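/- Let $n\ge 2$ and let $\mathbb H^n=\{x\in\mathbb R^n: x_n>0\}$ be the half-space model of hyperbolic space, with metric $\bar g=x_n^{-2}\delta$ and Levi-Civita connection $\bar\nabla$. Put $E_n=(0,\dots,0,1)$ and $X(x)=x-E_n$. Let $S\subset\mathbb H^n$ be one of the following support hypersurfaces: the horosphere $\{x_n=1\}$; an equidistant hypersurface $\{x_1\tan\theta+x_n=1\}$ with $0<\theta<\pi/2$; or the totally geodesic hyperplane $\{x_1=0\}$. Let $\Sigma$ be a compact smooth immersed hypersurface of $\mathbb H^n$, with (possibly empty) boundary $\partial\Sigma$ and with a smooth unit normal field $\nu$, such that $\partial\Sigma$ lies on $S$ and $\Sigma$ meets $S$ orthogonally along $\partial\Sigma$, that is, $\bar g(\nu,\bar N)=0$ on $\partial\Sigma$, where $\bar N$ is a unit normal of $S$. Let $\kappa_1,\dots,\kappa_{n-1}$ be the principal curvatures of $\Sigma$, that is, the eigenvalues of $h(Y,Z)=\bar g(\bar\nabla_Y\nu,Z)$ with respect to the induced metric, and let $H_r=\binom{n-1}{r}^{-1}\sum_{i_1<\dots<i_r}\kappa_{i_1}\cdots\kappa_{i_r}$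 for $1\le r\le n-1$ and $H_0=1$. Let $dA$ be the area measure of the induced metric. Then, for every $k=1,\dots,n-1$, the functions $H_{k-1}/x_n$ and $H_k\,\bar g(X,\nu)$ are integrable on $\Sigma$ and $$\int_\Sigma \frac{H_{k-1}}{x_n}\,dA=\int_\Sigma H_k\,\bar g(X,\nu)\,dA .$$ -/

import Mathlib

open scoped Manifold ContDiff ENNReal
open MeasureTheory

noncomputable section

namespace HalfSpace

/-- The coordinate space `ℝⁿ` with `n = m + 1`. Hyperbolic space `ℍⁿ` is its open subset
`{x | 0 < xₙ}` (half-space model), where `xₙ` is the last coordinate. -/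
abbrev Coord (m : ℕ) : Type := EuclideanSpace ℝ (Fin (m + 1))

/-- The last coordinate `xₙ`. -/
def height {m : ℕ} (x : Coord m) : ℝ := x (Fin.last m)

/-- The first Euclidean basis vector `E₁`. -/
def E₁ (m : ℕ) : Coord m := EuclideanSpace.single 0 1

/-- The last Euclidean basis vector `Eₙ`, also regarded as the point `(0, …, 0, 1)`. -/
def Eₙ (m : ℕ) : Coord m := EuclideanSpace.single (Fin.last m) 1

/-- The hyperbolic metric `ḡ = xₙ⁻² δ` at the point `x`. -/
def metric {m : ℕ} (x u v : Coord m) : ℝ := inner ℝ u v / height x ^ 2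

/-- The Christoffel term `Γ_x(u, v)` of the Levi-Civita connection of `ḡ`, so that
`∇̄_Y Z = D_Y Z + Γ(Y, Z)` where `D` is the flat connection; with `φ = -ln xₙ` this is
`Γ(Y, Z) = Y(φ) Z + Z(φ) Y - ⟨Y, Z⟩ Dφ`. -/
def christoffel {m : ℕ} (x u v : Coord m) : Coord m :=
  -(height u / height x) • v - (height v / height x) • u + (inner ℝ u v / height x) • Eₙ m

/-- The connection `D + Γ` is torsion free. -/
theorem christoffel_symm {m : ℕ} (x u v : Coord m) :
    christoffel x u v = christoffel x v u := by
  simp only [christoffel, real_inner_comm u v, neg_smul]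
  abel

theorem inner_Eₙ {m : ℕ} (u : Coord m) : inner ℝ (Eₙ m) u = height u := by
  simp [Eₙ, height, EuclideanSpace.inner_single_left]

/-- The connection `D + Γ` is compatible with `ḡ`: the derivative of `x ↦ ḡ_x(v, w)` in the
direction `u`, for constant `v, w`, is `ḡ(Γ(u, v), w) + ḡ(v, Γ(u, w))`. -/
theorem christoffel_compatible {m : ℕ} {x : Coord m} (hx : 0 < height x) (u v w : Coord m) :
    HasDerivAt (fun t : ℝ => metric (x + t • u) v w)
      (metric x (christoffel x u v) w + metric x v (christoffel x u w)) 0 := by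
  have hlin : HasDerivAt (fun t : ℝ => height x + t * height u) (height u) 0 := by
    simpa using ((hasDerivAt_id (0 : ℝ)).mul_const (height u)).const_add (height x)
  have h2 := ((hlin.pow 2).inv (by simpa using hx.ne')).const_mul (inner ℝ v w)
  have e : (fun t : ℝ => metric (x + t • u) v w)
      = fun t : ℝ => inner ℝ v w * ((fun t : ℝ => height x + t * height u) ^ 2)⁻¹ t := by
    funext t
    simp [metric, height, div_eq_mul_inv]
  rw [e]
  refine h2.congr_deriv ?_
  have hx' := hx.ne'
  simp only [metric, christoffel, inner_add_left, inner_sub_left, inner_add_right,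
    inner_sub_right, real_inner_smul_left, real_inner_smul_right, inner_Eₙ,
    real_inner_comm (Eₙ m) v, Pi.pow_apply]
  rw [real_inner_comm v u, zero_mul, add_zero]
  field_simp
  norm_num
  ring

/-- The conformal Killing field `X = x - Eₙ`. -/
def X {m : ℕ} (x : Coord m) : Coord m := x - Eₙ m

/-- The support hypersurface through `Eₙ` that meets `∂_∞ ℍⁿ` at Euclidean angle `θ`, whose
principal curvature is `κ = cos θ`: the horosphere `xₙ = 1` for `θ = 0`, the equidistant
hypersurface `x₁ tan θ + xₙ = 1` for `0 < θ < π / 2`, and the totally geodesic hyperplane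
`x₁ = 0` for `θ = π / 2`. -/
def support (m : ℕ) (θ : ℝ) : Set (Coord m) :=
  {x | 0 < height x ∧ x 0 * Real.sin θ + height x * Real.cos θ = Real.cos θ}

theorem support_zero (m : ℕ) : support m 0 = {x | height x = 1} := by
  ext x
  simp only [support, Set.mem_ofPred_eq, Real.sin_zero, Real.cos_zero]
  constructor
  · rintro ⟨-, h⟩
    linarith
  · intro h
    constructor <;> linarith

theorem support_of_lt (m : ℕ) {θ : ℝ} (h0 : 0 < θ) (h1 : θ < Real.pi / 2) :
    support m θ = {x | 0 < height x ∧ x 0 * Real.tan θ + height x = 1} := by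
  have hc : Real.cos θ ≠ 0 := (Real.cos_pos_of_mem_Ioo ⟨by linarith, h1⟩).ne'
  ext x
  simp only [support, Set.mem_ofPred_eq, Real.tan_eq_sin_div_cos]
  refine and_congr_right fun _ => ?_
  constructor
  · intro h
    field_simp
    linarith
  · intro h
    field_simp at h
    linarith

theorem support_pi_div_two (m : ℕ) :
    support m (Real.pi / 2) = {x | 0 < height x ∧ x 0 = 0} := by
  simp [support]

/-- The unit normal `N̄` of `support m θ` with respect to `ḡ`, in the direction
`-(sin θ, 0, …, 0, cos θ)`. -/
def supportNormal (m : ℕ) (θ : ℝ) (x : Coord m) : Coord m :=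
  -height x • (Real.sin θ • E₁ m + Real.cos θ • Eₙ m)

section Hypersurface

variable {m : ℕ} [NeZero m] {M : Type*} [TopologicalSpace M]
  [ChartedSpace (EuclideanHalfSpace m) M]

/-- `f : M → ℍⁿ` is a smooth immersion of the `(n-1)`-dimensional manifold with boundary `M`, and
`ν` is a smooth unit normal field along `f`. -/
structure IsHypersurface (f ν : M → Coord m) : Prop where
  smooth : ContMDiff (𝓡∂ m) 𝓘(ℝ, Coord m) ∞ f
  height_pos : ∀ p, 0 < height (f p)
  immersion : ∀ p, Function.Injective (mfderiv (𝓡∂ m) 𝓘(ℝ, Coord m) f p)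
  smooth_normal : ContMDiff (𝓡∂ m) 𝓘(ℝ, Coord m) ∞ ν
  unit : ∀ p, metric (f p) (ν p) (ν p) = 1
  normal : ∀ p v, metric (f p) (ν p) (mfderiv (𝓡∂ m) 𝓘(ℝ, Coord m) f p v) = 0

/-- The boundary of the hypersurface lies on the support hypersurface of angle `θ`, and the two
hypersurfaces are orthogonal there: `ḡ(ν, N̄) = 0`. -/
structure MeetsOrthogonally (f ν : M → Coord m) (θ : ℝ) : Prop where
  boundary_mem : ∀ p ∈ (𝓡∂ m).boundary M, f p ∈ support m θ
  orthogonal : ∀ p ∈ (𝓡∂ m).boundary M, metric (f p) (ν p) (supportNormal m θ (f p)) = 0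

/-- The `i`-th coordinate vector of `T_p M`, in the preferred chart at `p`. -/
def coordVector (p : M) (i : Fin m) : TangentSpace (𝓡∂ m) p :=
  (EuclideanSpace.single i 1 : EuclideanSpace ℝ (Fin m))

/-- The covariant derivative `∇̄_v ν` of a vector field `ν` along `f`, for `v ∈ T_p M`. -/
def covDeriv (f ν : M → Coord m) (p : M) (v : TangentSpace (𝓡∂ m) p) : Coord m :=
  let dν : Coord m := mfderiv (𝓡∂ m) 𝓘(ℝ, Coord m) ν p v
  let df : Coord m := mfderiv (𝓡∂ m) 𝓘(ℝ, Coord m) f p v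
  dν + christoffel (f p) df (ν p)

/-- The induced metric at `p`, as a Gram matrix. -/
def firstForm (f : M → Coord m) (p : M) : Matrix (Fin m) (Fin m) ℝ :=
  Matrix.of fun i j => metric (f p)
    (mfderiv (𝓡∂ m) 𝓘(ℝ, Coord m) f p (coordVector p i))
    (mfderiv (𝓡∂ m) 𝓘(ℝ, Coord m) f p (coordVector p j))

/-- The second fundamental form `h(v, w) = ḡ(∇̄_v ν, w)` at `p`, as a matrix. -/
def secondForm (f ν : M → Coord m) (p : M) : Matrix (Fin m) (Fin m) ℝ :=
  Matrix.of fun i j => metric (f p)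
    (covDeriv f ν p (coordVector p i))
    (mfderiv (𝓡∂ m) 𝓘(ℝ, Coord m) f p (coordVector p j))

/-- The principal curvatures at `p`: the eigenvalues, with multiplicity, of the second fundamental
form relative to the induced metric. -/
def principalCurvatures (f ν : M → Coord m) (p : M) : Multiset ℝ :=
  ((firstForm f p)⁻¹ * secondForm f ν p).charpoly.roots

/-- The normalized `r`-th mean curvature `H_r = S_r / binom(n-1, r)`, where `S_r` is the `r`-th
elementary symmetric function of the principal curvatures. -/
def meanCurvature (f ν : M → Coord m) (r : ℕ) (p : M) : ℝ :=
  (principalCurvatures f ν p).esymm r / (m.choose r : ℝ)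

/-- The area density `√(det ḡ(∂ᵢψ, ∂ⱼψ))` of the local parametrization `ψ = f ∘ φ⁻¹`, where `φ` is
the preferred chart at `p`. -/
def areaDensity (f : M → Coord m) (p : M) (u : EuclideanSpace ℝ (Fin m)) : ℝ :=
  let ψ : EuclideanSpace ℝ (Fin m) → Coord m := f ∘ (extChartAt (𝓡∂ m) p).symm
  let dψ := fderivWithin ℝ ψ (Set.range (𝓡∂ m)) u
  Real.sqrt (Matrix.of fun i j : Fin m => metric (ψ u)
    (dψ (EuclideanSpace.single i 1)) (dψ (EuclideanSpace.single j 1))).det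

variable [MeasurableSpace M]

/-- The area measure of the domain of the preferred chart at `p`, regarded as a measure on `M` that
vanishes outside that domain. -/
def chartArea (f : M → Coord m) (p : M) : Measure M :=
  ((volume.restrict (extChartAt (𝓡∂ m) p).target).withDensity
    fun u => ENNReal.ofReal (areaDensity f p u)).map (extChartAt (𝓡∂ m) p).symm

/-- The area measure `dA` of the hypersurface: the least measure on `M` that dominates the area
measures of all chart domains. (By change of variables those measures agree on overlaps, so this
is the measure that restricts to `chartArea f p` on the chart domain at each `p`.) -/
def area (f : M → Coord m) : Measure M := ⨆ p, chartArea f p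

end Hypersurface

end HalfSpace

end

/-! Let `A` be the shape operator and `T_t = adj(1 + t A)` for a real parameter `t`. The
coefficients of `T_t` in powers of `t` are the Newton tensors of `A`, up to sign, so one parameter
treats every `k` at once. The theorem is the divergence theorem for the tangent field `T_t Xᵀ`,
followed by comparison of coefficients in `t`.

The divergence is `tr T_t / xₙ - ḡ(X, ν) tr(T_t A)`. Indeed `T_t` is divergence free by the Codazzi
equation, which holds because `ℍⁿ` has constant curvature. Moreover `∇̄_v X` is `v / xₙ` plus a term
skew in `v`, whose trace against the self-adjoint `T_t` is zero. The normal part of `X` gives the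
second summand. At the boundary the flux vanishes. The support hypersurface is a piece of a
Euclidean hyperplane through `Eₙ`, so `X` is tangent to it, and orthogonality makes the conormal of
the boundary a principal direction.

Neither the induced connection nor the curvature tensor appears. With `ψ_j` the coordinate frame,
`a_j = ∇̄_j ν` and `e_j = ψ_j + t a_j`, the `i`-th component of `T_t Xᵀ` times the signed area
density is the hyperbolic volume of `ν, e_1, …, e_m` with `e_i` replaced by `X`. The hyperbolic
volume form is parallel, so this determinant is differentiated column by column with covariant
derivatives. Since `∇̄_i e_j` is symmetric in `i, j` (torsion-freeness and Codazzi), the terms that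
differentiate some `e_j` cancel in pairs when summed over `i` (`sum_flux_derivative`,
`LocalHypersurface.hasFDerivAt_flux`). On the boundary all columns of the relevant determinant lie
in one hyperplane (`flux_boundary`).

The local identities are globalized by a partition of unity. Chart by chart, the divergence theorem
on a half space applies to `ρ T_t Xᵀ` (`setIntegral_chartDivergence`); the terms with `dρ` add up to
zero because the functions `ρ` add up to one (`integral_divergence_eq_zero`). Finally `det(1 + t A)
= ∑ S_k t^k`, Jacobi's formula and `adj(B) B = det B` express both traces through the `S_k`
(`divergence_eq_sum`), and a polynomial in `t` that vanishes identically has zero coefficients. -/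

noncomputable section

namespace HalfSpace

open scoped Matrix Topology

/-! ### Determinants with a normal column, and the pointwise divergence identity. -/

section LinearAlgebra

variable {m : ℕ}

/-- The Euclidean volume form of `ℝⁿ`. -/
def vol (m : ℕ) : Coord m [⋀^Fin (m + 1)]→ₗ[ℝ] ℝ :=
  (EuclideanSpace.basisFun (Fin (m + 1)) ℝ).toBasis.det

theorem vol_apply (v : Fin (m + 1) → Coord m) :
    vol m v = (Matrix.of fun i j => v j i).det := by
  rw [vol, Module.Basis.det_apply]
  congr 1

theorem vol_sq (v : Fin (m + 1) → Coord m) :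
    vol m v ^ 2 = (Matrix.of fun i j => inner ℝ (v i) (v j)).det := by
  have h : (Matrix.of fun i j => inner ℝ (v i) (v j))
      = (Matrix.of fun i j => v j i)ᵀ * (Matrix.of fun i j => v j i) := by
    ext i j
    simp [Matrix.mul_apply, PiLp.inner_apply, mul_comm]
  rw [h, Matrix.det_mul, Matrix.det_transpose, vol_apply, sq]

/-- Cramer's rule in a form that also makes sense for dependent `v`. Pairing it with a suitable
vector replaces arguments by bases below. -/
theorem sum_vol_update_smul (v : Fin (m + 1) → Coord m) (u : Coord m) :
    ∑ j, vol m (Function.update v j u) • v j = vol m v • u := by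
  have h : ∀ j, vol m (Function.update v j u)
      = (Matrix.of fun i j => v j i).cramer (fun i => u i) j := by
    intro j
    rw [vol_apply, Matrix.cramer_apply]
    congr 1
    ext i k
    by_cases hk : k = j
    · subst hk; simp
    · simp [hk]
  have h2 := Matrix.mulVec_cramer (Matrix.of fun i j => v j i) (fun i => u i)
  ext i
  have h3 := congrFun h2 i
  simp only [Matrix.mulVec, dotProduct, Matrix.of_apply, Pi.smul_apply, smul_eq_mul] at h3
  simp only [h, vol_apply]
  rw [PiLp.smul_apply, smul_eq_mul, ← h3]
  simp [mul_comm]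

/-- The left side is the trace of `Γ(u, ·)` times the volume. The factor on the right is the
logarithmic derivative of `xₙ ^ -(m + 1)` in the direction `u`, so the hyperbolic volume form is
parallel. -/
theorem sum_vol_update_christoffel (x u : Coord m) (v : Fin (m + 1) → Coord m) :
    ∑ j, vol m (Function.update v j (christoffel x u (v j)))
      = -((m + 1 : ℝ) * (height u / height x)) * vol m v := by
  have hj : ∀ j, vol m (Function.update v j (christoffel x u (v j)))
      = -(height u / height x) * vol m v
        - (height (vol m (Function.update v j u) • v j) / height x)
        + inner ℝ u (vol m (Function.update v j (Eₙ m)) • v j) / height x := by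
    intro j
    simp only [christoffel, sub_eq_add_neg, ← neg_smul, AlternatingMap.map_update_add,
      AlternatingMap.map_update_smul, Function.update_eq_self, smul_eq_mul, inner_smul_right]
    simp only [height, PiLp.smul_apply, smul_eq_mul]
    ring
  have hh : ∀ w : Fin (m + 1) → Coord m, ∑ j, height (w j) = height (∑ j, w j) := by
    intro w; simp [height]
  simp only [hj, Finset.sum_add_distrib, Finset.sum_sub_distrib, ← Finset.sum_div, ← inner_sum, hh,
    sum_vol_update_smul]
  rw [inner_smul_right, real_inner_comm, inner_Eₙ]
  simp [height]
  ring

/-- The vectors of an `m`-tuple, preceded by `ν`. -/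
abbrev frameCons (ν : Coord m) (e : Fin m → Coord m) : Fin (m + 1) → Coord m :=
  Fin.cons (α := fun _ => Coord m) ν e

/-- Contracting the volume form with `ν` and pulling back along `ψ` gives an alternating `m`-form on
`ℝᵐ`, hence a multiple of the determinant. -/
theorem vol_cons_combination (ν : Coord m) (ψ : Fin m → Coord m) (B : Matrix (Fin m) (Fin m) ℝ) :
    vol m (frameCons ν fun j => Fintype.linearCombination ℝ ψ (fun k => B k j))
      = B.det * vol m (frameCons ν ψ) := by
  have h := AlternatingMap.eq_smul_basis_det (Pi.basisFun ℝ (Fin m))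
    (((vol m).curryLeft ν).compLinearMap (Fintype.linearCombination ℝ ψ))
  have h1 := congrArg (fun F => F fun j k => B k j) h
  simp only [AlternatingMap.compLinearMap_apply, AlternatingMap.smul_apply] at h1
  have h2 : (Pi.basisFun ℝ (Fin m)).det (fun j k => B k j) = B.det := by
    rw [Module.Basis.det_apply]; congr 1
  rw [h2] at h1
  simp only [AlternatingMap.curryLeft_apply_apply, Pi.basisFun_apply,
    Fintype.linearCombination_apply_single, one_smul, Matrix.vecCons] at h1
  rw [mul_comm]
  simpa using h1

/-- Cramer's rule inside the tangent space: the normal component `c • ν` repeats the zeroth column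
and drops out. This turns the flux determinant into a component of `adj(B) Xᵀ`. -/
theorem vol_cons_update (ν : Coord m) (ψ : Fin m → Coord m) (B : Matrix (Fin m) (Fin m) ℝ)
    (i : Fin m) (c : ℝ) (w : Fin m → ℝ) :
    vol m (frameCons ν (Function.update (fun j => Fintype.linearCombination ℝ ψ (fun k => B k j)) i
        (Fintype.linearCombination ℝ ψ w + c • ν)))
      = (B.adjugate *ᵥ w) i * vol m (frameCons ν ψ) := by
  have h0 : vol m (frameCons ν (Function.update
      (fun j => Fintype.linearCombination ℝ ψ (fun k => B k j)) i ν)) = 0 := by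
    refine AlternatingMap.map_eq_zero_of_eq _ (i := 0) (j := i.succ) _ ?_ (Fin.succ_ne_zero i).symm
    simp [frameCons]
  have h1 : (fun j => Fintype.linearCombination ℝ ψ (fun k => B.updateCol i w k j))
      = Function.update (fun j => Fintype.linearCombination ℝ ψ (fun k => B k j)) i
        (Fintype.linearCombination ℝ ψ w) := by
    funext j
    by_cases hj : j = i
    · subst hj; simp
    · simp [hj]
  have h2 := vol_cons_combination ν ψ (B.updateCol i w)
  rw [h1] at h2
  unfold frameCons at *
  rw [Fin.cons_update] at h0 h2 ⊢
  rw [AlternatingMap.map_update_add, AlternatingMap.map_update_smul, h0, h2,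
    ← Matrix.cramer_eq_adjugate_mulVec, Matrix.cramer_apply]
  simp

/-- The Gram matrix, with respect to `metric x`, of the vectors `ψ`. -/
def gram (x : Coord m) (ψ : Fin m → Coord m) : Matrix (Fin m) (Fin m) ℝ :=
  Matrix.of fun i j => metric x (ψ i) (ψ j)

theorem metric_comm (x u v : Coord m) : metric x u v = metric x v u := by
  simp only [metric, real_inner_comm]

theorem metric_add_left (x u v w : Coord m) : metric x (u + v) w = metric x u w + metric x v w := by
  simp only [metric, inner_add_left, add_div]

theorem metric_smul_left (x : Coord m) (c : ℝ) (u v : Coord m) :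
    metric x (c • u) v = c * metric x u v := by
  simp only [metric, real_inner_smul_left, mul_div_assoc]

theorem metric_add_right (x u v w : Coord m) : metric x u (v + w) = metric x u v + metric x u w := by
  simp only [metric, inner_add_right, add_div]

theorem metric_smul_right (x : Coord m) (c : ℝ) (u v : Coord m) :
    metric x u (c • v) = c * metric x u v := by
  simp only [metric, real_inner_smul_right, mul_div_assoc]

theorem metric_sum_left (x : Coord m) {ι : Type*} (s : Finset ι) (u : ι → Coord m) (v : Coord m) :
    metric x (∑ i ∈ s, u i) v = ∑ i ∈ s, metric x (u i) v := by
  simp only [metric, sum_inner, Finset.sum_div]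

/-- The Gram matrix of `ν, ψ` with respect to `ḡ` is block diagonal with blocks `1` and `gram x ψ`;
the power of the height accounts for `ḡ = xₙ⁻² δ` in `m + 1` rows. -/
theorem sq_vol_cons {x ν : Coord m} (hx : 0 < height x) {ψ : Fin m → Coord m}
    (hν : metric x ν ν = 1) (hψ : ∀ j, metric x ν (ψ j) = 0) :
    ((height x ^ (m + 1))⁻¹ * vol m (frameCons ν ψ)) ^ 2 = (gram x ψ).det := by
  have h1 : (Matrix.of fun i j => inner ℝ (frameCons ν ψ i) (frameCons ν ψ j))
      = (height x ^ 2) • (Matrix.of fun i j => metric x (frameCons ν ψ i) (frameCons ν ψ j)) := by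
    ext i j
    simp only [Matrix.smul_apply, Matrix.of_apply, metric, smul_eq_mul]
    field_simp
  have h2 : (Matrix.of fun i j => metric x (frameCons ν ψ i) (frameCons ν ψ j)).det
      = (gram x ψ).det := by
    rw [Matrix.det_succ_row_zero, Fin.sum_univ_succ]
    simp only [Matrix.of_apply, Fin.cons_zero, hν, Fin.cons_succ, hψ]
    simp only [Fin.val_zero, pow_zero, mul_one, mul_zero, zero_mul, Finset.sum_const_zero, add_zero,
      one_mul]
    congr 1
  rw [mul_pow, vol_sq, h1, Matrix.det_smul, h2]
  simp only [Fintype.card_fin]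
  field_simp
  ring

theorem gram_det_pos {x ν : Coord m} (hx : 0 < height x) {ψ : Fin m → Coord m}
    (hν : metric x ν ν = 1) (hψ : ∀ j, metric x ν (ψ j) = 0)
    (hvol : vol m (frameCons ν ψ) ≠ 0) : 0 < (gram x ψ).det := by
  rw [← sq_vol_cons hx hν hψ]
  positivity

theorem vol_cons_ne_zero {x ν : Coord m} {ψ : Fin m → Coord m}
    (hν : metric x ν ν = 1) (hψ : ∀ j, metric x ν (ψ j) = 0) (hli : LinearIndependent ℝ ψ) :
    vol m (frameCons ν ψ) ≠ 0 := by
  have hspan : ν ∉ Submodule.span ℝ (Set.range ψ) := by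
    intro h
    have : metric x ν ν = 0 := by
      refine Submodule.span_induction (p := fun w _ => metric x ν w = 0) ?_ ?_ ?_ ?_ h
      · rintro _ ⟨j, rfl⟩; exact hψ j
      · simp [metric]
      · intro u v _ _ hu hv; rw [metric_add_right, hu, hv, add_zero]
      · intro c u _ hu; rw [metric_smul_right, hu, mul_zero]
    linarith
  have hli' : LinearIndependent ℝ (frameCons ν ψ) := linearIndependent_finCons.2 ⟨hli, hspan⟩
  have hb : IsUnit ((EuclideanSpace.basisFun (Fin (m + 1)) ℝ).toBasis.det (frameCons ν ψ)) := by
    rw [← Module.Basis.is_basis_iff_det]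
    refine ⟨hli', ?_⟩
    apply hli'.span_eq_top_of_card_eq_finrank
    simp
  exact hb.ne_zero

theorem eq_zero_of_metric_eq_zero {x ν : Coord m} (hx : 0 < height x) {ψ : Fin m → Coord m}
    (hvol : vol m (frameCons ν ψ) ≠ 0) {d : Coord m} (h0 : metric x d ν = 0)
    (h : ∀ j, metric x d (ψ j) = 0) : d = 0 := by
  have h1 := sum_vol_update_smul (frameCons ν ψ) d
  have h2 : metric x d (vol m (frameCons ν ψ) • d) = 0 := by
    rw [← h1, metric_comm, metric_sum_left]
    refine Finset.sum_eq_zero fun j _ => ?_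
    rw [metric_smul_left, metric_comm]
    refine Fin.cases ?_ (fun j => ?_) j
    · simp [h0]
    · simp [h]
  rw [metric_smul_right, mul_eq_zero, or_iff_right hvol, metric, div_eq_zero_iff,
    or_iff_left (by positivity)] at h2
  exact inner_self_eq_zero.1 h2

/-- The decomposition of a vector into its tangential and normal parts. -/
theorem eq_combination_add_normal {x ν : Coord m} (hx : 0 < height x) {ψ : Fin m → Coord m}
    (hν : metric x ν ν = 1) (hψ : ∀ j, metric x ν (ψ j) = 0)
    (hvol : vol m (frameCons ν ψ) ≠ 0) (w : Coord m) :
    w = Fintype.linearCombination ℝ ψ ((gram x ψ)⁻¹ *ᵥ fun j => metric x w (ψ j))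
      + metric x w ν • ν := by
  set c := (gram x ψ)⁻¹ *ᵥ fun j => metric x w (ψ j)
  have hc : gram x ψ *ᵥ c = fun j => metric x w (ψ j) := by
    rw [Matrix.mulVec_mulVec, Matrix.mul_nonsing_inv _ (gram_det_pos hx hν hψ hvol).ne'.isUnit,
      Matrix.one_mulVec]
  have hd : w + (-1 : ℝ) • (Fintype.linearCombination ℝ ψ c + metric x w ν • ν) = 0 := by
    refine eq_zero_of_metric_eq_zero hx hvol ?_ fun j => ?_
    · have hψ' : ∀ j, metric x (ψ j) ν = 0 := fun j => by rw [metric_comm, hψ]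
      simp only [Fintype.linearCombination_apply, metric_add_left, metric_smul_left,
        metric_sum_left, hν, hψ']
      simp
    · have := congrFun hc j
      simp only [Matrix.mulVec, dotProduct, gram, Matrix.of_apply] at this
      simp only [Fintype.linearCombination_apply, metric_add_left, metric_smul_left,
        metric_sum_left, hψ, ← this]
      simp [mul_comm, metric_comm]
  rw [neg_smul, one_smul, ← sub_eq_add_neg, sub_eq_zero] at hd
  exact hd

theorem vol_eq_zero_of_inner_eq_zero {v : Fin (m + 1) → Coord m} {n : Coord m} (hn : n ≠ 0)
    (h : ∀ j, inner ℝ n (v j) = 0) : vol m v = 0 := by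
  have h1 := congrArg (fun w => inner ℝ n w) (sum_vol_update_smul v n)
  simp only [inner_sum, inner_smul_right, h, mul_zero, Finset.sum_const_zero] at h1
  rcases mul_eq_zero.1 h1.symm with h2 | h2
  · exact h2
  · exact absurd (inner_self_eq_zero.1 h2) hn

theorem vol_cons_update_swap (a ν : Coord m) (e : Fin m → Coord m) (i : Fin m) :
    vol m (frameCons a (Function.update e i ν))
      = -vol m (frameCons ν (Function.update e i a)) := by
  have h := (vol m).map_swap (frameCons ν (Function.update e i a))
    (i := 0) (j := i.succ) (Fin.succ_ne_zero i).symm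
  rw [← h]
  congr 1
  funext j
  refine Fin.cases ?_ (fun j => ?_) j
  · simp [frameCons]
  · by_cases hj : j = i
    · subst hj
      rw [Function.comp_apply, Equiv.swap_apply_right]
      simp only [frameCons, Fin.cons_succ, Function.update_self, Fin.cons_zero]
    · rw [Function.comp_apply, Equiv.swap_apply_of_ne_of_ne (Fin.succ_ne_zero j)
        (fun h => hj (Fin.succ_injective _ h))]
      simp [frameCons, hj]

theorem vol_cons_update_update_swap (ν X : Coord m) (e : Fin m → Coord m) (z : Coord m)
    {i j : Fin m} (hij : i ≠ j) :
    vol m (frameCons ν (Function.update (Function.update e j X) i z))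
      = -vol m (frameCons ν (Function.update (Function.update e i X) j z)) := by
  have h := (vol m).map_swap (frameCons ν (Function.update (Function.update e i X) j z))
    (i := i.succ) (j := j.succ) (fun h => hij (Fin.succ_injective _ h))
  rw [← h]
  congr 1
  funext l
  refine Fin.cases ?_ (fun l => ?_) l
  · rw [Function.comp_apply, Equiv.swap_apply_of_ne_of_ne (Fin.succ_ne_zero i).symm
      (Fin.succ_ne_zero j).symm]
    simp [frameCons]
  · by_cases hi : l = i
    · subst hi; simp [frameCons]
    by_cases hj : l = j
    · subst hj
      rw [Function.comp_apply, Equiv.swap_apply_right]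
      simp only [frameCons, Fin.cons_succ, Function.update_self, Function.update_of_ne hi,
        Function.update_of_ne hij]
    · rw [Function.comp_apply, Equiv.swap_apply_of_ne_of_ne
        (fun h => hi (Fin.succ_injective _ h)) (fun h => hj (Fin.succ_injective _ h))]
      simp [frameCons, hi, hj]

/-- Exchanging `i` and `j` swaps two columns, which changes the sign, while `z` stays the same. With
`z` the covariant derivatives of the columns, this is the statement that the Newton tensors are
divergence free. -/
theorem sum_sum_vol_update_update (ν X : Coord m) (e : Fin m → Coord m)
    {z : Fin m → Fin m → Coord m} (hz : ∀ i j, z i j = z j i) :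
    ∑ i, ∑ j, (if j = i then 0 else
      vol m (frameCons ν (Function.update (Function.update e i X) j (z i j)))) = 0 := by
  have h : ∑ i, ∑ j, (if j = i then 0 else
      vol m (frameCons ν (Function.update (Function.update e i X) j (z i j))))
      = -∑ i, ∑ j, (if j = i then 0 else
      vol m (frameCons ν (Function.update (Function.update e i X) j (z i j)))) := by
    conv_lhs => rw [Finset.sum_comm]
    simp only [← Finset.sum_neg_distrib]
    refine Finset.sum_congr rfl fun i _ => Finset.sum_congr rfl fun j _ => ?_
    by_cases hij : i = j
    · simp [hij]
    · rw [if_neg hij, if_neg (Ne.symm hij), hz j i, vol_cons_update_update_swap _ _ _ _ hij]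
  linarith

theorem trace_symm_mul_skew {S K : Matrix (Fin m) (Fin m) ℝ} (hS : Sᵀ = S) (hK : Kᵀ = -K) :
    (S * K).trace = 0 := by
  have h : (S * K).trace = -(S * K).trace := by
    conv_lhs => rw [← Matrix.trace_transpose, Matrix.transpose_mul, hS, hK, Matrix.trace_mul_comm]
    simp
  linarith

/-- `B = 1 + t g⁻¹ h` is self-adjoint for `g`, that is `Bᵀ = g B g⁻¹`, and the adjugate is
antimultiplicative. Invertibility of `B` is not needed, so no value of `t` has to be excluded. -/
theorem adjugate_mul_inv_transpose {g h : Matrix (Fin m) (Fin m) ℝ} (hg : IsUnit g.det)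
    (hgt : gᵀ = g) (hht : hᵀ = h) (t : ℝ) :
    ((1 + t • (g⁻¹ * h)).adjugate * g⁻¹)ᵀ = (1 + t • (g⁻¹ * h)).adjugate * g⁻¹ := by
  have h1 : (1 + t • (g⁻¹ * h))ᵀ * g = g * (1 + t • (g⁻¹ * h)) := by
    rw [Matrix.transpose_add, Matrix.transpose_smul, Matrix.transpose_mul, hht,
      Matrix.transpose_nonsing_inv, hgt, Matrix.add_mul, Matrix.mul_add, Matrix.smul_mul,
      Matrix.mul_smul, Matrix.mul_assoc, Matrix.nonsing_inv_mul _ hg,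
      Matrix.mul_nonsing_inv_cancel_left _ _ hg]
    simp
  have h2 : (1 + t • (g⁻¹ * h))ᵀ = g * (1 + t • (g⁻¹ * h)) * g⁻¹ := by
    rw [← h1, Matrix.mul_assoc, Matrix.mul_nonsing_inv _ hg, Matrix.mul_one]
  have h3 : g⁻¹.adjugate * g.adjugate = 1 := by
    rw [← Matrix.adjugate_mul_distrib, Matrix.mul_nonsing_inv _ hg, Matrix.adjugate_one]
  have h4 : g⁻¹.adjugate = g⁻¹.det • g := by
    have := Matrix.adjugate_mul g⁻¹
    calc g⁻¹.adjugate = g⁻¹.adjugate * (g⁻¹ * g) := by rw [Matrix.nonsing_inv_mul _ hg, mul_one]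
      _ = _ := by rw [← Matrix.mul_assoc, this]; simp
  have h5 : g.adjugate = g.det • g⁻¹ := by
    calc g.adjugate = g.adjugate * (g * g⁻¹) := by rw [Matrix.mul_nonsing_inv _ hg, mul_one]
      _ = _ := by rw [← Matrix.mul_assoc, Matrix.adjugate_mul]; simp
  have h6 : g⁻¹.det * g.det = 1 := by rw [← Matrix.det_mul, Matrix.nonsing_inv_mul _ hg]; simp
  rw [Matrix.transpose_mul, Matrix.transpose_nonsing_inv, hgt, Matrix.adjugate_transpose, h2,
    Matrix.adjugate_mul_distrib, Matrix.adjugate_mul_distrib, h4, h5]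
  simp only [Matrix.smul_mul, Matrix.mul_smul, smul_smul]
  rw [mul_comm, h6, one_smul, Matrix.nonsing_inv_mul_cancel_left _ _ hg]

/-- This is the conformal Killing property of `X`: the left side is `∇̄_v X`, and the last bracket
is a skew endomorphism in `v`. -/
theorem christoffel_X_add {x : Coord m} (hx : 0 < height x) (v : Coord m) :
    v + christoffel x v (X x) = (height x)⁻¹ • v
      + ((inner ℝ v x / height x) • Eₙ m - (height v / height x) • x) := by
  have h1 : height (X x) = height x - 1 := by simp [X, height, Eₙ]
  have h2 : inner ℝ v (X x) = inner ℝ v x - height v := by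
    rw [X, inner_sub_right, real_inner_comm (Eₙ m) v, inner_Eₙ]
  have h3 : v = (height x / height x) • v := by rw [div_self hx.ne', one_smul]
  nth_rw 1 [h3]
  rw [christoffel, h1, h2, X]
  simp only [smul_sub, neg_smul, div_eq_mul_inv, sub_smul, one_mul, sub_mul]
  abel

/-- The shape vectors `a` are the images of the coordinate frame `ψ` under the shape operator. -/
theorem shape_eq_combination {x ν : Coord m} (hx : 0 < height x) {ψ a : Fin m → Coord m}
    (hν : metric x ν ν = 1) (hψ : ∀ j, metric x ν (ψ j) = 0)
    (hvol : vol m (frameCons ν ψ) ≠ 0) (ha : ∀ j, metric x (a j) ν = 0)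
    (hsymm : ∀ i j, metric x (a i) (ψ j) = metric x (a j) (ψ i))
    {A : Matrix (Fin m) (Fin m) ℝ}
    (hA : A = (gram x ψ)⁻¹ * Matrix.of fun i j => metric x (a i) (ψ j)) (j : Fin m) :
    a j = Fintype.linearCombination ℝ ψ (fun k => A k j) := by
  have h1 := eq_combination_add_normal hx hν hψ hvol (a j)
  rw [ha, zero_smul, add_zero] at h1
  rw [h1]
  congr 1
  funext k
  simp only [Matrix.mulVec, dotProduct, hA, Matrix.mul_apply, Matrix.of_apply, hsymm j]

theorem add_smul_shape_eq_combination {ψ a : Fin m → Coord m} {A : Matrix (Fin m) (Fin m) ℝ}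
    (haL : ∀ j, a j = Fintype.linearCombination ℝ ψ (fun k => A k j)) (t : ℝ) :
    (fun j => ψ j + t • a j)
      = fun j => Fintype.linearCombination ℝ ψ (fun k => (1 + t • A) k j) := by
  funext j
  have h1 : (fun k => (1 + t • A) k j) = Pi.single j 1 + t • fun k => A k j := by
    funext k
    simp [Matrix.one_apply, Pi.single_apply]
  rw [h1, map_add, map_smul, ← haL, Fintype.linearCombination_apply_single, one_smul]

theorem vol_cons_combination_update {x ν : Coord m} (hx : 0 < height x) {ψ : Fin m → Coord m}
    (hν : metric x ν ν = 1) (hψ : ∀ j, metric x ν (ψ j) = 0)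
    (hvol : vol m (frameCons ν ψ) ≠ 0) (B : Matrix (Fin m) (Fin m) ℝ) (i : Fin m) (w : Coord m) :
    vol m (frameCons ν
        (Function.update (fun j => Fintype.linearCombination ℝ ψ (fun k => B k j)) i w))
      = (B.adjugate *ᵥ ((gram x ψ)⁻¹ *ᵥ fun j => metric x w (ψ j))) i
        * vol m (frameCons ν ψ) := by
  conv_lhs => rw [eq_combination_add_normal hx hν hψ hvol w]
  rw [vol_cons_update]

/-- The divergence identity at a point, in terms of the frame `ψ`, the shape vectors `a` (the
covariant derivatives of the normal `ν`) and the covariant derivatives `z` of `ψ + t a`. -/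
theorem sum_flux_derivative {x ν : Coord m} (hx : 0 < height x) {ψ a : Fin m → Coord m}
    (hν : metric x ν ν = 1) (hψ : ∀ j, metric x ν (ψ j) = 0)
    (hvol : vol m (frameCons ν ψ) ≠ 0) (ha : ∀ j, metric x (a j) ν = 0)
    (hsymm : ∀ i j, metric x (a i) (ψ j) = metric x (a j) (ψ i)) (t : ℝ)
    {z : Fin m → Fin m → Coord m} (hz : ∀ i j, z i j = z j i) {g h : Matrix (Fin m) (Fin m) ℝ}
    (hg : g = gram x ψ) (hh : h = Matrix.of fun i j => metric x (a i) (ψ j)) :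
    ∑ i, (vol m (frameCons (a i) (Function.update (fun j => ψ j + t • a j) i (X x)))
      + ∑ j, vol m (frameCons ν (Function.update
          (Function.update (fun j => ψ j + t • a j) i (X x)) j
          (if j = i then ψ i + christoffel x (ψ i) (X x) else z i j))))
      = vol m (frameCons ν ψ) * ((height x)⁻¹ * (1 + t • (g⁻¹ * h)).adjugate.trace
          - metric x (X x) ν * ((1 + t • (g⁻¹ * h)).adjugate * (g⁻¹ * h)).trace) := by
  set A := g⁻¹ * h with hA
  set B := 1 + t • A with hB
  set V := vol m (frameCons ν ψ) with hV
  have hgdet : IsUnit g.det := hg ▸ (gram_det_pos hx hν hψ hvol).ne'.isUnit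
  have hgt : gᵀ = g := by
    rw [hg]; ext i j; simp [gram, metric_comm]
  have hht : hᵀ = h := by
    rw [hh]; ext i j; simpa using hsymm j i
  have haL := shape_eq_combination hx hν hψ hvol ha hsymm (A := A) (by rw [hA, hg, hh])
  rw [add_smul_shape_eq_combination haL t]
  set e := fun j => Fintype.linearCombination ℝ ψ (fun k => B k j) with he
  have hupd : ∀ i w, vol m (frameCons ν (Function.update e i w))
      = (B.adjugate *ᵥ (g⁻¹ *ᵥ fun j => metric x w (ψ j))) i * V := by
    intro i w
    rw [he, vol_cons_combination_update hx hν hψ hvol, hg]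
  -- When the zeroth column is differentiated, only the normal part of `X` survives: its tangential
  -- part would leave `m + 1` vectors in the tangent hyperplane. Exchanging `ν` with `a i` then
  -- gives the minus sign.
  have hfirst : ∀ i, vol m (frameCons (a i) (Function.update e i (X x)))
      = -(metric x (X x) ν * ((B.adjugate * A) i i * V)) := by
    intro i
    have hν0 : ν ≠ 0 := by
      rintro rfl
      simp [metric] at hν
    have hinner : ∀ w, metric x ν w = 0 → inner ℝ ν w = 0 := by
      intro w hw
      rw [metric, div_eq_zero_iff, or_iff_left (by positivity)] at hw
      exact hw
    have hLc : ∀ c, metric x ν (Fintype.linearCombination ℝ ψ c) = 0 := by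
      intro c
      rw [metric_comm, Fintype.linearCombination_apply, metric_sum_left]
      refine Finset.sum_eq_zero fun j _ => ?_
      rw [metric_smul_left, metric_comm, hψ, mul_zero]
    have h0 : ∀ c, vol m (frameCons (a i)
        (Function.update e i (Fintype.linearCombination ℝ ψ c))) = 0 := by
      intro c
      refine vol_eq_zero_of_inner_eq_zero hν0 fun j => hinner _ ?_
      refine Fin.cases ?_ (fun j => ?_) j
      · rw [frameCons, Fin.cons_zero, metric_comm, ha]
      · rw [frameCons, Fin.cons_succ]
        by_cases hj : j = i
        · subst hj; rw [Function.update_self]; exact hLc _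
        · rw [Function.update_of_ne hj]; exact hLc _
    have h1 := eq_combination_add_normal hx hν hψ hvol (X x)
    have h2 : vol m (frameCons ν (Function.update e i (a i))) = (B.adjugate * A) i i * V := by
      have := vol_cons_update ν ψ B i 0 (fun k => A k i)
      rw [zero_smul, add_zero, ← haL] at this
      rw [he, this]
      rfl
    set c := (gram x ψ)⁻¹ *ᵥ fun j => metric x (X x) (ψ j)
    conv_lhs => rw [h1]
    have h0c := h0 c
    unfold frameCons at h0c ⊢
    rw [Fin.cons_update] at h0c ⊢
    rw [AlternatingMap.map_update_add, AlternatingMap.map_update_smul, h0c, zero_add,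
      ← Fin.cons_update]
    have h3 := vol_cons_update_swap (a i) ν e i
    unfold frameCons at h3
    rw [h3, smul_eq_mul]
    unfold frameCons at h2
    rw [h2]
    ring
  -- The diagonal term differentiates `X` itself, since column `i` holds `X`; the remaining terms
  -- are those that cancel in pairs.
  have hsecond : ∀ i, ∑ j, vol m (frameCons ν (Function.update
          (Function.update e i (X x)) j
          (if j = i then ψ i + christoffel x (ψ i) (X x) else z i j)))
      = vol m (frameCons ν (Function.update e i (ψ i + christoffel x (ψ i) (X x))))
        + ∑ j, (if j = i then 0 else
          vol m (frameCons ν (Function.update (Function.update e i (X x)) j (z i j)))) := by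
    intro i
    have : ∀ j, vol m (frameCons ν (Function.update
          (Function.update e i (X x)) j
          (if j = i then ψ i + christoffel x (ψ i) (X x) else z i j)))
        = (if j = i then
            vol m (frameCons ν (Function.update e i (ψ i + christoffel x (ψ i) (X x)))) else 0)
          + (if j = i then 0 else
          vol m (frameCons ν (Function.update (Function.update e i (X x)) j (z i j)))) := by
      intro j
      by_cases hj : j = i
      · subst hj; simp
      · simp [hj]
    simp only [this, Finset.sum_add_distrib]
    simp
  -- `K` is the skew part of `∇̄X` in the frame. It contributes the trace of a symmetric matrix
  -- times `K`, which is zero.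
  set K : Matrix (Fin m) (Fin m) ℝ := Matrix.of fun k i =>
    metric x ((inner ℝ (ψ i) x / height x) • Eₙ m - (height (ψ i) / height x) • x) (ψ k) with hK
  have hKskew : Kᵀ = -K := by
    ext i k
    simp only [hK, Matrix.transpose_apply, Matrix.of_apply, Matrix.neg_apply, metric,
      inner_sub_left, real_inner_smul_left, inner_Eₙ, real_inner_comm x]
    ring
  have hw : ∀ i, vol m (frameCons ν (Function.update e i (ψ i + christoffel x (ψ i) (X x))))
      = ((height x)⁻¹ * B.adjugate i i + (B.adjugate * g⁻¹ * K) i i) * V := by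
    intro i
    have h1 : (fun j => metric x (ψ i + christoffel x (ψ i) (X x)) (ψ j))
        = (height x)⁻¹ • (g *ᵥ Pi.single i 1) + fun k => K k i := by
      funext k
      rw [christoffel_X_add hx, metric_add_left, metric_smul_left]
      simp [hg, gram, hK, metric_comm]
    rw [hupd, h1, Matrix.mulVec_add, Matrix.mulVec_smul, Matrix.mulVec_mulVec,
      Matrix.nonsing_inv_mul _ hgdet, Matrix.one_mulVec, Matrix.mulVec_add, Matrix.mulVec_smul,
      Matrix.mulVec_mulVec]
    simp only [Matrix.mulVec_single_one, Pi.add_apply, Pi.smul_apply, smul_eq_mul]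
    rfl
  simp only [hfirst, hsecond, hw, Finset.sum_add_distrib]
  rw [sum_sum_vol_update_update ν (X x) e hz, add_zero, Finset.sum_neg_distrib, ← Finset.mul_sum,
    ← Finset.sum_mul, ← Finset.sum_mul, Finset.sum_add_distrib, ← Finset.mul_sum]
  have ht : ∑ i, (B.adjugate * g⁻¹ * K) i i = 0 :=
    trace_symm_mul_skew (adjugate_mul_inv_transpose hgdet hgt hht t) hKskew
  rw [ht]
  simp only [Matrix.trace, Matrix.diag_apply]
  ring

end LinearAlgebra

/-! ### Differentiation of the flux of a parametrized hypersurface. -/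

section Calculus

variable {m : ℕ}

/-- The last coordinate as a continuous linear map. -/
def heightL (m : ℕ) : Coord m →L[ℝ] ℝ := EuclideanSpace.proj (Fin.last m)

theorem heightL_apply (x : Coord m) : heightL m x = height x := rfl

theorem height_add (u v : Coord m) : height (u + v) = height u + height v := rfl

theorem height_smul (c : ℝ) (v : Coord m) : height (c • v) = c * height v := rfl

theorem christoffel_add_right (x u v w : Coord m) :
    christoffel x u (v + w) = christoffel x u v + christoffel x u w := by
  simp only [christoffel, inner_add_right, height_add]
  module

theorem christoffel_smul_right (x u v : Coord m) (c : ℝ) :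
    christoffel x u (c • v) = c • christoffel x u v := by
  simp only [christoffel, inner_smul_right, height_smul]
  module

theorem christoffel_add_left (x u v w : Coord m) :
    christoffel x (u + v) w = christoffel x u w + christoffel x v w := by
  rw [christoffel_symm, christoffel_add_right, christoffel_symm x w, christoffel_symm x w]

theorem christoffel_smul_left (x u v : Coord m) (c : ℝ) :
    christoffel x (c • u) v = c • christoffel x u v := by
  rw [christoffel_symm, christoffel_smul_right, christoffel_symm]

theorem continuous_vol : Continuous (vol m) := by
  have : (vol m : (Fin (m + 1) → Coord m) → ℝ) = fun v => (Matrix.of fun i j => v j i).det :=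
    funext vol_apply
  rw [this]
  refine Continuous.matrix_det ?_
  refine continuous_matrix fun i j => ?_
  simp only [Matrix.of_apply]
  fun_prop

theorem hasFDerivAt_vol {E : Type*} [NormedAddCommGroup E] [NormedSpace ℝ E]
    {v : Fin (m + 1) → E → Coord m} {v' : Fin (m + 1) → E →L[ℝ] Coord m} {u : E}
    (hv : ∀ l, HasFDerivAt (v l) (v' l) u) :
    ∃ V' : E →L[ℝ] ℝ, HasFDerivAt (fun y => vol m (fun l => v l y)) V' u ∧
      ∀ w, V' w = ∑ l, vol m (Function.update (fun l => v l u) l (v' l w)) := by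
  let F : ContinuousMultilinearMap ℝ (fun _ : Fin (m + 1) => Coord m) ℝ :=
    ⟨(vol m).toMultilinearMap, continuous_vol⟩
  refine ⟨_, HasFDerivAt.multilinear_comp F hv, fun w => ?_⟩
  simp only [_root_.sum_apply, ContinuousLinearMap.comp_apply]
  rfl

/-- The Codazzi equation in coordinates. For `p, q` the coordinate vectors `i, j`, `n, r` the
derivatives of the normal, and `s, d` the mixed second derivatives of immersion and normal, the two
sides are `∇̄_i e_j` and `∇̄_j e_i`. The asymmetric terms cancel by symmetry of the second
fundamental form (`hsymm`) and because the terms that carry the curvature of `ℍⁿ` are symmetric. -/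
theorem shape_derivative_symm {x ν p q n r s d : Coord m} (hx : height x ≠ 0) {t : ℝ}
    (hsymm : inner ℝ p (r - (height q / height x) • ν - (height ν / height x) • q)
      = inner ℝ q (n - (height p / height x) • ν - (height ν / height x) • p)) :
    s + t • (d - ((height s * (height x)⁻¹ + height q * (-(height x ^ 2)⁻¹ * height p)) • ν
        + (height q * (height x)⁻¹) • n)
        - ((height n * (height x)⁻¹ + height ν * (-(height x ^ 2)⁻¹ * height p)) • q
        + (height ν * (height x)⁻¹) • s))
      + christoffel x p (q + t • (r - (height q / height x) • ν - (height ν / height x) • q))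
    = s + t • (d - ((height s * (height x)⁻¹ + height p * (-(height x ^ 2)⁻¹ * height q)) • ν
        + (height p * (height x)⁻¹) • r)
        - ((height r * (height x)⁻¹ + height ν * (-(height x ^ 2)⁻¹ * height q)) • p
        + (height ν * (height x)⁻¹) • s))
      + christoffel x q (p + t • (n - (height p / height x) • ν - (height ν / height x) • p)) := by
  rw [christoffel_add_right, christoffel_add_right, christoffel_smul_right, christoffel_smul_right,
    christoffel_symm x q p]
  rw [christoffel, christoffel, christoffel, hsymm]
  simp only [sub_eq_add_neg, height_add, ← neg_smul, height_smul]
  match_scalars <;> field_simp <;> ring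

/-- The covariant derivative of the normal field `ν` in the direction `v`, if `L` and `L'` are the
derivatives of the immersion and of `ν`. -/
def shape {E : Type*} [NormedAddCommGroup E] [NormedSpace ℝ E] (x ν : Coord m)
    (L L' : E →L[ℝ] Coord m) (v : E) : Coord m :=
  L' v + christoffel x (L v) ν

/-- The vectors tangent to the coordinate lines. -/
def coordFrame (L : EuclideanSpace ℝ (Fin m) →L[ℝ] Coord m) (j : Fin m) : Coord m :=
  L (EuclideanSpace.single j 1)

/-- The covariant derivatives of the normal field along the coordinate lines. -/
def shapeFrame (x ν : Coord m) (L L' : EuclideanSpace ℝ (Fin m) →L[ℝ] Coord m) (j : Fin m) :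
    Coord m :=
  shape x ν L L' (EuclideanSpace.single j 1)

/-- The components of the flux density: up to sign, the coordinates of `adj(1 + t A) Xᵀ`
multiplied by the area density, where `A` is the shape operator. -/
def flux (t : ℝ) (x ν : Coord m) (L L' : EuclideanSpace ℝ (Fin m) →L[ℝ] Coord m) (i : Fin m) : ℝ :=
  (height x ^ (m + 1))⁻¹ * vol m (frameCons ν
    (Function.update (fun j => coordFrame L j + t • shapeFrame x ν L L' j) i (X x)))

/-- The second fundamental form in coordinates. -/
def second (x ν : Coord m) (L L' : EuclideanSpace ℝ (Fin m) →L[ℝ] Coord m) :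
    Matrix (Fin m) (Fin m) ℝ :=
  Matrix.of fun i j => metric x (shapeFrame x ν L L' i) (coordFrame L j)

/-- The matrix of the shape operator in coordinates. -/
def weingarten (x ν : Coord m) (L L' : EuclideanSpace ℝ (Fin m) →L[ℝ] Coord m) :
    Matrix (Fin m) (Fin m) ℝ :=
  (gram x (coordFrame L))⁻¹ * second x ν L L'

/-- The intrinsic divergence of `adj(1 + t A) Xᵀ`. -/
def divergence (t : ℝ) (x ν : Coord m) (A : Matrix (Fin m) (Fin m) ℝ) : ℝ :=
  (height x)⁻¹ * (1 + t • A).adjugate.trace - metric x (X x) ν * ((1 + t • A).adjugate * A).trace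

/-- On tangent vectors the inner product term of the connection vanishes, so the derivative of the
shape vectors can be computed without differentiating an inner product. -/
theorem shape_eq_of_normal {E : Type*} [NormedAddCommGroup E] [NormedSpace ℝ E] {x ν : Coord m}
    (hx : 0 < height x) {L : E →L[ℝ] Coord m} (L' : E →L[ℝ] Coord m) {v : E}
    (h : metric x ν (L v) = 0) :
    shape x ν L L' v = L' v - (height (L v) / height x) • ν - (height ν / height x) • L v := by
  rw [metric, div_eq_zero_iff, or_iff_left (by positivity), real_inner_comm] at h
  rw [shape, christoffel, h]
  module

/-- The local data of a hypersurface at an interior point. -/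
structure LocalHypersurface (ψ ν : EuclideanSpace ℝ (Fin m) → Coord m)
    (dψ dν : EuclideanSpace ℝ (Fin m) → EuclideanSpace ℝ (Fin m) →L[ℝ] Coord m)
    (u : EuclideanSpace ℝ (Fin m)) : Prop where
  hasFDerivAt : ∀ᶠ y in 𝓝 u, HasFDerivAt ψ (dψ y) y
  hasFDerivAt_normal : ∀ᶠ y in 𝓝 u, HasFDerivAt ν (dν y) y
  differentiableAt : DifferentiableAt ℝ dψ u
  differentiableAt_normal : DifferentiableAt ℝ dν u
  height_pos : 0 < height (ψ u)
  unit : ∀ᶠ y in 𝓝 u, metric (ψ y) (ν y) (ν y) = 1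
  normal : ∀ᶠ y in 𝓝 u, ∀ v, metric (ψ y) (ν y) (dψ y v) = 0
  injective : Function.Injective (dψ u)

namespace LocalHypersurface

variable {ψ ν : EuclideanSpace ℝ (Fin m) → Coord m}
  {dψ dν : EuclideanSpace ℝ (Fin m) → EuclideanSpace ℝ (Fin m) →L[ℝ] Coord m}
  {u : EuclideanSpace ℝ (Fin m)}

theorem eventually_height_pos (H : LocalHypersurface ψ ν dψ dν u) :
    ∀ᶠ y in 𝓝 u, 0 < height (ψ y) := by
  have h : ContinuousAt (fun y => heightL m (ψ y)) u :=
    (heightL m).continuous.continuousAt.comp H.hasFDerivAt.self_of_nhds.continuousAt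
  exact h.eventually (lt_mem_nhds H.height_pos)

theorem linearIndependent_coordFrame {L : EuclideanSpace ℝ (Fin m) →L[ℝ] Coord m}
    (hL : Function.Injective L) : LinearIndependent ℝ (coordFrame L) := by
  have h := (EuclideanSpace.basisFun (Fin m) ℝ).toBasis.linearIndependent.map'
    (L : EuclideanSpace ℝ (Fin m) →ₗ[ℝ] Coord m) (LinearMap.ker_eq_bot.2 hL)
  have e : coordFrame L = (L : EuclideanSpace ℝ (Fin m) →ₗ[ℝ] Coord m) ∘
      (EuclideanSpace.basisFun (Fin m) ℝ).toBasis := by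
    funext j
    simp [coordFrame]
  rw [e]
  exact h

theorem vol_ne_zero (H : LocalHypersurface ψ ν dψ dν u) :
    vol m (frameCons (ν u) (coordFrame (dψ u))) ≠ 0 :=
  vol_cons_ne_zero H.unit.self_of_nhds (fun _ => H.normal.self_of_nhds _)
    (linearIndependent_coordFrame H.injective)

/-- Differentiate `⟨ν, ν⟩ = xₙ²`, which is the condition that `ν` is a unit vector for `ḡ`. -/
theorem metric_shape_normal (H : LocalHypersurface ψ ν dψ dν u) (v : EuclideanSpace ℝ (Fin m)) :
    metric (ψ u) (shape (ψ u) (ν u) (dψ u) (dν u) v) (ν u) = 0 := by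
  have hx := H.height_pos
  have h1 : (fun y => inner ℝ (ν y) (ν y)) =ᶠ[𝓝 u] fun y => heightL m (ψ y) ^ 2 := by
    filter_upwards [H.unit, H.eventually_height_pos] with y hy hy'
    rw [metric, div_eq_one_iff_eq (by positivity)] at hy
    exact hy
  have hν := H.hasFDerivAt_normal.self_of_nhds
  have hψ := H.hasFDerivAt.self_of_nhds
  have h2 := (hν.inner ℝ hν).unique
    ((((heightL m).hasFDerivAt.comp u hψ).pow 2).congr_of_eventuallyEq h1)
  have h3 := congrArg (fun F => F v) h2
  simp [heightL_apply, real_inner_comm (ν u)] at h3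
  have h4 := h1.self_of_nhds
  simp only [heightL_apply] at h4
  have h5 : inner ℝ (dψ u v) (ν u) = 0 := by
    have := H.normal.self_of_nhds v
    rw [metric, div_eq_zero_iff, or_iff_left (by positivity), real_inner_comm] at this
    exact this
  rw [shape_eq_of_normal hx _ (H.normal.self_of_nhds v), metric, div_eq_zero_iff]
  left
  rw [inner_sub_left, inner_sub_left, real_inner_smul_left, real_inner_smul_left, h4, h5]
  field_simp
  have h6 : inner ℝ (dν u v) (ν u) = height (ψ u) * height (dψ u v) := by
    linarith [real_inner_comm (ν u) (dν u v)]
  rw [h6]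
  ring

/-- Differentiating `⟨ν, dψ w⟩ = 0` expresses the form through the second derivative of `ψ`, which
is symmetric. -/
theorem metric_shape_symm (H : LocalHypersurface ψ ν dψ dν u) (v w : EuclideanSpace ℝ (Fin m)) :
    metric (ψ u) (shape (ψ u) (ν u) (dψ u) (dν u) v) (dψ u w)
      = metric (ψ u) (shape (ψ u) (ν u) (dψ u) (dν u) w) (dψ u v) := by
  have hx := H.height_pos
  have key : ∀ v w, inner ℝ (dν u v) (dψ u w) = -inner ℝ (ν u) (fderiv ℝ dψ u v w) := by
    intro v w
    have h1 : (fun y => inner ℝ (ν y) (dψ y w)) =ᶠ[𝓝 u] fun y => 0 := by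
      filter_upwards [H.normal, H.eventually_height_pos] with y hy hy'
      have := hy w
      rw [metric, div_eq_zero_iff, or_iff_left (by positivity)] at this
      exact this
    have h2 := (H.hasFDerivAt_normal.self_of_nhds.inner ℝ
      (H.differentiableAt.hasFDerivAt.clm_apply (hasFDerivAt_const w u))).unique
      ((hasFDerivAt_const (0 : ℝ) u).congr_of_eventuallyEq h1)
    have h3 := congrArg (fun F => F v) h2
    simp at h3
    linarith
  have hs := second_derivative_symmetric_of_eventually H.hasFDerivAt H.differentiableAt.hasFDerivAt
    v w
  have hn : ∀ v, inner ℝ (ν u) (dψ u v) = 0 := by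
    intro v
    have := H.normal.self_of_nhds v
    rw [metric, div_eq_zero_iff, or_iff_left (by positivity)] at this
    exact this
  rw [shape_eq_of_normal hx _ (H.normal.self_of_nhds v),
    shape_eq_of_normal hx _ (H.normal.self_of_nhds w)]
  simp only [metric, inner_sub_left, real_inner_smul_left, key, hs, hn]
  rw [real_inner_comm (dψ u w) (dψ u v), mul_zero, mul_zero]

/-- The divergence identity for the flux density. -/
theorem hasFDerivAt_flux (H : LocalHypersurface ψ ν dψ dν u) (t : ℝ) :
    ∃ W' : EuclideanSpace ℝ (Fin m) →L[ℝ] (Fin m → ℝ),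
      HasFDerivAt (fun y => flux t (ψ y) (ν y) (dψ y) (dν y)) W' u ∧
      ∑ i, W' (EuclideanSpace.single i 1) i
        = (height (ψ u) ^ (m + 1))⁻¹ * vol m (frameCons (ν u) (coordFrame (dψ u)))
          * divergence t (ψ u) (ν u) (weingarten (ψ u) (ν u) (dψ u) (dν u)) := by
  have hx := H.height_pos
  set ε : Fin m → EuclideanSpace ℝ (Fin m) := fun j => EuclideanSpace.single j 1 with hε
  have hν := H.hasFDerivAt_normal.self_of_nhds
  have hψ := H.hasFDerivAt.self_of_nhds
  have hη := (heightL m).hasFDerivAt.comp u hψ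
  have hηinv := (hasDerivAt_inv hx.ne').comp_hasFDerivAt u hη
  have hην := (heightL m).hasFDerivAt.comp u hν
  have hp : ∀ j, HasFDerivAt (fun y => dψ y (ε j)) ((fderiv ℝ dψ u).flip (ε j)) u := fun j => by
    simpa using H.differentiableAt.hasFDerivAt.clm_apply (hasFDerivAt_const (ε j) u)
  have hn : ∀ j, HasFDerivAt (fun y => dν y (ε j)) ((fderiv ℝ dν u).flip (ε j)) u := fun j => by
    simpa using H.differentiableAt_normal.hasFDerivAt.clm_apply (hasFDerivAt_const (ε j) u)
  -- The product rule is applied to the simplified formula of `shape_eq_of_normal`, which holds on a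
  -- neighbourhood of `u` and not only at `u`.
  have he : ∀ j, ∃ e' : EuclideanSpace ℝ (Fin m) →L[ℝ] Coord m,
      HasFDerivAt (fun y => dψ y (ε j) + t • shape (ψ y) (ν y) (dψ y) (dν y) (ε j)) e' u ∧
      ∀ w, e' w = fderiv ℝ dψ u w (ε j) + t • (fderiv ℝ dν u w (ε j)
        - ((height (fderiv ℝ dψ u w (ε j)) * (height (ψ u))⁻¹
          + height (dψ u (ε j)) * (-(height (ψ u) ^ 2)⁻¹ * height (dψ u w))) • ν u
        + (height (dψ u (ε j)) * (height (ψ u))⁻¹) • dν u w)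
        - ((height (dν u w) * (height (ψ u))⁻¹
          + height (ν u) * (-(height (ψ u) ^ 2)⁻¹ * height (dψ u w))) • dψ u (ε j)
        + (height (ν u) * (height (ψ u))⁻¹) • fderiv ℝ dψ u w (ε j))) := by
    intro j
    have h1 := (hp j).add ((((hn j).sub
      (((((heightL m).hasFDerivAt.comp u (hp j)).mul hηinv).smul hν))).sub
      ((hην.mul hηinv).smul (hp j))).const_smul t)
    refine ⟨_, h1.congr_of_eventuallyEq ?_, fun w => ?_⟩
    · filter_upwards [H.normal, H.eventually_height_pos] with y hy hy'
      rw [shape_eq_of_normal hy' _ (hy _)]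
      rfl
    · simp [heightL_apply]
      module
  choose e' he' hew using he
  have hflux : ∀ i, ∃ W' : EuclideanSpace ℝ (Fin m) →L[ℝ] ℝ,
      HasFDerivAt (fun y => flux t (ψ y) (ν y) (dψ y) (dν y) i) W' u ∧
      W' (ε i) = (height (ψ u) ^ (m + 1))⁻¹ *
        (vol m (frameCons (shapeFrame (ψ u) (ν u) (dψ u) (dν u) i)
          (Function.update (fun j => coordFrame (dψ u) j
            + t • shapeFrame (ψ u) (ν u) (dψ u) (dν u) j) i (X (ψ u))))
        + ∑ j, vol m (frameCons (ν u) (Function.update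
          (Function.update (fun j => coordFrame (dψ u) j
            + t • shapeFrame (ψ u) (ν u) (dψ u) (dν u) j) i (X (ψ u))) j
          (if j = i then coordFrame (dψ u) i
              + christoffel (ψ u) (coordFrame (dψ u) i) (X (ψ u))
            else e' j (ε i) + christoffel (ψ u) (coordFrame (dψ u) i)
              (coordFrame (dψ u) j + t • shapeFrame (ψ u) (ν u) (dψ u) (dν u) j))))) := by
    intro i
    let v : Fin (m + 1) → EuclideanSpace ℝ (Fin m) → Coord m :=
      Fin.cons (α := fun _ => EuclideanSpace ℝ (Fin m) → Coord m) ν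
      (Function.update (fun j y => dψ y (ε j) + t • shape (ψ y) (ν y) (dψ y) (dν y) (ε j)) i
        (fun y => X (ψ y)))
    let v' : Fin (m + 1) → EuclideanSpace ℝ (Fin m) →L[ℝ] Coord m :=
      Fin.cons (α := fun _ => EuclideanSpace ℝ (Fin m) →L[ℝ] Coord m) (dν u)
      (Function.update e' i (dψ u))
    have hv : ∀ l, HasFDerivAt (v l) (v' l) u := by
      intro l
      refine Fin.cases ?_ (fun j => ?_) l
      · exact hν
      · simp only [v, v', Fin.cons_succ]
        by_cases hj : j = i
        · subst hj
          simp only [Function.update_self]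
          exact hψ.sub_const _
        · simp only [Function.update_of_ne hj]
          exact he' j
    have hvy : ∀ y, (fun l => v l y) = frameCons (ν y) (Function.update
        (fun j => coordFrame (dψ y) j + t • shapeFrame (ψ y) (ν y) (dψ y) (dν y) j) i
        (X (ψ y))) := by
      intro y
      funext l
      refine Fin.cases ?_ (fun j => ?_) l
      · rfl
      · simp only [v, frameCons, Fin.cons_succ]
        by_cases hj : j = i
        · subst hj
          simp only [Function.update_self]
        · simp only [Function.update_of_ne hj]
          rfl
    obtain ⟨V', hV', hVw⟩ := hasFDerivAt_vol hv
    have hpow := ((hasDerivAt_pow (m + 1) (height (ψ u))).inv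
      (pow_ne_zero (m + 1) hx.ne')).comp_hasFDerivAt u hη
    have hmul := hpow.mul hV'
    refine ⟨_, hmul.congr_of_eventuallyEq (Filter.Eventually.of_forall fun y => ?_), ?_⟩
    · simp only [flux, ← hvy]
      rfl
    -- The derivative of `xₙ ^ -(m + 1)` is absorbed by the trace of the Christoffel term, so each
    -- flat derivative of a column may be replaced by its covariant derivative.
    · have htr := sum_vol_update_christoffel (ψ u) (dψ u (ε i)) (fun l => v l u)
      have hsum : ∑ l, vol m (Function.update (fun l => v l u) l (v' l (ε i)
            + christoffel (ψ u) (dψ u (ε i)) (v l u)))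
          = V' (ε i) + -((m + 1 : ℝ) * (height (dψ u (ε i)) / height (ψ u)))
            * vol m (fun l => v l u) := by
        rw [← htr, hVw, ← Finset.sum_add_distrib]
        exact Finset.sum_congr rfl fun l _ => AlternatingMap.map_update_add _ _ _ _ _
      have hrhs : ∑ l, vol m (Function.update (fun l => v l u) l (v' l (ε i)
            + christoffel (ψ u) (dψ u (ε i)) (v l u))) = _ := Fin.sum_univ_succ _
      rw [hsum] at hrhs
      have hcov0 : vol m (Function.update (fun l => v l u) 0 (v' 0 (ε i)
            + christoffel (ψ u) (dψ u (ε i)) (v 0 u)))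
          = vol m (frameCons (shapeFrame (ψ u) (ν u) (dψ u) (dν u) i)
          (Function.update (fun j => coordFrame (dψ u) j
            + t • shapeFrame (ψ u) (ν u) (dψ u) (dν u) j) i (X (ψ u)))) := by
        rw [hvy, frameCons, Fin.update_cons_zero]
        rfl
      have hcovs : ∀ j : Fin m, vol m (Function.update (fun l => v l u) j.succ (v' j.succ (ε i)
            + christoffel (ψ u) (dψ u (ε i)) (v j.succ u)))
          = vol m (frameCons (ν u) (Function.update
          (Function.update (fun j => coordFrame (dψ u) j
            + t • shapeFrame (ψ u) (ν u) (dψ u) (dν u) j) i (X (ψ u))) j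
          (if j = i then coordFrame (dψ u) i
              + christoffel (ψ u) (coordFrame (dψ u) i) (X (ψ u))
            else e' j (ε i) + christoffel (ψ u) (coordFrame (dψ u) i)
              (coordFrame (dψ u) j + t • shapeFrame (ψ u) (ν u) (dψ u) (dν u) j)))) := by
        intro j
        rw [hvy, frameCons, frameCons, ← Fin.cons_update]
        congr 3
        simp only [v, v', Fin.cons_succ]
        by_cases hj : j = i
        · subst hj
          simp only [Function.update_self, if_true]
          rfl
        · simp only [Function.update_of_ne hj, if_neg hj]
          rfl
      simp only [hcov0, hcovs] at hrhs
      rw [← hrhs]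
      simp only [Function.comp_apply, Pi.inv_apply, heightL_apply, _root_.add_apply,
        _root_.smul_apply, ContinuousLinearMap.comp_apply, smul_eq_mul]
      push_cast
      field_simp
      ring
  choose W' hW' hWi using hflux
  refine ⟨ContinuousLinearMap.pi W', hasFDerivAt_pi.2 hW', ?_⟩
  simp only [ContinuousLinearMap.pi_apply]
  have hsum := sum_flux_derivative hx (ψ := coordFrame (dψ u))
    (a := shapeFrame (ψ u) (ν u) (dψ u) (dν u)) H.unit.self_of_nhds
    (fun _ => H.normal.self_of_nhds _) H.vol_ne_zero (fun j => H.metric_shape_normal _)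
    (fun i j => H.metric_shape_symm _ _) t
    (z := fun i j => e' j (ε i) + christoffel (ψ u) (coordFrame (dψ u) i)
              (coordFrame (dψ u) j + t • shapeFrame (ψ u) (ν u) (dψ u) (dν u) j))
    (fun i j => ?_) rfl rfl
  · rw [Finset.sum_congr rfl fun i _ => hWi i, ← Finset.mul_sum, hsum, mul_assoc]
    rfl
  -- It remains to see that `∇̄_i e_j` is symmetric, which is the Codazzi equation.
  · have hs := second_derivative_symmetric_of_eventually H.hasFDerivAt
      H.differentiableAt.hasFDerivAt (ε i) (ε j)
    have hsn := second_derivative_symmetric_of_eventually H.hasFDerivAt_normal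
      H.differentiableAt_normal.hasFDerivAt (ε i) (ε j)
    have hsh := H.metric_shape_symm (ε j) (ε i)
    rw [hew, hew, hs, hsn, shapeFrame, shapeFrame]
    rw [shape_eq_of_normal hx _ (H.normal.self_of_nhds _),
      shape_eq_of_normal hx _ (H.normal.self_of_nhds _)] at hsh ⊢
    rw [metric, metric, div_left_inj' (by positivity), real_inner_comm, real_inner_comm (dψ u _)]
      at hsh
    exact shape_derivative_symm hx.ne' hsh

end LocalHypersurface

end Calculus

/-! ### Independence of the chart. -/

section ChangeOfBasis

variable {m : ℕ}

/-- The matrix of an endomorphism of `ℝᵐ`. -/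
def jacobian (J : EuclideanSpace ℝ (Fin m) →L[ℝ] EuclideanSpace ℝ (Fin m)) :
    Matrix (Fin m) (Fin m) ℝ :=
  Matrix.of fun k j => J (EuclideanSpace.single j 1) k

theorem apply_eq_sum_jacobian {F : Type*} [AddCommGroup F] [Module ℝ F]
    (L : EuclideanSpace ℝ (Fin m) →ₗ[ℝ] F)
    (J : EuclideanSpace ℝ (Fin m) →L[ℝ] EuclideanSpace ℝ (Fin m)) (j : Fin m) :
    L (J (EuclideanSpace.single j 1)) = ∑ k, jacobian J k j • L (EuclideanSpace.single k 1) := by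
  have h : J (EuclideanSpace.single j 1)
      = ∑ k, jacobian J k j • (EuclideanSpace.single k (1 : ℝ)) := by
    have := (EuclideanSpace.basisFun (Fin m) ℝ).sum_repr (J (EuclideanSpace.single j 1))
    rw [← this]
    simp [jacobian]
  rw [h, map_sum]
  simp only [map_smul]

theorem det_jacobian (J : EuclideanSpace ℝ (Fin m) →L[ℝ] EuclideanSpace ℝ (Fin m)) :
    (jacobian J).det = J.det := by
  have h : J.det = (LinearMap.toMatrix (EuclideanSpace.basisFun (Fin m) ℝ).toBasis
      (EuclideanSpace.basisFun (Fin m) ℝ).toBasis (J : EuclideanSpace ℝ (Fin m) →ₗ[ℝ] _)).det := by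
    rw [LinearMap.det_toMatrix]
  rw [h]
  congr 1

/-- The congruence rule `Jᵀ G J` for bilinear forms, stated with two maps `S, L` so that it covers
both fundamental forms. -/
theorem matrix_of_comp {F : Type*} [AddCommGroup F] [Module ℝ F] (b : F → F → ℝ)
    (hadd : ∀ u v w, b (u + v) w = b u w + b v w) (hsmul : ∀ (c : ℝ) u v, b (c • u) v = c * b u v)
    (hadd' : ∀ u v w, b u (v + w) = b u v + b u w) (hsmul' : ∀ (c : ℝ) u v, b u (c • v) = c * b u v)
    (S L : EuclideanSpace ℝ (Fin m) →ₗ[ℝ] F)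
    (J : EuclideanSpace ℝ (Fin m) →L[ℝ] EuclideanSpace ℝ (Fin m)) :
    (Matrix.of fun i j => b (S (J (EuclideanSpace.single i 1))) (L (J (EuclideanSpace.single j 1))))
      = (jacobian J)ᵀ * (Matrix.of fun i j =>
          b (S (EuclideanSpace.single i 1)) (L (EuclideanSpace.single j 1))) * jacobian J := by
  let β : F →ₗ[ℝ] F →ₗ[ℝ] ℝ := LinearMap.mk₂ ℝ b hadd hsmul hadd' hsmul'
  have hβ : ∀ u v, b u v = β u v := fun u v => rfl
  ext i j
  simp only [hβ, Matrix.of_apply, Matrix.mul_apply, Matrix.transpose_apply,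
    apply_eq_sum_jacobian, map_sum, map_smul, LinearMap.sum_apply, LinearMap.smul_apply,
    smul_eq_mul, Finset.mul_sum, Finset.sum_mul]
  refine Finset.sum_congr rfl fun k _ => Finset.sum_congr rfl fun l _ => ?_
  ring

/-- `shape` as a linear map. -/
def shapeLM {E : Type*} [NormedAddCommGroup E] [NormedSpace ℝ E] (x ν : Coord m)
    (L L' : E →L[ℝ] Coord m) : E →ₗ[ℝ] Coord m where
  toFun := shape x ν L L'
  map_add' u v := by simp only [shape, map_add, christoffel_add_left]; abel
  map_smul' c v := by simp [shape, christoffel_smul_left]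

variable {x ν : Coord m} {L L' : EuclideanSpace ℝ (Fin m) →L[ℝ] Coord m}
  {J : EuclideanSpace ℝ (Fin m) →L[ℝ] EuclideanSpace ℝ (Fin m)}

theorem gram_comp : gram x (coordFrame (L.comp J))
    = (jacobian J)ᵀ * gram x (coordFrame L) * jacobian J :=
  matrix_of_comp (metric x) (metric_add_left x) (metric_smul_left x) (metric_add_right x)
    (fun c u v => metric_smul_right x c u v) L.toLinearMap L.toLinearMap J

theorem second_comp : second x ν (L.comp J) (L'.comp J)
    = (jacobian J)ᵀ * second x ν L L' * jacobian J :=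
  matrix_of_comp (metric x) (metric_add_left x) (metric_smul_left x) (metric_add_right x)
    (fun c u v => metric_smul_right x c u v) (shapeLM x ν L L') L.toLinearMap J

/-- Both fundamental forms change by congruence with the same Jacobian, so their quotient changes by
conjugation; all spectral quantities are then intrinsic. -/
theorem weingarten_comp (hJ : IsUnit (jacobian J).det) : weingarten x ν (L.comp J) (L'.comp J)
    = (jacobian J)⁻¹ * weingarten x ν L L' * jacobian J := by
  have hJt : IsUnit (jacobian J)ᵀ.det := by rwa [Matrix.det_transpose]
  rw [weingarten, weingarten, gram_comp, second_comp, Matrix.mul_inv_rev, Matrix.mul_inv_rev]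
  simp only [Matrix.mul_assoc]
  rw [Matrix.nonsing_inv_mul_cancel_left _ _ hJt]

theorem one_add_smul_conj {A J : Matrix (Fin m) (Fin m) ℝ} (hJ : IsUnit J.det) (t : ℝ) :
    1 + t • (J⁻¹ * A * J) = J⁻¹ * (1 + t • A) * J := by
  rw [Matrix.mul_add, Matrix.add_mul, Matrix.mul_one, Matrix.nonsing_inv_mul _ hJ,
    Matrix.mul_smul, Matrix.smul_mul]

theorem adjugate_conj {B J : Matrix (Fin m) (Fin m) ℝ} (hJ : IsUnit J.det) :
    (J⁻¹ * B * J).adjugate = J⁻¹ * B.adjugate * J := by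
  have h4 : J⁻¹.adjugate = J⁻¹.det • J := by
    calc J⁻¹.adjugate = J⁻¹.adjugate * (J⁻¹ * J) := by rw [Matrix.nonsing_inv_mul _ hJ, mul_one]
      _ = _ := by rw [← Matrix.mul_assoc, Matrix.adjugate_mul]; simp
  have h5 : J.adjugate = J.det • J⁻¹ := by
    calc J.adjugate = J.adjugate * (J * J⁻¹) := by rw [Matrix.mul_nonsing_inv _ hJ, mul_one]
      _ = _ := by rw [← Matrix.mul_assoc, Matrix.adjugate_mul]; simp
  have h6 : J⁻¹.det * J.det = 1 := by rw [← Matrix.det_mul, Matrix.nonsing_inv_mul _ hJ]; simp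
  rw [Matrix.adjugate_mul_distrib, Matrix.adjugate_mul_distrib, h4, h5]
  simp only [Matrix.smul_mul, Matrix.mul_smul, smul_smul, Matrix.mul_assoc]
  rw [h6, one_smul]

theorem trace_conj {B J : Matrix (Fin m) (Fin m) ℝ} (hJ : IsUnit J.det) :
    (J⁻¹ * B * J).trace = B.trace := by
  rw [Matrix.trace_mul_comm, Matrix.mul_nonsing_inv_cancel_left _ _ hJ]

theorem divergence_conj {A J : Matrix (Fin m) (Fin m) ℝ} (hJ : IsUnit J.det) (t : ℝ) :
    divergence t x ν (J⁻¹ * A * J) = divergence t x ν A := by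
  have h : J⁻¹ * (1 + t • A).adjugate * J * (J⁻¹ * A * J)
      = J⁻¹ * ((1 + t • A).adjugate * A) * J := by
    simp only [Matrix.mul_assoc]
    rw [Matrix.mul_nonsing_inv_cancel_left _ _ hJ]
  rw [divergence, divergence, one_add_smul_conj hJ, adjugate_conj hJ, h, trace_conj hJ,
    trace_conj hJ]

theorem charpoly_conj {A J : Matrix (Fin m) (Fin m) ℝ} (hJ : IsUnit J.det) :
    (J⁻¹ * A * J).charpoly = A.charpoly := by
  have hu := Matrix.nonsing_inv_mul J hJ
  have hu' := Matrix.mul_nonsing_inv J hJ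
  let U : (Matrix (Fin m) (Fin m) ℝ)ˣ := ⟨J, J⁻¹, hu', hu⟩
  exact Matrix.charpoly_units_conj' U A

/-- The pairing of the covector `ξ` with the tangent vector `adj(1 + t A) Xᵀ`. -/
def pairing (t : ℝ) (x ν : Coord m) (L L' : EuclideanSpace ℝ (Fin m) →L[ℝ] Coord m)
    (ξ : EuclideanSpace ℝ (Fin m) →L[ℝ] ℝ) : ℝ :=
  ∑ i, ξ (EuclideanSpace.single i 1) * ((1 + t • weingarten x ν L L').adjugate *ᵥ
    ((gram x (coordFrame L))⁻¹ *ᵥ fun j => metric x (X x) (coordFrame L j))) i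

/-- The components of `T_t Xᵀ` transform by `J⁻¹` and those of the covector by `J`. -/
theorem pairing_comp (hJ : IsUnit (jacobian J).det) (t : ℝ)
    (ξ : EuclideanSpace ℝ (Fin m) →L[ℝ] ℝ) :
    pairing t x ν (L.comp J) (L'.comp J) (ξ.comp J) = pairing t x ν L L' ξ := by
  have hJt : IsUnit (jacobian J)ᵀ.det := by rwa [Matrix.det_transpose]
  have h1 : (fun i => (ξ.comp J) (EuclideanSpace.single i 1))
      = (fun i => ξ (EuclideanSpace.single i 1)) ᵥ* jacobian J := by
    funext i
    have := apply_eq_sum_jacobian ξ.toLinearMap J i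
    rw [Matrix.vecMul, dotProduct]
    simpa [mul_comm] using this
  have h2 : (fun j => metric x (X x) (coordFrame (L.comp J) j))
      = (jacobian J)ᵀ *ᵥ fun j => metric x (X x) (coordFrame L j) := by
    funext i
    have := apply_eq_sum_jacobian L.toLinearMap J i
    simp only [coordFrame, ContinuousLinearMap.comp_apply]
    rw [Matrix.mulVec, dotProduct, metric_comm]
    have this' : L (J (EuclideanSpace.single i 1)) = _ := this
    rw [this', metric_sum_left]
    simp only [metric_smul_left, Matrix.transpose_apply, metric_comm x (X x)]
    rfl
  have h3 : ∀ (a : Fin m → ℝ) (v : Fin m → ℝ), ∑ i, a i * v i = a ⬝ᵥ v := fun a v => rfl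
  have h1' : (fun i => ξ (J (EuclideanSpace.single i 1)))
      = (fun i => ξ (EuclideanSpace.single i 1)) ᵥ* jacobian J := h1
  rw [pairing, pairing, h3 (fun i => (ξ.comp J) (EuclideanSpace.single i 1)), h3 (fun i => ξ _), h1,
    h2, weingarten_comp hJ, one_add_smul_conj hJ, adjugate_conj hJ, gram_comp, Matrix.mul_inv_rev,
    Matrix.mul_inv_rev, ← Matrix.dotProduct_mulVec]
  simp only [Matrix.mulVec_mulVec, Matrix.mul_assoc]
  rw [Matrix.nonsing_inv_mul _ hJt, Matrix.mul_one, Matrix.mul_nonsing_inv_cancel_left _ _ hJ,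
    Matrix.mul_nonsing_inv_cancel_left _ _ hJ]

end ChangeOfBasis

/-! ### The flux as a multiple of the tangent field. -/

section Flux

variable {m : ℕ} {ψ ν : EuclideanSpace ℝ (Fin m) → Coord m}
  {dψ dν : EuclideanSpace ℝ (Fin m) → EuclideanSpace ℝ (Fin m) →L[ℝ] Coord m}
  {u : EuclideanSpace ℝ (Fin m)}

theorem LocalHypersurface.sum_mul_flux (H : LocalHypersurface ψ ν dψ dν u) (t : ℝ)
    (ξ : EuclideanSpace ℝ (Fin m) →L[ℝ] ℝ) :
    ∑ i, ξ (EuclideanSpace.single i 1) * flux t (ψ u) (ν u) (dψ u) (dν u) i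
      = (height (ψ u) ^ (m + 1))⁻¹ * vol m (frameCons (ν u) (coordFrame (dψ u)))
        * pairing t (ψ u) (ν u) (dψ u) (dν u) ξ := by
  have hx := H.height_pos
  have hA := shape_eq_combination hx (ψ := coordFrame (dψ u))
    (a := shapeFrame (ψ u) (ν u) (dψ u) (dν u)) H.unit.self_of_nhds
    (fun _ => H.normal.self_of_nhds _) H.vol_ne_zero (fun j => H.metric_shape_normal _)
    (fun i j => H.metric_shape_symm _ _) (A := weingarten (ψ u) (ν u) (dψ u) (dν u)) rfl
  rw [pairing, Finset.mul_sum]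
  refine Finset.sum_congr rfl fun i _ => ?_
  rw [flux, add_smul_shape_eq_combination hA, vol_cons_combination_update hx
    (ψ := coordFrame (dψ u)) H.unit.self_of_nhds
    (fun _ => H.normal.self_of_nhds _) H.vol_ne_zero]
  ring

end Flux

/-! ### Traces of the adjugate in terms of the symmetric functions of the principal curvatures. -/

section CharacteristicPolynomial

variable {m : ℕ}

/-- A basis orthonormal for `g`: `S = U D`, with `U` diagonalizing `g` and `D` the inverse square
roots of the eigenvalues. -/
theorem exists_transpose_mul_mul_eq_one {g : Matrix (Fin m) (Fin m) ℝ} (hg : g.PosDef) :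
    ∃ S : Matrix (Fin m) (Fin m) ℝ, Sᵀ * g * S = 1 := by
  set U : Matrix (Fin m) (Fin m) ℝ := hg.1.eigenvectorUnitary.val with hU
  have hUU : Uᵀ * U = 1 := by
    have := Unitary.coe_star_mul_self hg.1.eigenvectorUnitary
    rwa [Matrix.star_eq_conjTranspose, Matrix.conjTranspose_eq_transpose_of_trivial] at this
  have hsp : g = U * Matrix.diagonal hg.1.eigenvalues * Uᵀ := by
    conv_lhs => rw [hg.1.spectral_theorem, Unitary.conjStarAlgAut_apply]
    rw [Matrix.star_eq_conjTranspose, Matrix.conjTranspose_eq_transpose_of_trivial]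
    rfl
  set D := Matrix.diagonal fun i => (Real.sqrt (hg.1.eigenvalues i))⁻¹ with hD
  refine ⟨U * D, ?_⟩
  have h1 : (U * D)ᵀ * g * (U * D)
      = Dᵀ * (Uᵀ * U) * Matrix.diagonal hg.1.eigenvalues * (Uᵀ * U) * D := by
    conv_lhs => rw [hsp]
    rw [Matrix.transpose_mul]
    simp only [Matrix.mul_assoc]
  rw [h1, hUU, Matrix.mul_one, Matrix.mul_one, hD, Matrix.diagonal_transpose,
    Matrix.diagonal_mul_diagonal, Matrix.diagonal_mul_diagonal, ← Matrix.diagonal_one]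
  congr 1
  funext i
  have hpos := hg.eigenvalues_pos i
  have hs := Real.mul_self_sqrt hpos.le
  have hs0 := (Real.sqrt_pos.2 hpos).ne'
  nth_rw 2 [← hs]
  field_simp

/-- In a `g`-orthonormal basis `g⁻¹ h` becomes the symmetric matrix `Sᵀ h S`. Since `roots` lists
only the real roots, this count is what identifies their symmetric functions with coefficients of
the characteristic polynomial. -/
theorem card_roots_charpoly {g h : Matrix (Fin m) (Fin m) ℝ} (hg : g.PosDef) (hh : hᵀ = h) :
    Multiset.card (g⁻¹ * h).charpoly.roots = m := by
  obtain ⟨S, hS⟩ := exists_transpose_mul_mul_eq_one hg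
  have hSdet : IsUnit S.det := by
    have := congrArg Matrix.det hS
    rw [Matrix.det_mul, Matrix.det_one] at this
    exact IsUnit.of_mul_eq_one _ (by rw [mul_comm]; exact this)
  have hgdet : IsUnit g.det := hg.det_pos.ne'.isUnit
  have hinv : S⁻¹ = Sᵀ * g := Matrix.inv_eq_left_inv hS
  have hconj : S⁻¹ * (g⁻¹ * h) * S = Sᵀ * h * S := by
    rw [hinv]
    simp only [Matrix.mul_assoc]
    rw [Matrix.mul_nonsing_inv_cancel_left _ _ hgdet]
  have hherm : (Sᵀ * h * S).IsHermitian := by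
    rw [Matrix.IsHermitian, Matrix.conjTranspose_eq_transpose_of_trivial, Matrix.transpose_mul,
      Matrix.transpose_mul, Matrix.transpose_transpose, hh, Matrix.mul_assoc]
  rw [← charpoly_conj hSdet, hconj, hherm.roots_charpoly_eq_eigenvalues]
  simp

theorem det_one_add_smul {A : Matrix (Fin m) (Fin m) ℝ}
    (hA : Multiset.card A.charpoly.roots = m) (t : ℝ) :
    (1 + t • A).det = ∑ k ∈ Finset.range (m + 1), A.charpoly.roots.esymm k * t ^ k := by
  have hdeg : A.charpoly.natDegree = m := by simp [Matrix.charpoly_natDegree_eq_dim]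
  have h1 : (1 + t • A).det = A.charpolyRev.eval (-t) := by
    rw [Matrix.charpolyRev, ← Polynomial.coe_evalRingHom, RingHom.map_det]
    congr 1
    ext i j
    simp [Matrix.one_apply, apply_ite (Polynomial.eval (-t))]
    ring
  rw [h1, ← Matrix.reverse_charpoly, Polynomial.eval_eq_sum_range'
    (Nat.lt_succ_of_le ((Polynomial.reverse_natDegree_le _).trans hdeg.le))]
  refine Finset.sum_congr rfl fun k hk => ?_
  have hk' : k ≤ m := Nat.lt_succ_iff.1 (Finset.mem_range.1 hk)
  have hsub : m - (m - k) = k := Nat.sub_sub_self hk'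
  rw [Polynomial.coeff_reverse, hdeg, Polynomial.revAt_le hk',
    Polynomial.coeff_eq_esymm_roots_of_card (by rw [hA, hdeg]) (by rw [hdeg]; omega), hdeg, hsub,
    (Matrix.charpoly_monic A).leadingCoeff, one_mul, neg_pow t]
  have : ((-1 : ℝ) ^ k) * (-1) ^ k = 1 := by rw [← mul_pow]; simp
  linear_combination (A.charpoly.roots.esymm k * t ^ k) * this

/-- Jacobi's formula along a line; the derivative of each column is evaluated by Cramer's rule. -/
theorem hasDerivAt_det (B A : Matrix (Fin m) (Fin m) ℝ) (t : ℝ) :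
    HasDerivAt (fun s : ℝ => (B + s • A).det) ((B + t • A).adjugate * A).trace t := by
  let F : ContinuousMultilinearMap ℝ (fun _ : Fin m => Fin m → ℝ) ℝ :=
    ⟨(Matrix.detRowAlternating (R := ℝ) (n := Fin m)).toMultilinearMap,
      Continuous.matrix_det continuous_id⟩
  have hrow : ∀ i, HasFDerivAt (fun s : ℝ => fun j => (B + s • A)ᵀ i j)
      (ContinuousLinearMap.toSpanSingleton ℝ fun j => Aᵀ i j) t := by
    intro i
    rw [← hasDerivAt_iff_hasFDerivAt]
    refine hasDerivAt_pi.2 fun j => ?_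
    simpa using ((hasDerivAt_id t).mul_const (A j i)).const_add (B j i)
  have h := (HasFDerivAt.multilinear_comp F hrow).hasDerivAt
  have e : (fun s : ℝ => (B + s • A).det) = fun s : ℝ => F fun i => fun j => (B + s • A)ᵀ i j := by
    funext s
    rw [← Matrix.det_transpose]
    rfl
  rw [e]
  refine h.congr_deriv ?_
  simp only [_root_.sum_apply, ContinuousLinearMap.comp_apply,
    ContinuousLinearMap.toSpanSingleton_apply, one_smul, Matrix.trace, Matrix.diag_apply]
  refine Finset.sum_congr rfl fun i _ => ?_
  have h2 : ((B + t • A).adjugate * A) i i = ((B + t • A).adjugate *ᵥ fun k => A k i) i := rfl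
  rw [h2, ← Matrix.cramer_eq_adjugate_mulVec, Matrix.cramer_apply, ← Matrix.det_transpose,
    ← Matrix.updateRow_transpose]
  rfl

theorem divergence_eq_sum {x ν : Coord m} {A : Matrix (Fin m) (Fin m) ℝ}
    (hA : Multiset.card A.charpoly.roots = m) (t : ℝ) :
    divergence t x ν A = ∑ k ∈ Finset.range m, t ^ k * ((k + 1) * m.choose (k + 1) *
      (A.charpoly.roots.esymm k / m.choose k / height x
        - A.charpoly.roots.esymm (k + 1) / m.choose (k + 1) * metric x (X x) ν)) := by
  set S := A.charpoly.roots.esymm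
  -- Both sides are the derivative of `det(1 + t A)`: one by Jacobi's formula, one from the
  -- expansion in powers of `t`.
  have h1 : ((1 + t • A).adjugate * A).trace
      = ∑ k ∈ Finset.range (m + 1), S k * (k * t ^ (k - 1)) := by
    refine (hasDerivAt_det 1 A t).unique ?_
    have e : (fun s : ℝ => (1 + s • A).det)
        = fun s => ∑ k ∈ Finset.range (m + 1), S k * s ^ k := funext (det_one_add_smul hA)
    rw [e]
    exact HasDerivAt.fun_sum fun k _ => (hasDerivAt_pow k t).const_mul (S k)
  -- The trace of `adj(B) B = det B • 1`.
  have h2 : (1 + t • A).adjugate.trace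
      = m * (1 + t • A).det - t * ((1 + t • A).adjugate * A).trace := by
    have := congrArg Matrix.trace (Matrix.adjugate_mul (1 + t • A))
    rw [Matrix.mul_add, Matrix.mul_one, Matrix.mul_smul, Matrix.trace_add, Matrix.trace_smul,
      Matrix.trace_smul, Matrix.trace_one, Fintype.card_fin, smul_eq_mul, smul_eq_mul] at this
    linarith
  have h3 : (1 + t • A).adjugate.trace
      = ∑ k ∈ Finset.range m, t ^ k * ((m - k) * S k) := by
    rw [h2, show (1 + t • A).det = ∑ k ∈ Finset.range (m + 1), S k * t ^ k from
      det_one_add_smul hA t, h1, Finset.mul_sum, Finset.mul_sum, ← Finset.sum_sub_distrib,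
      Finset.sum_range_succ]
    have h4 : ∀ k : ℕ, m * (S k * t ^ k) - t * (S k * (k * t ^ (k - 1)))
        = t ^ k * ((m - k) * S k) := by
      intro k
      rcases k with _ | k
      · simp
      · simp only [Nat.add_sub_cancel, pow_succ]; ring
    simp only [h4]
    simp
  rw [divergence, h3, h1, Finset.sum_range_succ', Finset.mul_sum]
  simp only [Nat.cast_zero, zero_mul, mul_zero, add_zero, Nat.add_sub_cancel]
  rw [Finset.mul_sum, ← Finset.sum_sub_distrib]
  refine Finset.sum_congr rfl fun k hk => ?_
  have hk' : k < m := Finset.mem_range.1 hk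
  have hc : ((m.choose k : ℕ) : ℝ) ≠ 0 := by exact_mod_cast (Nat.choose_pos hk'.le).ne'
  have hc' : ((m.choose (k + 1) : ℕ) : ℝ) ≠ 0 := by exact_mod_cast (Nat.choose_pos hk').ne'
  -- This binomial identity is why the normalized curvatures `H_k` give an identity without
  -- constants: both terms acquire the same factor.
  have hch : ((m.choose (k + 1) : ℕ) : ℝ) * (k + 1) = m.choose k * (m - k) := by
    have := Nat.choose_succ_right_eq m k
    rw [← Nat.cast_sub hk'.le]
    exact_mod_cast this
  have e1 : (k + 1) * (m.choose (k + 1) : ℝ) * (S k / m.choose k / height x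
        - S (k + 1) / m.choose (k + 1) * metric x (X x) ν)
      = (m.choose (k + 1) : ℝ) * (k + 1) / m.choose k * S k / height x
        - (k + 1) * S (k + 1) * metric x (X x) ν := by
    field_simp
  rw [e1, hch]
  push_cast
  field_simp

theorem gram_posDef {x : Coord m} (hx : 0 < height x) {ψ : Fin m → Coord m}
    (h : LinearIndependent ℝ ψ) : (gram x ψ).PosDef := by
  have e : gram x ψ = (height x ^ 2)⁻¹ • Matrix.gram ℝ ψ := by
    ext i j
    simp [gram, metric, Matrix.gram_apply, div_eq_inv_mul]
  rw [e]
  exact (Matrix.posDef_gram_of_linearIndependent h).smul (by positivity)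

theorem LocalHypersurface.card_roots_charpoly {ψ ν : EuclideanSpace ℝ (Fin m) → Coord m}
    {dψ dν : EuclideanSpace ℝ (Fin m) → EuclideanSpace ℝ (Fin m) →L[ℝ] Coord m}
    {u : EuclideanSpace ℝ (Fin m)} (H : LocalHypersurface ψ ν dψ dν u) :
    Multiset.card (weingarten (ψ u) (ν u) (dψ u) (dν u)).charpoly.roots = m := by
  refine HalfSpace.card_roots_charpoly
    (gram_posDef H.height_pos (linearIndependent_coordFrame H.injective)) ?_
  ext i j
  exact H.metric_shape_symm _ _

end CharacteristicPolynomial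

/-! ### The divergence theorem on a half space. -/

section HalfSpaceDivergence

theorem integral_divergence_halfSpace_pi {n : ℕ} (W : (Fin (n + 1) → ℝ) → Fin (n + 1) → ℝ)
    (W' : (Fin (n + 1) → ℝ) → (Fin (n + 1) → ℝ) →L[ℝ] (Fin (n + 1) → ℝ)) {R : ℝ} (hR : 0 < R)
    (hc : ContinuousOn W {u | 0 ≤ u 0}) (hzero : ∀ u, R ≤ ‖u‖ → W u = 0)
    (hbd : ∀ u, u 0 = 0 → W u 0 = 0) (hd : ∀ u, 0 < u 0 → HasFDerivAt W (W' u) u)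
    (hi : IntegrableOn (fun u => ∑ i, W' u (Pi.single i 1) i) {u | 0 ≤ u 0}) :
    ∫ u in {u : Fin (n + 1) → ℝ | 0 ≤ u 0}, ∑ i, W' u (Pi.single i 1) i = 0 := by
  -- The box `[0, R] × [-R, R]ⁿ`: the field vanishes on every face but `u 0 = 0`, and there its
  -- normal component is zero.
  set a : Fin (n + 1) → ℝ := Function.update (fun _ => -R) 0 0 with ha
  set b : Fin (n + 1) → ℝ := fun _ => R with hb
  have ha0 : a 0 = 0 := by simp [ha]
  have ha1 : ∀ i, i ≠ 0 → a i = -R := fun i hi => by simp [ha, hi]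
  have hab : a ≤ b := by
    intro i
    by_cases h : i = 0
    · subst h; rw [ha0]; exact hR.le
    · rw [ha1 i h]; simp only [hb]; linarith
  have hsub : Set.Icc a b ⊆ {u | 0 ≤ u 0} := fun u hu => by
    have := hu.1 0
    rwa [ha0] at this
  have h := integral_divergence_of_hasFDerivAt_off_countable a b hab W W' ∅ Set.countable_empty
    (hc.mono hsub) (fun u hu => hd u (by simpa [ha0] using (hu.1 0 (Set.mem_univ _)).1))
    (hi.mono_set hsub)
  have hset : ∫ u in {u : Fin (n + 1) → ℝ | 0 ≤ u 0}, ∑ i, W' u (Pi.single i 1) i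
      = ∫ u in Set.Icc a b, ∑ i, W' u (Pi.single i 1) i := by
    refine setIntegral_eq_of_subset_of_ae_sdiff_eq_zero ?_ hsub ?_
    · exact (measurableSet_le measurable_const (measurable_pi_apply 0)).nullMeasurableSet
    -- Nothing is known about `W'` on the boundary hyperplane, which is removed as a null set.
    · have hnull : ∀ᵐ u : Fin (n + 1) → ℝ, u 0 ≠ 0 := by
        rw [ae_iff]
        simpa [volume_pi] using Measure.pi_hyperplane (fun _ : Fin (n + 1) => (volume : Measure ℝ)) 0 0
      filter_upwards [hnull] with u hu0 hu
      have hpos : 0 < u 0 := lt_of_le_of_ne hu.1 hu0.symm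
      have hnorm : R < ‖u‖ := by
        by_contra hle
        refine hu.2 ⟨fun i => ?_, fun i => ?_⟩
        · have := (abs_le.1 ((norm_le_pi_norm u i).trans (not_lt.1 hle))).1
          by_cases h0 : i = 0
          · subst h0; rw [ha0]; exact hpos.le
          · rw [ha1 i h0]; exact this
        · exact (abs_le.1 ((norm_le_pi_norm u i).trans (not_lt.1 hle))).2
      have hev : W =ᶠ[𝓝 u] fun _ => 0 := by
        filter_upwards [continuous_norm.continuousAt.eventually (lt_mem_nhds hnorm)] with v hv
        exact hzero v hv.le
      have hW : W' u = 0 := (hd u hpos).unique ((hasFDerivAt_const 0 u).congr_of_eventuallyEq hev)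
      simp [hW]
  rw [hset, h]
  refine Finset.sum_eq_zero fun i _ => ?_
  have hface : ∀ (x : Fin n → ℝ), W (i.insertNth (b i) x) i = 0 := by
    intro x
    rw [hzero]
    · rfl
    · have := norm_le_pi_norm (i.insertNth (b i) x : Fin (n + 1) → ℝ) i
      rw [Fin.insertNth_apply_same] at this
      simpa [hb, abs_of_pos hR] using this
  have hface' : ∀ (x : Fin n → ℝ), W (i.insertNth (a i) x) i = 0 := by
    intro x
    by_cases h0 : i = 0
    · subst h0
      apply hbd
      rw [Fin.insertNth_apply_same, ha0]
    rw [hzero]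
    · rfl
    · have := norm_le_pi_norm (i.insertNth (a i) x : Fin (n + 1) → ℝ) i
      rwa [Fin.insertNth_apply_same, ha1 i h0, norm_neg, Real.norm_of_nonneg hR.le,
        ← ha1 i h0] at this
  simp [hface, hface']

/-- The divergence theorem on the half space `{u | 0 ≤ u 0}`, for a compactly supported field
that is tangent to the boundary. -/
theorem integral_divergence_halfSpace {m : ℕ} [NeZero m]
    (W : EuclideanSpace ℝ (Fin m) → Fin m → ℝ)
    (W' : EuclideanSpace ℝ (Fin m) → EuclideanSpace ℝ (Fin m) →L[ℝ] (Fin m → ℝ))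
    {K : Set (EuclideanSpace ℝ (Fin m))} (hK : IsCompact K)
    (hc : ContinuousOn W {u | 0 ≤ u 0}) (hzero : ∀ u, u ∉ K → W u = 0)
    (hbd : ∀ u, u 0 = 0 → W u 0 = 0) (hd : ∀ u, 0 < u 0 → HasFDerivAt W (W' u) u)
    (hi : IntegrableOn (fun u => ∑ i, W' u (EuclideanSpace.single i 1) i)
      {u : EuclideanSpace ℝ (Fin m) | 0 ≤ u 0}) :
    ∫ u in {u : EuclideanSpace ℝ (Fin m) | 0 ≤ u 0},
      ∑ i, W' u (EuclideanSpace.single i 1) i = 0 := by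
  obtain ⟨n, rfl⟩ : ∃ n, m = n + 1 := Nat.exists_eq_succ_of_ne_zero (NeZero.ne m)
  let T : (Fin (n + 1) → ℝ) ≃L[ℝ] EuclideanSpace ℝ (Fin (n + 1)) :=
    (EuclideanSpace.equiv (Fin (n + 1)) ℝ).symm
  have hT : ∀ u i, T u i = u i := fun u i => rfl
  have hTs : ∀ i, T (Pi.single i 1) = EuclideanSpace.single i 1 := fun i => rfl
  have hmp : MeasurePreserving T := PiLp.volume_preserving_toLp (Fin (n + 1))
  have hme : MeasurableEmbedding T := T.toHomeomorph.measurableEmbedding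
  have hpre : T ⁻¹' {u : EuclideanSpace ℝ (Fin (n + 1)) | 0 ≤ u 0} = {u | 0 ≤ u 0} := rfl
  obtain ⟨R, hR, hKR⟩ : ∃ R, 0 < R ∧ T ⁻¹' K ⊆ Metric.ball 0 R := by
    have hb : Bornology.IsBounded (T ⁻¹' K) :=
      (T.toHomeomorph.isCompact_preimage.2 hK).isBounded
    obtain ⟨R, hR⟩ := hb.subset_ball 0
    exact ⟨max R 1, by positivity, hR.trans (Metric.ball_subset_ball (le_max_left _ _))⟩
  have h := integral_divergence_halfSpace_pi (fun u => W (T u))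
    (fun u => (W' (T u)).comp (T : (Fin (n + 1) → ℝ) →L[ℝ] EuclideanSpace ℝ (Fin (n + 1)))) hR
    (hc.comp T.continuous.continuousOn fun u hu => hu)
    (fun u hu => hzero _ fun hmem => by
      have := hKR hmem
      rw [mem_ball_zero_iff] at this
      linarith)
    (fun u hu => hbd _ hu)
    (fun u hu => (hd (T u) hu).comp u T.hasFDerivAt)
    (by
      have := (hmp.integrableOn_comp_preimage hme).2 hi
      exact this)
  rw [← hmp.setIntegral_preimage_emb hme]
  exact h

end HalfSpaceDivergence

open Set

set_option linter.unusedSectionVars false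

/-! ### Maps and derivatives read in charts. -/

section Charts

variable {m : ℕ} [NeZero m] {M : Type*} [TopologicalSpace M]
  [ChartedSpace (EuclideanHalfSpace m) M]
  {V : Type*} [NormedAddCommGroup V] [NormedSpace ℝ V]

/-- A function on `M`, read in the preferred chart at `p`. -/
def chartMap (F : M → V) (p : M) : EuclideanSpace ℝ (Fin m) → V :=
  F ∘ (extChartAt (𝓡∂ m) p).symm

/-- The derivative of a function on `M`, read in the preferred chart at `p`. -/
def chartDeriv (F : M → V) (p : M) (u : EuclideanSpace ℝ (Fin m)) :
    EuclideanSpace ℝ (Fin m) →L[ℝ] V :=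
  fderivWithin ℝ (chartMap F p) (range (𝓡∂ m)) u

/-- The derivative of the transition map from the chart at `q` to the chart at `p`. -/
def transitionDeriv (p q : M) (u : EuclideanSpace ℝ (Fin m)) :
    EuclideanSpace ℝ (Fin m) →L[ℝ] EuclideanSpace ℝ (Fin m) :=
  fderivWithin ℝ (extChartAt (𝓡∂ m) p ∘ (extChartAt (𝓡∂ m) q).symm) (range (𝓡∂ m)) u

theorem measurableSet_target (p : M) : MeasurableSet (extChartAt (𝓡∂ m) p).target := by
  rw [extChartAt_target]
  exact (((chartAt _ p).open_target.preimage (𝓡∂ m).continuous_symm).measurableSet).inter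
    (𝓡∂ m).isClosed_range.measurableSet

theorem mem_range_iff {u : EuclideanSpace ℝ (Fin m)} : u ∈ range (𝓡∂ m) ↔ 0 ≤ u 0 := by
  rw [range_modelWithCornersEuclideanHalfSpace]; rfl

theorem nonneg_of_mem_target {p : M} {u : EuclideanSpace ℝ (Fin m)}
    (hu : u ∈ (extChartAt (𝓡∂ m) p).target) : 0 ≤ u 0 :=
  mem_range_iff.1 (extChartAt_target_subset_range p hu)

theorem target_mem_nhds {p : M} {u : EuclideanSpace ℝ (Fin m)}
    (hu : u ∈ (extChartAt (𝓡∂ m) p).target) (h0 : 0 < u 0) :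
    (extChartAt (𝓡∂ m) p).target ∈ 𝓝 u := by
  have h1 : range (𝓡∂ m) ∈ 𝓝 u := by
    rw [← mem_interior_iff_mem_nhds, interior_range_modelWithCornersEuclideanHalfSpace]
    exact h0
  have h2 := extChartAt_target_mem_nhdsWithin_of_mem hu
  rwa [nhdsWithin_eq_nhds.2 h1] at h2

theorem fderivWithin_target {p : M} {u : EuclideanSpace ℝ (Fin m)}
    (hu : u ∈ (extChartAt (𝓡∂ m) p).target) (G : EuclideanSpace ℝ (Fin m) → V) :
    fderivWithin ℝ G (extChartAt (𝓡∂ m) p).target u = fderivWithin ℝ G (range (𝓡∂ m)) u :=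
  fderivWithin_congr_set (extChartAt_target_eventuallyEq_of_mem hu)

variable [IsManifold (𝓡∂ m) ∞ M]

theorem contDiffOn_chartMap {F : M → V} (hF : ContMDiff (𝓡∂ m) 𝓘(ℝ, V) ∞ F) (p : M) :
    ContDiffOn ℝ ∞ (chartMap F p) (extChartAt (𝓡∂ m) p).target := by
  rw [← contMDiffOn_iff_contDiffOn]
  exact hF.comp_contMDiffOn (contMDiffOn_extChartAt_symm p)

theorem continuousOn_chartDeriv {F : M → V} (hF : ContMDiff (𝓡∂ m) 𝓘(ℝ, V) ∞ F) (p : M) :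
    ContinuousOn (chartDeriv F p) (extChartAt (𝓡∂ m) p).target :=
  ((contDiffOn_chartMap hF p).continuousOn_fderivWithin (uniqueDiffOn_extChartAt_target p)
    (by simp)).congr fun u hu => (fderivWithin_target hu _).symm

theorem hasFDerivWithinAt_chartMap {F : M → V} (hF : ContMDiff (𝓡∂ m) 𝓘(ℝ, V) ∞ F) {p : M}
    {u : EuclideanSpace ℝ (Fin m)} (hu : u ∈ (extChartAt (𝓡∂ m) p).target) :
    HasFDerivWithinAt (chartMap F p) (chartDeriv F p u) (range (𝓡∂ m)) u := by
  have h := ((contDiffOn_chartMap hF p).differentiableOn (by simp)) u hu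
  exact (h.mono_of_mem_nhdsWithin (extChartAt_target_mem_nhdsWithin_of_mem hu)).hasFDerivWithinAt

theorem hasFDerivAt_chartMap {F : M → V} (hF : ContMDiff (𝓡∂ m) 𝓘(ℝ, V) ∞ F) {p : M}
    {u : EuclideanSpace ℝ (Fin m)} (hu : u ∈ (extChartAt (𝓡∂ m) p).target) (h0 : 0 < u 0) :
    HasFDerivAt (chartMap F p) (chartDeriv F p u) u :=
  (hasFDerivWithinAt_chartMap hF hu).hasFDerivAt
    (Filter.mem_of_superset (target_mem_nhds hu h0) (extChartAt_target_subset_range p))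

theorem eventually_mem_target {p : M} {u : EuclideanSpace ℝ (Fin m)}
    (hu : u ∈ (extChartAt (𝓡∂ m) p).target) (h0 : 0 < u 0) :
    ∀ᶠ y in 𝓝 u, y ∈ (extChartAt (𝓡∂ m) p).target ∧ 0 < y 0 :=
  Filter.Eventually.and (target_mem_nhds hu h0)
    (((EuclideanSpace.proj (0 : Fin m) : EuclideanSpace ℝ (Fin m) →L[ℝ] ℝ).continuous.continuousAt
      (x := u)).eventually (lt_mem_nhds h0))

theorem differentiableAt_chartDeriv {F : M → V} (hF : ContMDiff (𝓡∂ m) 𝓘(ℝ, V) ∞ F) {p : M}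
    {u : EuclideanSpace ℝ (Fin m)} (hu : u ∈ (extChartAt (𝓡∂ m) p).target) (h0 : 0 < u 0) :
    DifferentiableAt ℝ (chartDeriv F p) u := by
  have h1 : ContDiffAt ℝ ∞ (chartMap F p) u :=
    (contDiffOn_chartMap hF p).contDiffAt (target_mem_nhds hu h0)
  have h2 : ContDiffAt ℝ 1 (fderiv ℝ (chartMap F p)) u :=
    h1.fderiv_right (m := 1) (by norm_cast)
  refine (h2.differentiableAt (by simp)).congr_of_eventuallyEq ?_
  filter_upwards [eventually_mem_target hu h0] with y hy
  exact (hasFDerivAt_chartMap hF hy.1 hy.2).fderiv.symm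

theorem hasFDerivWithinAt_transition {p q z : M} (hp : z ∈ (extChartAt (𝓡∂ m) p).source)
    (hq : z ∈ (extChartAt (𝓡∂ m) q).source) :
    HasFDerivWithinAt (extChartAt (𝓡∂ m) p ∘ (extChartAt (𝓡∂ m) q).symm)
      (transitionDeriv p q (extChartAt (𝓡∂ m) q z)) (range (𝓡∂ m)) (extChartAt (𝓡∂ m) q z) := by
  have h := contDiffWithinAt_ext_coord_change (I := 𝓡∂ m) (n := ∞) p q
    (y := extChartAt (𝓡∂ m) q z) (by
      rw [PartialEquiv.trans_source, PartialEquiv.symm_source]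
      refine ⟨(extChartAt (𝓡∂ m) q).map_source hq, ?_⟩
      rwa [mem_preimage, (extChartAt (𝓡∂ m) q).left_inv hq])
  exact (h.differentiableWithinAt (by simp)).hasFDerivWithinAt

theorem chartDeriv_eq_comp {F : M → V} (hF : ContMDiff (𝓡∂ m) 𝓘(ℝ, V) ∞ F) {p q z : M}
    (hp : z ∈ (extChartAt (𝓡∂ m) p).source) (hq : z ∈ (extChartAt (𝓡∂ m) q).source) :
    chartDeriv F q (extChartAt (𝓡∂ m) q z)
      = (chartDeriv F p (extChartAt (𝓡∂ m) p z)).comp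
        (transitionDeriv p q (extChartAt (𝓡∂ m) q z)) := by
  have hu : UniqueDiffWithinAt ℝ (range (𝓡∂ m)) (extChartAt (𝓡∂ m) q z) :=
    (𝓡∂ m).uniqueDiffOn _ (extChartAt_target_subset_range q ((extChartAt (𝓡∂ m) q).map_source hq))
  have hτz : (extChartAt (𝓡∂ m) p ∘ (extChartAt (𝓡∂ m) q).symm) (extChartAt (𝓡∂ m) q z)
      = extChartAt (𝓡∂ m) p z := by
    rw [Function.comp_apply, (extChartAt (𝓡∂ m) q).left_inv hq]
  have h1 := hasFDerivWithinAt_chartMap hF ((extChartAt (𝓡∂ m) p).map_source hp)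
  rw [← hτz] at h1
  have h2 := h1.comp (extChartAt (𝓡∂ m) q z) (hasFDerivWithinAt_transition hp hq)
    (fun u _ => mem_range_self _)
  rw [hτz] at h2
  refine (h2.congr_of_eventuallyEq ?_ ?_).fderivWithin hu
  · have hmem := extChartAt_preimage_mem_nhdsWithin' (I := 𝓡∂ m) (s := univ) hq
      (t := (extChartAt (𝓡∂ m) p).source) (by
        rw [nhdsWithin_univ]; exact extChartAt_source_mem_nhds' hp)
    rw [preimage_univ, univ_inter] at hmem
    filter_upwards [hmem] with u hu'
    simp only [chartMap, Function.comp_apply, (extChartAt (𝓡∂ m) p).left_inv hu']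
  · simp only [chartMap, Function.comp_apply, (extChartAt (𝓡∂ m) q).left_inv hq,
      (extChartAt (𝓡∂ m) p).left_inv hp]

theorem mfderiv_eq_chartDeriv {F : M → V} (hF : ContMDiff (𝓡∂ m) 𝓘(ℝ, V) ∞ F) (q : M) :
    mfderiv (𝓡∂ m) 𝓘(ℝ, V) F q = chartDeriv F q (extChartAt (𝓡∂ m) q q) := by
  rw [((hF q).mdifferentiableAt (by simp)).mfderiv]
  rfl

/-- The immersion hypothesis refers to the preferred chart at `z` itself. There the derivative
factors as `L ∘ J`; injectivity passes to the endomorphism `J`, which is then bijective, and hence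
to `L`. -/
theorem transition_chartDeriv_bijective {f : M → Coord m}
    (hf : ContMDiff (𝓡∂ m) 𝓘(ℝ, Coord m) ∞ f)
    (himm : ∀ p, Function.Injective (mfderiv (𝓡∂ m) 𝓘(ℝ, Coord m) f p)) {p z : M}
    (hp : z ∈ (extChartAt (𝓡∂ m) p).source) :
    Function.Bijective (transitionDeriv p z (extChartAt (𝓡∂ m) z z)) ∧
      Function.Injective (chartDeriv f p (extChartAt (𝓡∂ m) p z)) := by
  have h := himm z
  rw [mfderiv_eq_chartDeriv hf z, chartDeriv_eq_comp hf hp (mem_extChartAt_source z)] at h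
  set J := transitionDeriv p z (extChartAt (𝓡∂ m) z z)
  set L := chartDeriv f p (extChartAt (𝓡∂ m) p z)
  have hLJ : Function.Injective (L ∘ J) := h
  have hJ : Function.Injective J := hLJ.of_comp
  have hJs : Function.Surjective J :=
    (LinearMap.injective_iff_surjective (f := (J : EuclideanSpace ℝ (Fin m) →ₗ[ℝ] _))).1 hJ
  exact ⟨⟨hJ, hJs⟩, hLJ.of_comp_right hJs⟩

theorem chartDeriv_injective {f : M → Coord m} (hf : ContMDiff (𝓡∂ m) 𝓘(ℝ, Coord m) ∞ f)
    (himm : ∀ p, Function.Injective (mfderiv (𝓡∂ m) 𝓘(ℝ, Coord m) f p)) {p : M}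
    {u : EuclideanSpace ℝ (Fin m)} (hu : u ∈ (extChartAt (𝓡∂ m) p).target) :
    Function.Injective (chartDeriv f p u) := by
  have := (transition_chartDeriv_bijective hf himm ((extChartAt (𝓡∂ m) p).map_target hu)).2
  rwa [(extChartAt (𝓡∂ m) p).right_inv hu] at this

theorem isUnit_det_jacobian {J : EuclideanSpace ℝ (Fin m) →L[ℝ] EuclideanSpace ℝ (Fin m)}
    (hJ : Function.Injective J) : IsUnit (jacobian J).det := by
  rw [det_jacobian]
  exact LinearEquiv.isUnit_det' (LinearEquiv.ofInjectiveEndo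
    (J : EuclideanSpace ℝ (Fin m) →ₗ[ℝ] EuclideanSpace ℝ (Fin m)) hJ)

theorem isUnit_det_transition {f : M → Coord m} (hf : ContMDiff (𝓡∂ m) 𝓘(ℝ, Coord m) ∞ f)
    (himm : ∀ p, Function.Injective (mfderiv (𝓡∂ m) 𝓘(ℝ, Coord m) f p)) {p q z : M}
    (hp : z ∈ (extChartAt (𝓡∂ m) p).source) (hq : z ∈ (extChartAt (𝓡∂ m) q).source) :
    IsUnit (jacobian (transitionDeriv p q (extChartAt (𝓡∂ m) q z))).det := by
  refine isUnit_det_jacobian ?_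
  have h := chartDeriv_injective hf himm ((extChartAt (𝓡∂ m) q).map_source hq)
  rw [chartDeriv_eq_comp hf hp hq] at h
  exact Function.Injective.of_comp (f := chartDeriv f p (extChartAt (𝓡∂ m) p z)) h

end Charts

/-! ### The area measure and integration in charts. -/

section Area

theorem ae_ne_zero_zero {m : ℕ} [NeZero m] : ∀ᵐ u : EuclideanSpace ℝ (Fin m), u 0 ≠ 0 := by
  have h1 := (PiLp.volume_preserving_ofLp (Fin m)).measure_preimage
    (s := {u : Fin m → ℝ | u 0 = 0})
    (measurableSet_eq_fun (measurable_pi_apply 0) measurable_const).nullMeasurableSet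
  rw [volume_pi] at h1
  rw [ae_iff]
  have h2 : {u : EuclideanSpace ℝ (Fin m) | ¬u 0 ≠ 0}
      = WithLp.ofLp ⁻¹' {u : Fin m → ℝ | u 0 = 0} := by
    ext u; simp
  rw [h2]
  exact h1.trans (Measure.pi_hyperplane (fun _ : Fin m => (volume : Measure ℝ)) 0 0)

variable {m : ℕ} [NeZero m] {M : Type*} [TopologicalSpace M]
  [ChartedSpace (EuclideanHalfSpace m) M] [MeasurableSpace M] [BorelSpace M]

theorem aemeasurable_extChartAt_symm (p : M) :
    AEMeasurable (extChartAt (𝓡∂ m) p).symm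
      (volume.restrict (extChartAt (𝓡∂ m) p).target) :=
  (continuousOn_extChartAt_symm p).aemeasurable (measurableSet_target p)

theorem chartArea_apply (f : M → Coord m) (p : M) {B : Set M} (hB : MeasurableSet B) :
    chartArea f p B = ∫⁻ u in (extChartAt (𝓡∂ m) p).symm ⁻¹' B ∩ (extChartAt (𝓡∂ m) p).target,
      ENNReal.ofReal (areaDensity f p u) := by
  rw [chartArea, Measure.map_apply_of_aemeasurable
    ((aemeasurable_extChartAt_symm p).mono_ac (withDensity_absolutelyContinuous _ _)) hB,
    withDensity_apply', Measure.restrict_restrict' (measurableSet_target p)]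

theorem measurableSet_preimage_inter_target (p : M) {B : Set M} (hB : MeasurableSet B) :
    MeasurableSet ((extChartAt (𝓡∂ m) p).symm ⁻¹' B ∩ (extChartAt (𝓡∂ m) p).target) := by
  have h := (continuousOn_iff_continuous_domRestrict.1
    (continuousOn_extChartAt_symm (I := 𝓡∂ m) p)).measurable hB
  convert! (measurableSet_target p).subtype_image h using 1
  ext u
  simp [and_comm]

theorem image_eq_preimage_inter_target {p : M} {B : Set M}
    (hB : B ⊆ (extChartAt (𝓡∂ m) p).source) :
    extChartAt (𝓡∂ m) p '' B
      = (extChartAt (𝓡∂ m) p).symm ⁻¹' B ∩ (extChartAt (𝓡∂ m) p).target := by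
  ext u
  constructor
  · rintro ⟨z, hz, rfl⟩
    exact ⟨by rwa [mem_preimage, (extChartAt (𝓡∂ m) p).left_inv (hB hz)],
      (extChartAt (𝓡∂ m) p).map_source (hB hz)⟩
  · rintro ⟨h1, h2⟩
    exact ⟨_, h1, (extChartAt (𝓡∂ m) p).right_inv h2⟩

theorem chartArea_compl_source (f : M → Coord m) (p : M) :
    chartArea f p (extChartAt (𝓡∂ m) p).sourceᶜ = 0 := by
  rw [chartArea_apply f p (isOpen_extChartAt_source p).measurableSet.compl]
  have : (extChartAt (𝓡∂ m) p).symm ⁻¹' (extChartAt (𝓡∂ m) p).sourceᶜ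
      ∩ (extChartAt (𝓡∂ m) p).target = ∅ := by
    ext u
    simp only [mem_inter_iff, mem_preimage, mem_compl_iff, mem_empty_iff_false, iff_false, not_and]
    intro h1 h2
    exact h1 ((extChartAt (𝓡∂ m) p).map_target h2)
  rw [this]
  simp

theorem areaDensity_eq (f : M → Coord m) (p : M) (u : EuclideanSpace ℝ (Fin m)) :
    areaDensity f p u
      = Real.sqrt (gram (chartMap f p u) (coordFrame (chartDeriv f p u))).det := rfl

variable [IsManifold (𝓡∂ m) ∞ M]

theorem areaDensity_transition {f : M → Coord m} (hf : ContMDiff (𝓡∂ m) 𝓘(ℝ, Coord m) ∞ f)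
    {p q z : M} (hp : z ∈ (extChartAt (𝓡∂ m) p).source) (hq : z ∈ (extChartAt (𝓡∂ m) q).source) :
    areaDensity f q (extChartAt (𝓡∂ m) q z)
      = |(transitionDeriv p q (extChartAt (𝓡∂ m) q z)).det|
        * areaDensity f p (extChartAt (𝓡∂ m) p z) := by
  have h1 : chartMap f q (extChartAt (𝓡∂ m) q z) = f z := by
    rw [chartMap, Function.comp_apply, (extChartAt (𝓡∂ m) q).left_inv hq]
  have h2 : chartMap f p (extChartAt (𝓡∂ m) p z) = f z := by
    rw [chartMap, Function.comp_apply, (extChartAt (𝓡∂ m) p).left_inv hp]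
  rw [areaDensity_eq, areaDensity_eq, h1, h2, chartDeriv_eq_comp hf hp hq, gram_comp,
    Matrix.det_mul, Matrix.det_mul, Matrix.det_transpose, det_jacobian, ← Real.sqrt_sq_eq_abs,
    ← Real.sqrt_mul (sq_nonneg _)]
  congr 1
  ring

/-- Change of variables along the transition map, whose Jacobian determinant is the quotient of the
two area densities. -/
theorem chartArea_eq_of_subset {f : M → Coord m} (hf : ContMDiff (𝓡∂ m) 𝓘(ℝ, Coord m) ∞ f)
    {p q : M} {B : Set M} (hB : MeasurableSet B) (hp : B ⊆ (extChartAt (𝓡∂ m) p).source)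
    (hq : B ⊆ (extChartAt (𝓡∂ m) q).source) : chartArea f p B = chartArea f q B := by
  rw [chartArea_apply f p hB, chartArea_apply f q hB, ← image_eq_preimage_inter_target hp,
    ← image_eq_preimage_inter_target hq]
  have himg : extChartAt (𝓡∂ m) p '' B = (extChartAt (𝓡∂ m) p ∘ (extChartAt (𝓡∂ m) q).symm) ''
      (extChartAt (𝓡∂ m) q '' B) := by
    rw [image_image]
    refine image_congr fun z hz => ?_
    rw [Function.comp_apply, (extChartAt (𝓡∂ m) q).left_inv (hq hz)]
  have hmeas : MeasurableSet (extChartAt (𝓡∂ m) q '' B) := by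
    rw [image_eq_preimage_inter_target hq]
    exact measurableSet_preimage_inter_target q hB
  rw [himg, lintegral_image_eq_lintegral_abs_det_fderiv_mul volume hmeas
    (f' := transitionDeriv p q)]
  · refine setLIntegral_congr_fun hmeas ?_
    rintro _ ⟨z, hz, rfl⟩
    simp only
    rw [areaDensity_transition hf (hp hz) (hq hz), ENNReal.ofReal_mul (abs_nonneg _),
      Function.comp_apply, (extChartAt (𝓡∂ m) q).left_inv (hq hz)]
  · rintro _ ⟨z, hz, rfl⟩
    refine (hasFDerivWithinAt_transition (hp hz) (hq hz)).mono ?_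
    rintro _ ⟨w, hw, rfl⟩
    exact extChartAt_target_subset_range q ((extChartAt (𝓡∂ m) q).map_source (hq hw))
  · rintro _ ⟨z, hz, rfl⟩ _ ⟨w, hw, rfl⟩ h
    simp only [Function.comp_apply, (extChartAt (𝓡∂ m) q).left_inv (hq hz),
      (extChartAt (𝓡∂ m) q).left_inv (hq hw)] at h
    rw [(extChartAt (𝓡∂ m) p).injOn (hp hz) (hp hw) h]

/-- The measure `chartArea f p + (area f).restrict Sᶜ`, with `S` the chart domain, dominates every
chart measure, hence their supremum; its second summand does not see `B`. -/
theorem area_apply_of_subset {f : M → Coord m} (hf : ContMDiff (𝓡∂ m) 𝓘(ℝ, Coord m) ∞ f)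
    {p : M} {B : Set M} (hB : MeasurableSet B) (hp : B ⊆ (extChartAt (𝓡∂ m) p).source) :
    area f B = chartArea f p B := by
  set S := (extChartAt (𝓡∂ m) p).source with hS
  have hSm : MeasurableSet S := (isOpen_extChartAt_source p).measurableSet
  have hle : chartArea f p ≤ area f := le_iSup (chartArea f) p
  refine le_antisymm ?_ (hle B)
  have hup : area f ≤ chartArea f p + (area f).restrict Sᶜ := by
    refine iSup_le fun q => Measure.le_iff.2 fun C hC => ?_
    set T := (extChartAt (𝓡∂ m) q).source with hT
    have hTm : MeasurableSet T := (isOpen_extChartAt_source q).measurableSet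
    have h1 : chartArea f q (C ∩ S) ≤ chartArea f p C := by
      have h2 : chartArea f q (C ∩ S) = chartArea f q (C ∩ S ∩ T) := by
        refine (measure_inter_conull ?_).symm
        exact chartArea_compl_source f q
      rw [h2, chartArea_eq_of_subset hf ((hC.inter hSm).inter hTm) (fun z hz => hz.2)
        (fun z hz => hz.1.2)]
      exact measure_mono fun z hz => hz.1.1
    rw [← measure_inter_add_sdiff C hSm, Measure.add_apply, Measure.restrict_apply hC]
    exact add_le_add h1 (le_iSup (chartArea f) q _)
  refine (hup B).trans ?_
  rw [Measure.add_apply, Measure.restrict_apply hB]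
  have : B ∩ Sᶜ = ∅ := by
    ext z
    simp only [mem_inter_iff, mem_compl_iff, mem_empty_iff_false, iff_false, not_and, not_not]
    exact fun hz => hp hz
  rw [this]
  simp

theorem area_restrict {f : M → Coord m} (hf : ContMDiff (𝓡∂ m) 𝓘(ℝ, Coord m) ∞ f)
    {p : M} {K : Set M} (hK : MeasurableSet K) (hp : K ⊆ (extChartAt (𝓡∂ m) p).source) :
    (area f).restrict K = (chartArea f p).restrict K := by
  ext B hB
  rw [Measure.restrict_apply hB, Measure.restrict_apply hB,
    area_apply_of_subset hf (hB.inter hK) (inter_subset_right.trans hp)]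

/-- Boundary points form a null set, so pointwise facts that need two-sided derivatives may be
proved in the interior only. -/
theorem ae_chartArea (f : M → Coord m) (p : M) {P : M → Prop}
    (hP : ∀ u ∈ (extChartAt (𝓡∂ m) p).target, 0 < u 0 → P ((extChartAt (𝓡∂ m) p).symm u)) :
    ∀ᵐ z ∂(chartArea f p), P z := by
  set S := (extChartAt (𝓡∂ m) p).source with hS
  have hSo : IsOpen S := isOpen_extChartAt_source p
  set U := S ∩ extChartAt (𝓡∂ m) p ⁻¹' {u | 0 < u 0} with hU
  have hUo : IsOpen U := (continuousOn_extChartAt p).isOpen_inter_preimage hSo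
    (isOpen_lt continuous_const
      (EuclideanSpace.proj (0 : Fin m) : EuclideanSpace ℝ (Fin m) →L[ℝ] ℝ).continuous)
  have hnull : chartArea f p Uᶜ = 0 := by
    rw [chartArea_apply f p hUo.measurableSet.compl]
    refine setLIntegral_measure_zero _ _ ?_
    refine measure_mono_null (t := {u : EuclideanSpace ℝ (Fin m) | u 0 = 0}) ?_ ?_
    · rintro u ⟨h1, h2⟩
      by_contra h0
      refine h1 ⟨(extChartAt (𝓡∂ m) p).map_target h2, ?_⟩
      rw [mem_preimage, (extChartAt (𝓡∂ m) p).right_inv h2]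
      exact lt_of_le_of_ne (nonneg_of_mem_target h2) (Ne.symm h0)
    · simpa using ae_iff.1 (ae_ne_zero_zero (m := m))
  have hae : ∀ᵐ z ∂(chartArea f p), z ∈ U := hnull
  filter_upwards [hae] with z hz
  have := hP _ ((extChartAt (𝓡∂ m) p).map_source hz.1) hz.2
  rwa [(extChartAt (𝓡∂ m) p).left_inv hz.1] at this

theorem continuousOn_areaDensity {f : M → Coord m} (hf : ContMDiff (𝓡∂ m) 𝓘(ℝ, Coord m) ∞ f)
    (hpos : ∀ z, 0 < height (f z)) (p : M) :
    ContinuousOn (areaDensity f p) (extChartAt (𝓡∂ m) p).target := by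
  have h1 := (contDiffOn_chartMap hf p).continuousOn
  have h2 := continuousOn_chartDeriv hf p
  have h : ContinuousOn (fun u => gram (chartMap f p u) (coordFrame (chartDeriv f p u)))
      (extChartAt (𝓡∂ m) p).target := by
    refine continuousOn_pi.2 fun i => continuousOn_pi.2 fun j => ?_
    simp only [gram, Matrix.of_apply, metric, coordFrame]
    refine ContinuousOn.div ?_ ?_ fun u hu => pow_ne_zero 2 (hpos _).ne'
    · exact continuous_inner.comp_continuousOn
        ((h2.clm_apply continuousOn_const).prodMk (h2.clm_apply continuousOn_const))
    · exact ((heightL m).continuous.comp_continuousOn h1).pow 2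
  refine Real.continuous_sqrt.comp_continuousOn ?_
  exact (continuous_id.matrix_det).comp_continuousOn h

theorem isCompact_image_extChartAt {p : M} {K : Set M} (hK : IsCompact K)
    (hp : K ⊆ (extChartAt (𝓡∂ m) p).source) : IsCompact (extChartAt (𝓡∂ m) p '' K) :=
  hK.image_of_continuousOn ((continuousOn_extChartAt p).mono hp)

theorem image_subset_target {p : M} {K : Set M} (hp : K ⊆ (extChartAt (𝓡∂ m) p).source) :
    extChartAt (𝓡∂ m) p '' K ⊆ (extChartAt (𝓡∂ m) p).target := by
  rintro _ ⟨z, hz, rfl⟩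
  exact (extChartAt (𝓡∂ m) p).map_source (hp hz)

theorem chartArea_lt_top {f : M → Coord m} (hf : ContMDiff (𝓡∂ m) 𝓘(ℝ, Coord m) ∞ f)
    (hpos : ∀ z, 0 < height (f z)) {p : M} {K : Set M} (hK : IsCompact K) (hKm : MeasurableSet K)
    (hp : K ⊆ (extChartAt (𝓡∂ m) p).source) : chartArea f p K < ⊤ := by
  rw [chartArea_apply f p hKm, ← image_eq_preimage_inter_target hp]
  have h : IntegrableOn (areaDensity f p) (extChartAt (𝓡∂ m) p '' K) volume :=
    ((continuousOn_areaDensity hf hpos p).mono (image_subset_target hp)).integrableOn_compact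
      (isCompact_image_extChartAt hK hp)
  exact h.lintegral_lt_top

variable (m) in
/-- A function on `M` is continuous in charts away from the boundary, with a continuous extension
to the boundary in each chart. -/
def ContinuousInCharts (g : M → ℝ) : Prop :=
  ∀ p : M, ∃ G : EuclideanSpace ℝ (Fin m) → ℝ, ContinuousOn G (extChartAt (𝓡∂ m) p).target ∧
    ∀ u ∈ (extChartAt (𝓡∂ m) p).target, 0 < u 0 → g ((extChartAt (𝓡∂ m) p).symm u) = G u

theorem ae_eq_comp_extChartAt (f : M → Coord m) {g : M → ℝ} {p : M}
    {G : EuclideanSpace ℝ (Fin m) → ℝ}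
    (hg : ∀ u ∈ (extChartAt (𝓡∂ m) p).target, 0 < u 0 → g ((extChartAt (𝓡∂ m) p).symm u) = G u) :
    g =ᵐ[chartArea f p] G ∘ extChartAt (𝓡∂ m) p := by
  refine ae_chartArea f p fun u hu h0 => ?_
  rw [hg u hu h0, Function.comp_apply, (extChartAt (𝓡∂ m) p).right_inv hu]

theorem integrableOn_of_isCompact {f : M → Coord m} (hf : ContMDiff (𝓡∂ m) 𝓘(ℝ, Coord m) ∞ f)
    (hpos : ∀ z, 0 < height (f z)) {g : M → ℝ} {p : M} {G : EuclideanSpace ℝ (Fin m) → ℝ}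
    (hG : ContinuousOn G (extChartAt (𝓡∂ m) p).target)
    (hg : ∀ u ∈ (extChartAt (𝓡∂ m) p).target, 0 < u 0 → g ((extChartAt (𝓡∂ m) p).symm u) = G u)
    {K : Set M} (hK : IsCompact K) (hKm : MeasurableSet K)
    (hp : K ⊆ (extChartAt (𝓡∂ m) p).source) : IntegrableOn g K (area f) := by
  rw [IntegrableOn, area_restrict hf hKm hp]
  have hc : ContinuousOn (G ∘ extChartAt (𝓡∂ m) p) K :=
    hG.comp ((continuousOn_extChartAt p).mono hp)
      fun z hz => (extChartAt (𝓡∂ m) p).map_source (hp hz)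
  obtain ⟨C, hC⟩ := hK.exists_bound_of_continuousOn hc
  have hint : IntegrableOn (G ∘ extChartAt (𝓡∂ m) p) K (chartArea f p) :=
    IntegrableOn.of_bound (chartArea_lt_top hf hpos hK hKm hp) (hc.aestronglyMeasurable hKm) C
      (by filter_upwards [ae_restrict_mem hKm] with z hz using hC z hz)
  exact hint.congr_fun_ae
    (Filter.EventuallyEq.symm (ae_restrict_of_ae (ae_eq_comp_extChartAt f hg)))

theorem integrable_of_continuousInCharts [CompactSpace M] [T2Space M] {f : M → Coord m}
    (hf : ContMDiff (𝓡∂ m) 𝓘(ℝ, Coord m) ∞ f) (hpos : ∀ z, 0 < height (f z)) {g : M → ℝ}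
    (hg : ContinuousInCharts m g) : Integrable g (area f) := by
  have hloc : LocallyIntegrable g (area f) := by
    intro p
    obtain ⟨K, hK, hKS, hKc⟩ := local_compact_nhds
      (extChartAt_source_mem_nhds (I := 𝓡∂ m) p)
    obtain ⟨G, hG, hgG⟩ := hg p
    exact ⟨K, hK, integrableOn_of_isCompact hf hpos hG hgG hKc hKc.measurableSet hKS⟩
  rw [← integrableOn_univ]
  exact hloc.integrableOn_isCompact isCompact_univ

/-- The integral of a function supported in a chart domain. -/
theorem integral_area_eq {f : M → Coord m} (hf : ContMDiff (𝓡∂ m) 𝓘(ℝ, Coord m) ∞ f)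
    (hpos : ∀ z, 0 < height (f z)) {g : M → ℝ} {p : M} {G : EuclideanSpace ℝ (Fin m) → ℝ}
    (hG : ContinuousOn G (extChartAt (𝓡∂ m) p).target)
    (hg : ∀ u ∈ (extChartAt (𝓡∂ m) p).target, 0 < u 0 → g ((extChartAt (𝓡∂ m) p).symm u) = G u)
    (hsupp : ∀ z ∉ (extChartAt (𝓡∂ m) p).source, g z = 0) :
    ∫ z, g z ∂(area f) = ∫ u in (extChartAt (𝓡∂ m) p).target, areaDensity f p u * G u := by
  set S := (extChartAt (𝓡∂ m) p).source with hS
  set T := (extChartAt (𝓡∂ m) p).target with hT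
  have hSm : MeasurableSet S := (isOpen_extChartAt_source p).measurableSet
  have hTm : MeasurableSet T := measurableSet_target p
  have hrestr : (chartArea f p).restrict S = chartArea f p :=
    Measure.restrict_eq_self_of_ae_mem (chartArea_compl_source f p)
  have hGφ : AEStronglyMeasurable (G ∘ extChartAt (𝓡∂ m) p) (chartArea f p) := by
    rw [← hrestr]
    exact (hG.comp (continuousOn_extChartAt p)
      fun z hz => (extChartAt (𝓡∂ m) p).map_source hz).aestronglyMeasurable hSm
  have hdens : AEMeasurable (fun u => Real.toNNReal (areaDensity f p u)) (volume.restrict T) :=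
    ((continuousOn_areaDensity hf hpos p).aemeasurable hTm).real_toNNReal
  rw [← setIntegral_eq_integral_of_forall_compl_eq_zero hsupp, area_restrict hf hSm subset_rfl,
    hrestr, integral_congr_ae (ae_eq_comp_extChartAt f hg)]
  rw [chartArea] at hGφ ⊢
  rw [integral_map ((aemeasurable_extChartAt_symm p).mono_ac
    (withDensity_absolutelyContinuous _ _)) hGφ]
  have := integral_withDensity_eq_integral_smul₀ hdens
    (fun u => (G ∘ extChartAt (𝓡∂ m) p) ((extChartAt (𝓡∂ m) p).symm u))
  refine this.trans ?_
  refine setIntegral_congr_fun hTm fun u hu => ?_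
  simp only [Function.comp_apply]
  rw [(extChartAt (𝓡∂ m) p).right_inv hu, NNReal.smul_def, smul_eq_mul,
    Real.coe_toNNReal (areaDensity f p u) (Real.sqrt_nonneg _)]

end Area

/-! ### Continuity of the geometric quantities. -/

section Continuity

variable {m : ℕ} {E : Type*} [TopologicalSpace E] {s : Set E}

theorem continuousOn_christoffel {x u v : E → Coord m} (hx : ContinuousOn x s)
    (hu : ContinuousOn u s) (hv : ContinuousOn v s) (hpos : ∀ y ∈ s, 0 < height (x y)) :
    ContinuousOn (fun y => christoffel (x y) (u y) (v y)) s := by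
  have hh : ∀ {w : E → Coord m}, ContinuousOn w s → ContinuousOn (fun y => height (w y)) s :=
    fun hw => (heightL m).continuous.comp_continuousOn hw
  have hne : ∀ y ∈ s, height (x y) ≠ 0 := fun y hy => (hpos y hy).ne'
  unfold christoffel
  exact (((((hh hu).div (hh hx) hne).neg).smul hv).sub (((hh hv).div (hh hx) hne).smul hu)).add
    (((continuous_inner.comp_continuousOn (hu.prodMk hv)).div (hh hx) hne).smul continuousOn_const)

theorem continuousOn_metric {x u v : E → Coord m} (hx : ContinuousOn x s)
    (hu : ContinuousOn u s) (hv : ContinuousOn v s) (hpos : ∀ y ∈ s, 0 < height (x y)) :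
    ContinuousOn (fun y => metric (x y) (u y) (v y)) s := by
  have hh : ContinuousOn (fun y => height (x y)) s := (heightL m).continuous.comp_continuousOn hx
  exact (continuous_inner.comp_continuousOn (hu.prodMk hv)).div (hh.pow 2)
    fun y hy => pow_ne_zero 2 (hpos y hy).ne'

variable {x ν : E → Coord m} {L L' : E → EuclideanSpace ℝ (Fin m) →L[ℝ] Coord m}

theorem continuousOn_coordFrame (hL : ContinuousOn L s) (j : Fin m) :
    ContinuousOn (fun y => coordFrame (L y) j) s :=
  hL.clm_apply continuousOn_const

theorem continuousOn_shapeFrame (hx : ContinuousOn x s) (hν : ContinuousOn ν s)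
    (hL : ContinuousOn L s) (hL' : ContinuousOn L' s) (hpos : ∀ y ∈ s, 0 < height (x y))
    (j : Fin m) : ContinuousOn (fun y => shapeFrame (x y) (ν y) (L y) (L' y) j) s :=
  (hL'.clm_apply continuousOn_const).add
    (continuousOn_christoffel hx (hL.clm_apply continuousOn_const) hν hpos)

theorem continuousOn_vol {v : E → Fin (m + 1) → Coord m}
    (hv : ∀ l, ContinuousOn (fun y => v y l) s) : ContinuousOn (fun y => vol m (v y)) s :=
  continuous_vol.comp_continuousOn (continuousOn_pi.2 hv)

theorem continuousOn_X (hx : ContinuousOn x s) : ContinuousOn (fun y => X (x y)) s :=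
  hx.sub continuousOn_const

theorem continuousOn_flux (hx : ContinuousOn x s) (hν : ContinuousOn ν s)
    (hL : ContinuousOn L s) (hL' : ContinuousOn L' s) (hpos : ∀ y ∈ s, 0 < height (x y)) (t : ℝ)
    (i : Fin m) : ContinuousOn (fun y => flux t (x y) (ν y) (L y) (L' y) i) s := by
  have hh : ContinuousOn (fun y => height (x y)) s := (heightL m).continuous.comp_continuousOn hx
  refine ((hh.pow _).inv₀ fun y hy => pow_ne_zero _ (hpos y hy).ne').mul
    (continuousOn_vol fun l => ?_)
  refine Fin.cases ?_ (fun j => ?_) l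
  · exact hν
  · simp only [frameCons, Fin.cons_succ]
    by_cases hj : j = i
    · subst hj
      simpa only [Function.update_self] using continuousOn_X hx
    · simp only [Function.update_of_ne hj]
      exact (continuousOn_coordFrame hL j).add
        ((continuousOn_shapeFrame hx hν hL hL' hpos j).const_smul t)

theorem continuousOn_gram (hx : ContinuousOn x s) (hL : ContinuousOn L s)
    (hpos : ∀ y ∈ s, 0 < height (x y)) :
    ContinuousOn (fun y => gram (x y) (coordFrame (L y))) s :=
  continuousOn_pi.2 fun i => continuousOn_pi.2 fun j =>
    continuousOn_metric hx (continuousOn_coordFrame hL i) (continuousOn_coordFrame hL j) hpos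

theorem continuousOn_gram_inv (hx : ContinuousOn x s) (hL : ContinuousOn L s)
    (hpos : ∀ y ∈ s, 0 < height (x y))
    (hinj : ∀ y ∈ s, Function.Injective (L y)) :
    ContinuousOn (fun y => (gram (x y) (coordFrame (L y)))⁻¹) s := by
  intro y hy
  have hdet : (gram (x y) (coordFrame (L y))).det ≠ 0 :=
    (gram_posDef (hpos y hy)
      (LocalHypersurface.linearIndependent_coordFrame (hinj y hy))).det_pos.ne'
  have h := continuousAt_matrix_inv (gram (x y) (coordFrame (L y)))
    (NormedRing.inverse_continuousAt (Units.mk0 _ hdet))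
  exact ContinuousAt.comp_continuousWithinAt (f := fun y => gram (x y) (coordFrame (L y))) h
    (continuousOn_gram hx hL hpos y hy)

theorem continuousOn_weingarten (hx : ContinuousOn x s) (hν : ContinuousOn ν s)
    (hL : ContinuousOn L s) (hL' : ContinuousOn L' s) (hpos : ∀ y ∈ s, 0 < height (x y))
    (hinj : ∀ y ∈ s, Function.Injective (L y)) :
    ContinuousOn (fun y => weingarten (x y) (ν y) (L y) (L' y)) s := by
  have h2 : ContinuousOn (fun y => second (x y) (ν y) (L y) (L' y)) s :=
    continuousOn_pi.2 fun i => continuousOn_pi.2 fun j =>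
      continuousOn_metric hx (continuousOn_shapeFrame hx hν hL hL' hpos i)
        (continuousOn_coordFrame hL j) hpos
  have hc : Continuous fun q : Matrix (Fin m) (Fin m) ℝ × Matrix (Fin m) (Fin m) ℝ => q.1 * q.2 :=
    continuous_fst.matrix_mul continuous_snd
  exact hc.comp_continuousOn ((continuousOn_gram_inv hx hL hpos hinj).prodMk h2)

theorem continuous_adjugate_one_add (t : ℝ) :
    Continuous fun A : Matrix (Fin m) (Fin m) ℝ => (1 + t • A).adjugate :=
  (continuous_const.add (continuous_id.const_smul t)).matrix_adjugate

theorem continuousOn_divergence {A : E → Matrix (Fin m) (Fin m) ℝ} (hx : ContinuousOn x s)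
    (hν : ContinuousOn ν s) (hA : ContinuousOn A s) (hpos : ∀ y ∈ s, 0 < height (x y)) (t : ℝ) :
    ContinuousOn (fun y => divergence t (x y) (ν y) (A y)) s := by
  have hh : ContinuousOn (fun y => height (x y)) s := (heightL m).continuous.comp_continuousOn hx
  have h1 : Continuous fun A : Matrix (Fin m) (Fin m) ℝ => (1 + t • A).adjugate.trace :=
    (continuous_adjugate_one_add t).matrix_trace
  have h2 : Continuous fun A : Matrix (Fin m) (Fin m) ℝ => ((1 + t • A).adjugate * A).trace :=
    ((continuous_adjugate_one_add t).matrix_mul continuous_id).matrix_trace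
  exact ((hh.inv₀ fun y hy => (hpos y hy).ne').mul (h1.comp_continuousOn hA)).sub
    ((continuousOn_metric hx (continuousOn_X hx) hν hpos).mul (h2.comp_continuousOn hA))

theorem continuousOn_pairing (hx : ContinuousOn x s) (hν : ContinuousOn ν s)
    (hL : ContinuousOn L s) (hL' : ContinuousOn L' s) (hpos : ∀ y ∈ s, 0 < height (x y))
    (hinj : ∀ y ∈ s, Function.Injective (L y)) {ξ : E → EuclideanSpace ℝ (Fin m) →L[ℝ] ℝ}
    (hξ : ContinuousOn ξ s) (t : ℝ) :
    ContinuousOn (fun y => pairing t (x y) (ν y) (L y) (L' y) (ξ y)) s := by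
  refine continuousOn_finsetSum _ fun i _ => (hξ.clm_apply continuousOn_const).mul ?_
  have hA := (continuous_adjugate_one_add t).comp_continuousOn
    (continuousOn_weingarten hx hν hL hL' hpos hinj)
  have hw : ContinuousOn (fun y => fun j => metric (x y) (X (x y)) (coordFrame (L y) j)) s :=
    continuousOn_pi.2 fun j =>
      continuousOn_metric hx (continuousOn_X hx) (continuousOn_coordFrame hL j) hpos
  have hc : Continuous fun q : Matrix (Fin m) (Fin m) ℝ × (Fin m → ℝ) => q.1 *ᵥ q.2 :=
    continuous_fst.matrix_mulVec continuous_snd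
  exact (continuous_apply i).comp_continuousOn (hc.comp_continuousOn (hA.prodMk
    (hc.comp_continuousOn ((continuousOn_gram_inv hx hL hpos hinj).prodMk hw))))

/-- The coefficients are universal polynomials in the entries. Continuity of the mean curvatures is
obtained from them, which avoids continuity of the roots. -/
theorem continuous_charpoly_coeff (r : ℕ) :
    Continuous fun A : Matrix (Fin m) (Fin m) ℝ => A.charpoly.coeff r := by
  have e : (fun A : Matrix (Fin m) (Fin m) ℝ => A.charpoly.coeff r)
      = fun A => MvPolynomial.eval (fun q : Fin m × Fin m => A q.1 q.2)
        ((Matrix.charpoly.univ ℝ (Fin m)).coeff r) := by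
    funext A
    have := Matrix.charpoly.univ_coeff_eval₂Hom (R := ℝ) (n := Fin m) (RingHom.id ℝ)
      (fun q : Fin m × Fin m => A q.1 q.2) r
    exact this.symm
  rw [e]
  exact (MvPolynomial.continuous_eval _).comp
    (continuous_pi fun q => (continuous_apply q.2).comp (continuous_apply q.1))

end Continuity

/-! ### Geometry of the immersed hypersurface in charts. -/

section Geometry

variable {m : ℕ} [NeZero m] {M : Type*} [TopologicalSpace M]
  [ChartedSpace (EuclideanHalfSpace m) M] [IsManifold (𝓡∂ m) ∞ M] {f ν : M → Coord m}

/-- Normality is given in the preferred chart of each point; surjectivity of the transition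
derivative carries it to the chart at `p`. -/
theorem IsHypersurface.metric_normal_chartDeriv (H : IsHypersurface f ν) {p : M}
    {u : EuclideanSpace ℝ (Fin m)} (hu : u ∈ (extChartAt (𝓡∂ m) p).target)
    (v : EuclideanSpace ℝ (Fin m)) :
    metric (chartMap f p u) (chartMap ν p u) (chartDeriv f p u v) = 0 := by
  set z := (extChartAt (𝓡∂ m) p).symm u with hz
  have hzp : z ∈ (extChartAt (𝓡∂ m) p).source := (extChartAt (𝓡∂ m) p).map_target hu
  have hzu : extChartAt (𝓡∂ m) p z = u := (extChartAt (𝓡∂ m) p).right_inv hu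
  obtain ⟨w, hw⟩ := (transition_chartDeriv_bijective H.smooth H.immersion hzp).1.2 v
  have h := H.normal z w
  rw [mfderiv_eq_chartDeriv H.smooth, chartDeriv_eq_comp H.smooth hzp (mem_extChartAt_source z),
    hzu] at h
  rw [← hw]
  exact h

theorem IsHypersurface.localHypersurface (H : IsHypersurface f ν) {p : M}
    {u : EuclideanSpace ℝ (Fin m)} (hu : u ∈ (extChartAt (𝓡∂ m) p).target) (h0 : 0 < u 0) :
    LocalHypersurface (chartMap f p) (chartMap ν p) (chartDeriv f p) (chartDeriv ν p) u where
  hasFDerivAt := by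
    filter_upwards [eventually_mem_target hu h0] with y hy
    exact hasFDerivAt_chartMap H.smooth hy.1 hy.2
  hasFDerivAt_normal := by
    filter_upwards [eventually_mem_target hu h0] with y hy
    exact hasFDerivAt_chartMap H.smooth_normal hy.1 hy.2
  differentiableAt := differentiableAt_chartDeriv H.smooth hu h0
  differentiableAt_normal := differentiableAt_chartDeriv H.smooth_normal hu h0
  height_pos := H.height_pos _
  unit := Filter.Eventually.of_forall fun y => H.unit _
  normal := by
    filter_upwards [eventually_mem_target hu h0] with y hy
    exact H.metric_normal_chartDeriv hy.1
  injective := chartDeriv_injective H.smooth H.immersion hu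

/-- The matrix of the shape operator at `z`, in the preferred chart at `z`. -/
def shapeOperator (f ν : M → Coord m) (z : M) : Matrix (Fin m) (Fin m) ℝ :=
  (firstForm f z)⁻¹ * secondForm f ν z

theorem IsHypersurface.shapeOperator_eq (H : IsHypersurface f ν) (z : M) :
    shapeOperator f ν z = weingarten (f z) (ν z) (chartDeriv f z (extChartAt (𝓡∂ m) z z))
      (chartDeriv ν z (extChartAt (𝓡∂ m) z z)) := by
  rw [← mfderiv_eq_chartDeriv H.smooth, ← mfderiv_eq_chartDeriv H.smooth_normal]
  rfl

theorem IsHypersurface.shapeOperator_eq_conj (H : IsHypersurface f ν) {p z : M}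
    (hp : z ∈ (extChartAt (𝓡∂ m) p).source) :
    ∃ J : Matrix (Fin m) (Fin m) ℝ, IsUnit J.det ∧ shapeOperator f ν z
      = J⁻¹ * weingarten (f z) (ν z) (chartDeriv f p (extChartAt (𝓡∂ m) p z))
        (chartDeriv ν p (extChartAt (𝓡∂ m) p z)) * J := by
  have hJ := isUnit_det_transition H.smooth H.immersion hp (mem_extChartAt_source z)
  refine ⟨_, hJ, ?_⟩
  rw [H.shapeOperator_eq, chartDeriv_eq_comp H.smooth hp (mem_extChartAt_source z),
    chartDeriv_eq_comp H.smooth_normal hp (mem_extChartAt_source z), weingarten_comp hJ]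

/-- The pairing of `dρ` with the tangent vector field `adj(1 + t A) Xᵀ`. -/
def fluxPairing (f ν : M → Coord m) (t : ℝ) (ρ : M → ℝ) (z : M) : ℝ :=
  pairing t (f z) (ν z) (chartDeriv f z (extChartAt (𝓡∂ m) z z))
    (chartDeriv ν z (extChartAt (𝓡∂ m) z z)) (chartDeriv ρ z (extChartAt (𝓡∂ m) z z))

theorem IsHypersurface.fluxPairing_eq (H : IsHypersurface f ν) {p z : M}
    (hp : z ∈ (extChartAt (𝓡∂ m) p).source) (t : ℝ) {ρ : M → ℝ}
    (hρ : ContMDiff (𝓡∂ m) 𝓘(ℝ, ℝ) ∞ ρ) :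
    fluxPairing f ν t ρ z = pairing t (f z) (ν z) (chartDeriv f p (extChartAt (𝓡∂ m) p z))
      (chartDeriv ν p (extChartAt (𝓡∂ m) p z)) (chartDeriv ρ p (extChartAt (𝓡∂ m) p z)) := by
  have hJ := isUnit_det_transition H.smooth H.immersion hp (mem_extChartAt_source z)
  rw [fluxPairing, chartDeriv_eq_comp H.smooth hp (mem_extChartAt_source z),
    chartDeriv_eq_comp H.smooth_normal hp (mem_extChartAt_source z),
    chartDeriv_eq_comp hρ hp (mem_extChartAt_source z), pairing_comp hJ]

theorem IsHypersurface.divergence_shapeOperator_eq (H : IsHypersurface f ν) {p z : M}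
    (hp : z ∈ (extChartAt (𝓡∂ m) p).source) (t : ℝ) :
    divergence t (f z) (ν z) (shapeOperator f ν z)
      = divergence t (f z) (ν z) (weingarten (f z) (ν z) (chartDeriv f p (extChartAt (𝓡∂ m) p z))
        (chartDeriv ν p (extChartAt (𝓡∂ m) p z))) := by
  obtain ⟨J, hJ, h⟩ := H.shapeOperator_eq_conj hp
  rw [h, divergence_conj hJ]

theorem IsHypersurface.principalCurvatures_eq (H : IsHypersurface f ν) {p z : M}
    (hp : z ∈ (extChartAt (𝓡∂ m) p).source) :
    principalCurvatures f ν z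
      = (weingarten (f z) (ν z) (chartDeriv f p (extChartAt (𝓡∂ m) p z))
        (chartDeriv ν p (extChartAt (𝓡∂ m) p z))).charpoly.roots := by
  obtain ⟨J, hJ, h⟩ := H.shapeOperator_eq_conj hp
  have h1 : principalCurvatures f ν z = (shapeOperator f ν z).charpoly.roots := rfl
  rw [h1, h, charpoly_conj hJ]

theorem esymm_roots_charpoly {A : Matrix (Fin m) (Fin m) ℝ}
    (hA : Multiset.card A.charpoly.roots = m) {r : ℕ} (hr : r ≤ m) :
    A.charpoly.roots.esymm r = (-1) ^ r * A.charpoly.coeff (m - r) := by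
  have hdeg : A.charpoly.natDegree = m := by simp [Matrix.charpoly_natDegree_eq_dim]
  have hsub : m - (m - r) = r := Nat.sub_sub_self hr
  rw [Polynomial.coeff_eq_esymm_roots_of_card (by rw [hA, hdeg]) (by rw [hdeg]; omega), hdeg, hsub,
    (Matrix.charpoly_monic A).leadingCoeff, one_mul, ← mul_assoc, ← mul_pow]
  simp

theorem IsHypersurface.continuousOn_weingarten (H : IsHypersurface f ν) (p : M) :
    ContinuousOn (fun u => weingarten (chartMap f p u) (chartMap ν p u) (chartDeriv f p u)
      (chartDeriv ν p u)) (extChartAt (𝓡∂ m) p).target :=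
  HalfSpace.continuousOn_weingarten (contDiffOn_chartMap H.smooth p).continuousOn
    (contDiffOn_chartMap H.smooth_normal p).continuousOn (continuousOn_chartDeriv H.smooth p)
    (continuousOn_chartDeriv H.smooth_normal p) (fun _ _ => H.height_pos _)
    (fun _ hu => chartDeriv_injective H.smooth H.immersion hu)

/-- The extension is a coefficient of the characteristic polynomial, continuous up to the boundary.
At interior points all roots are real, and it equals the symmetric function of the principal
curvatures. -/
theorem IsHypersurface.meanCurvature_extends (H : IsHypersurface f ν) (p : M) {r : ℕ} (hr : r ≤ m) :
    ∃ G : EuclideanSpace ℝ (Fin m) → ℝ, ContinuousOn G (extChartAt (𝓡∂ m) p).target ∧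
    ∀ u ∈ (extChartAt (𝓡∂ m) p).target, 0 < u 0 →
      meanCurvature f ν r ((extChartAt (𝓡∂ m) p).symm u) = G u := by
  refine ⟨fun u => (-1) ^ r * (weingarten (chartMap f p u) (chartMap ν p u) (chartDeriv f p u)
      (chartDeriv ν p u)).charpoly.coeff (m - r) / m.choose r, ?_, fun u hu h0 => ?_⟩
  · exact (((continuous_charpoly_coeff (m - r)).comp_continuousOn
      (H.continuousOn_weingarten p)).const_mul _).div_const _
  · have hL := H.localHypersurface hu h0
    rw [meanCurvature, H.principalCurvatures_eq ((extChartAt (𝓡∂ m) p).map_target hu),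
      (extChartAt (𝓡∂ m) p).right_inv hu]
    congr 1
    exact esymm_roots_charpoly hL.card_roots_charpoly hr

theorem IsHypersurface.continuousInCharts_meanCurvature_div (H : IsHypersurface f ν) {r : ℕ}
    (hr : r ≤ m) : ContinuousInCharts m fun z => meanCurvature f ν r z / height (f z) := by
  intro p
  obtain ⟨G, hG, hGu⟩ := H.meanCurvature_extends p hr
  refine ⟨fun u => G u / height (chartMap f p u), hG.div
    ((heightL m).continuous.comp_continuousOn (contDiffOn_chartMap H.smooth p).continuousOn)
    fun u _ => (H.height_pos _).ne', fun u hu h0 => ?_⟩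
  simp only [hGu u hu h0]
  rfl

theorem IsHypersurface.continuousInCharts_meanCurvature_mul (H : IsHypersurface f ν) {r : ℕ}
    (hr : r ≤ m) :
    ContinuousInCharts m fun z => meanCurvature f ν r z * metric (f z) (X (f z)) (ν z) := by
  intro p
  obtain ⟨G, hG, hGu⟩ := H.meanCurvature_extends p hr
  have hf := (contDiffOn_chartMap H.smooth p).continuousOn
  refine ⟨fun u => G u * metric (chartMap f p u) (X (chartMap f p u)) (chartMap ν p u), hG.mul
    (continuousOn_metric hf (continuousOn_X hf)
      (contDiffOn_chartMap H.smooth_normal p).continuousOn fun u _ => H.height_pos _),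
    fun u hu h0 => ?_⟩
  simp only [hGu u hu h0]
  rfl

/-- The divergence of `ρ adj(1 + t A) Xᵀ`. -/
def localizedDivergence (f ν : M → Coord m) (t : ℝ) (ρ : M → ℝ) (z : M) : ℝ :=
  fluxPairing f ν t ρ z + ρ z * divergence t (f z) (ν z) (shapeOperator f ν z)

/-- The divergence of `ρ adj(1 + t A) Xᵀ`, computed in the preferred chart at `p`. -/
def chartDivergence (f ν : M → Coord m) (t : ℝ) (ρ : M → ℝ) (p : M)
    (u : EuclideanSpace ℝ (Fin m)) : ℝ :=
  pairing t (chartMap f p u) (chartMap ν p u) (chartDeriv f p u) (chartDeriv ν p u)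
    (chartDeriv ρ p u) + chartMap ρ p u * divergence t (chartMap f p u) (chartMap ν p u)
      (weingarten (chartMap f p u) (chartMap ν p u) (chartDeriv f p u) (chartDeriv ν p u))

theorem IsHypersurface.localizedDivergence_symm (H : IsHypersurface f ν) (t : ℝ) {ρ : M → ℝ}
    (hρ : ContMDiff (𝓡∂ m) 𝓘(ℝ, ℝ) ∞ ρ) {p : M} {u : EuclideanSpace ℝ (Fin m)}
    (hu : u ∈ (extChartAt (𝓡∂ m) p).target) :
    localizedDivergence f ν t ρ ((extChartAt (𝓡∂ m) p).symm u) = chartDivergence f ν t ρ p u := by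
  have hz := (extChartAt (𝓡∂ m) p).map_target hu
  rw [localizedDivergence, H.fluxPairing_eq hz t hρ, H.divergence_shapeOperator_eq hz,
    (extChartAt (𝓡∂ m) p).right_inv hu]
  rfl

theorem IsHypersurface.continuousOn_chartDivergence (H : IsHypersurface f ν) (t : ℝ) {ρ : M → ℝ}
    (hρ : ContMDiff (𝓡∂ m) 𝓘(ℝ, ℝ) ∞ ρ) (p : M) :
    ContinuousOn (chartDivergence f ν t ρ p) (extChartAt (𝓡∂ m) p).target := by
  have hf := (contDiffOn_chartMap H.smooth p).continuousOn
  have hν := (contDiffOn_chartMap H.smooth_normal p).continuousOn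
  exact (continuousOn_pairing hf hν (continuousOn_chartDeriv H.smooth p)
    (continuousOn_chartDeriv H.smooth_normal p) (fun _ _ => H.height_pos _)
    (fun _ hu => chartDeriv_injective H.smooth H.immersion hu) (continuousOn_chartDeriv hρ p) t).add
    ((contDiffOn_chartMap hρ p).continuousOn.mul (continuousOn_divergence hf hν
      (H.continuousOn_weingarten p) (fun _ _ => H.height_pos _) t))

theorem IsHypersurface.continuousInCharts_localizedDivergence (H : IsHypersurface f ν) (t : ℝ)
    {ρ : M → ℝ} (hρ : ContMDiff (𝓡∂ m) 𝓘(ℝ, ℝ) ∞ ρ) :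
    ContinuousInCharts m (localizedDivergence f ν t ρ) := fun p =>
  ⟨_, H.continuousOn_chartDivergence t hρ p, fun _ hu _ => H.localizedDivergence_symm t hρ hu⟩

/-! ### Vanishing of the flux on the boundary. -/

section Boundary

theorem not_isInteriorPoint_symm {p : M} {u : EuclideanSpace ℝ (Fin m)}
    (hu : u ∈ (extChartAt (𝓡∂ m) p).target) (h0 : u 0 = 0) :
    (extChartAt (𝓡∂ m) p).symm u ∈ (𝓡∂ m).boundary M := by
  rw [← ModelWithCorners.compl_interior]
  intro hint
  have hz := (extChartAt (𝓡∂ m) p).map_target hu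
  rw [extChartAt_source] at hz
  have h1 := ((𝓡∂ m).isInteriorPoint_iff_of_mem_atlas (n := ∞) (by simp)
    (chart_mem_atlas _ p) hz).1 hint
  have h2 : (extChartAt (𝓡∂ m) p) ((extChartAt (𝓡∂ m) p).symm u)
      ∈ interior (extChartAt (𝓡∂ m) p).target := h1
  rw [(extChartAt (𝓡∂ m) p).right_inv hu] at h2
  have h3 := interior_mono (extChartAt_target_subset_range p) h2
  rw [interior_range_modelWithCornersEuclideanHalfSpace] at h3
  exact absurd h0 (ne_of_gt h3)

/-- For `i ≠ 0` the coordinate line through `u` stays in the hyperplane `u 0 = 0`, so a derivative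
within the half space suffices to differentiate along it in both directions. -/
theorem tangential_derivative_eq_zero {V : Type*} [NormedAddCommGroup V] [NormedSpace ℝ V]
    {G : EuclideanSpace ℝ (Fin m) → V} {L : EuclideanSpace ℝ (Fin m) →L[ℝ] V}
    {p : M} {u : EuclideanSpace ℝ (Fin m)} (hu : u ∈ (extChartAt (𝓡∂ m) p).target) (h0 : u 0 = 0)
    (hG : HasFDerivWithinAt G L (range (𝓡∂ m)) u) (l : V →L[ℝ] ℝ) {c : ℝ}
    (hc : ∀ y ∈ (extChartAt (𝓡∂ m) p).target, y 0 = 0 → l (G y) = c) {i : Fin m} (hi : i ≠ 0) :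
    l (L (EuclideanSpace.single i 1)) = 0 := by
  let γ : ℝ → EuclideanSpace ℝ (Fin m) := fun s => u + s • EuclideanSpace.single i 1
  have hγ0 : γ 0 = u := by simp [γ]
  have hγb : ∀ s, γ s 0 = 0 := fun s => by simp [γ, h0, hi.symm]
  have hγr : ∀ s, γ s ∈ range (𝓡∂ m) := fun s => mem_range_iff.2 (hγb s).ge
  have hγ : HasDerivAt γ (EuclideanSpace.single i 1) 0 := by
    have h := ((hasDerivAt_id (0 : ℝ)).smul_const (EuclideanSpace.single i (1 : ℝ))).const_add u
    rw [one_smul] at h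
    exact h
  have hG' : HasFDerivWithinAt G L (range (𝓡∂ m)) (γ 0) := by rwa [hγ0]
  have h1 : HasDerivAt (fun s => l (G (γ s))) (l (L (EuclideanSpace.single i 1))) 0 :=
    l.hasFDerivAt.comp_hasDerivAt (0 : ℝ)
      (hG'.comp_hasDerivAt (0 : ℝ) hγ (Filter.Eventually.of_forall hγr))
  have htend : Filter.Tendsto γ (𝓝 0) (𝓝[range (𝓡∂ m)] u) := by
    refine tendsto_nhdsWithin_iff.2 ⟨?_, Filter.Eventually.of_forall hγr⟩
    have := hγ.continuousAt.tendsto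
    rwa [hγ0] at this
  have h2 : (fun s => l (G (γ s))) =ᶠ[𝓝 0] fun _ => c := by
    filter_upwards [htend (extChartAt_target_mem_nhdsWithin_of_mem hu)] with s hs
    exact hc _ hs (hγb s)
  exact h1.unique ((hasDerivAt_const 0 c).congr_of_eventuallyEq h2)

/-- The Euclidean normal `(sin θ, 0, …, 0, cos θ)` of the support hypersurface. -/
def supportVector (m : ℕ) (θ : ℝ) : Coord m := Real.sin θ • E₁ m + Real.cos θ • Eₙ m

theorem inner_supportVector (θ : ℝ) (x : Coord m) :
    inner ℝ (supportVector m θ) x = x 0 * Real.sin θ + height x * Real.cos θ := by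
  rw [supportVector, inner_add_left, real_inner_smul_left, real_inner_smul_left, inner_Eₙ]
  simp [E₁, EuclideanSpace.inner_single_left]
  ring

theorem supportVector_ne_zero (θ : ℝ) : supportVector m θ ≠ 0 := by
  intro h
  have hm : (0 : Fin (m + 1)) ≠ Fin.last m := by
    intro h
    exact NeZero.ne m (congrArg Fin.val h).symm
  have h0 := congrArg (fun x : Coord m => x 0) h
  have h1 := congrArg (fun x : Coord m => x (Fin.last m)) h
  simp [supportVector, E₁, Eₙ, hm] at h0 h1
  have := Real.sin_sq_add_cos_sq θ
  rw [h0] at this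
  simp_all

/-- Every column is Euclidean orthogonal to the constant vector `n = supportVector m θ`. For `ν`
this is the orthogonality condition. For `X` it holds because `x` and `Eₙ` have the same product
`cos θ` with `n`. For the columns `j ≠ 0` it follows by differentiating `⟨n, f⟩ = cos θ` and `⟨n, ν⟩
= 0` along the boundary, as `a_j` is a combination of `∂_j ν`, `ν` and `∂_j f`. -/
theorem flux_boundary (H : IsHypersurface f ν) {θ : ℝ} (hθ : MeetsOrthogonally f ν θ) (t : ℝ)
    {p : M} {u : EuclideanSpace ℝ (Fin m)} (hu : u ∈ (extChartAt (𝓡∂ m) p).target)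
    (h0 : u 0 = 0) :
    flux t (chartMap f p u) (chartMap ν p u) (chartDeriv f p u) (chartDeriv ν p u) 0 = 0 := by
  set n := supportVector m θ with hn
  let l : Coord m →L[ℝ] ℝ := innerSL ℝ n
  have hl : ∀ x, l x = inner ℝ n x := fun x => rfl
  have hψ : ∀ y ∈ (extChartAt (𝓡∂ m) p).target, y 0 = 0 → l (chartMap f p y) = Real.cos θ := by
    intro y hy hy0
    rw [hl, hn, inner_supportVector]
    exact (hθ.boundary_mem _ (not_isInteriorPoint_symm hy hy0)).2
  have hν : ∀ y ∈ (extChartAt (𝓡∂ m) p).target, y 0 = 0 → l (chartMap ν p y) = 0 := by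
    intro y hy hy0
    have h1 := hθ.orthogonal _ (not_isInteriorPoint_symm hy hy0)
    have hpos := H.height_pos ((extChartAt (𝓡∂ m) p).symm y)
    rw [metric, div_eq_zero_iff, or_iff_left (by positivity), supportNormal,
      inner_smul_right, mul_eq_zero, or_iff_right (by linarith), real_inner_comm] at h1
    exact h1
  have hdψ := fun i hi => tangential_derivative_eq_zero hu h0
    (hasFDerivWithinAt_chartMap H.smooth hu) l hψ (i := i) hi
  have hdν := fun i hi => tangential_derivative_eq_zero hu h0
    (hasFDerivWithinAt_chartMap H.smooth_normal hu) l hν (i := i) hi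
  rw [flux, mul_eq_zero]
  right
  refine vol_eq_zero_of_inner_eq_zero (n := n) (supportVector_ne_zero θ) fun j => ?_
  refine Fin.cases ?_ (fun j => ?_) j
  · exact hν u hu h0
  · rw [frameCons, Fin.cons_succ]
    by_cases hj : j = 0
    · subst hj
      rw [Function.update_self, X, inner_sub_right, real_inner_comm (Eₙ m), inner_Eₙ]
      have h1 := hψ u hu h0
      rw [hl] at h1
      have h2 : height n = Real.cos θ := by
        have := real_inner_comm (Eₙ m) n
        rw [inner_Eₙ] at this
        rw [← this, hn, inner_supportVector]
        have hm : (0 : Fin (m + 1)) ≠ Fin.last m := by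
          intro h
          exact NeZero.ne m (congrArg Fin.val h).symm
        simp [Eₙ, height, hm]
      rw [h1, h2, sub_self]
    · have hpos : 0 < height (chartMap f p u) := H.height_pos _
      rw [Function.update_of_ne hj, shapeFrame, shape_eq_of_normal hpos _
        (H.metric_normal_chartDeriv hu _), coordFrame]
      simp only [← hl, map_add, map_sub, map_smul, hdψ j hj, hdν j hj, hν u hu h0]
      simp

end Boundary

end Geometry

/-! ### Integration over the hypersurface and comparison of coefficients. -/

section Integral

variable {m : ℕ} [NeZero m] {M : Type*} [TopologicalSpace M]
  [ChartedSpace (EuclideanHalfSpace m) M] [IsManifold (𝓡∂ m) ∞ M] [MeasurableSpace M]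
  [BorelSpace M] {f ν : M → Coord m}

/-- The area density of the chart at `p`, with a sign that depends on the orientation of the
chart. -/
def signedDensity (f ν : M → Coord m) (p : M) (u : EuclideanSpace ℝ (Fin m)) : ℝ :=
  (height (chartMap f p u) ^ (m + 1))⁻¹ *
    vol m (frameCons (chartMap ν p u) (coordFrame (chartDeriv f p u)))

theorem signedDensity_ne_zero (H : IsHypersurface f ν) {p : M} {u : EuclideanSpace ℝ (Fin m)}
    (hu : u ∈ (extChartAt (𝓡∂ m) p).target) : signedDensity f ν p u ≠ 0 := by
  have hpos : 0 < height (chartMap f p u) := H.height_pos _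
  refine mul_ne_zero (by positivity) (vol_cons_ne_zero (x := chartMap f p u)
    (ψ := coordFrame (chartDeriv f p u)) (H.unit _)
    (fun j => H.metric_normal_chartDeriv hu _) ?_)
  exact LocalHypersurface.linearIndependent_coordFrame
    (chartDeriv_injective H.smooth H.immersion hu)

theorem areaDensity_eq_abs (H : IsHypersurface f ν) {p : M} {u : EuclideanSpace ℝ (Fin m)}
    (hu : u ∈ (extChartAt (𝓡∂ m) p).target) : areaDensity f p u = |signedDensity f ν p u| := by
  have hpos : 0 < height (chartMap f p u) := H.height_pos _
  rw [areaDensity_eq, ← sq_vol_cons hpos (ψ := coordFrame (chartDeriv f p u)) (ν := chartMap ν p u)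
    (H.unit _)
    (fun j => H.metric_normal_chartDeriv hu _), Real.sqrt_sq_eq_abs]
  rfl

theorem continuousOn_signedDensity (H : IsHypersurface f ν) (p : M) :
    ContinuousOn (signedDensity f ν p) (extChartAt (𝓡∂ m) p).target := by
  have hf := (contDiffOn_chartMap H.smooth p).continuousOn
  have hh : ContinuousOn (fun u => height (chartMap f p u)) (extChartAt (𝓡∂ m) p).target :=
    (heightL m).continuous.comp_continuousOn hf
  refine ((hh.pow _).inv₀ fun u _ => pow_ne_zero _ (H.height_pos _).ne').mul
    (continuousOn_vol fun l => ?_)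
  refine Fin.cases ?_ (fun j => ?_) l
  · exact (contDiffOn_chartMap H.smooth_normal p).continuousOn
  · exact continuousOn_coordFrame (continuousOn_chartDeriv H.smooth p) j

/-- The vector field `ρ adj(1 + t A) Xᵀ`, multiplied by the area density, in the chart at `p`. -/
def chartField (f ν : M → Coord m) (t : ℝ) (ρ : M → ℝ) (p : M) :
    EuclideanSpace ℝ (Fin m) → Fin m → ℝ :=
  (extChartAt (𝓡∂ m) p).target.indicator fun u =>
    -- The flux carries the signed density. This locally constant sign turns it into the area
    -- density, so charts need not be compatible with an orientation.
    (signedDensity f ν p u / |signedDensity f ν p u|) • chartMap ρ p u •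
      flux t (chartMap f p u) (chartMap ν p u) (chartDeriv f p u) (chartDeriv ν p u)

theorem chartField_eq_zero (t : ℝ) {ρ : M → ℝ} {p : M} {u : EuclideanSpace ℝ (Fin m)}
    (hu : u ∉ extChartAt (𝓡∂ m) p '' tsupport ρ) : chartField f ν t ρ p u = 0 := by
  by_cases hT : u ∈ (extChartAt (𝓡∂ m) p).target
  · have h0 : ρ ((extChartAt (𝓡∂ m) p).symm u) = 0 := image_eq_zero_of_notMem_tsupport
      fun hmem => hu ⟨_, hmem, (extChartAt (𝓡∂ m) p).right_inv hT⟩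
    have h1 : chartMap ρ p u = 0 := h0
    rw [chartField, indicator_of_mem hT, h1, zero_smul, smul_zero]
  · rw [chartField, indicator_of_notMem hT]

theorem isClosed_image_tsupport [CompactSpace M] {ρ : M → ℝ} {p : M}
    (hρp : tsupport ρ ⊆ (extChartAt (𝓡∂ m) p).source) :
    IsClosed (extChartAt (𝓡∂ m) p '' tsupport ρ) :=
  (isCompact_image_extChartAt (isClosed_tsupport ρ).isCompact hρp).isClosed

theorem chartField_eventuallyEq_zero [CompactSpace M] (t : ℝ) {ρ : M → ℝ} {p : M}
    (hρp : tsupport ρ ⊆ (extChartAt (𝓡∂ m) p).source) {u : EuclideanSpace ℝ (Fin m)}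
    (hu : u ∉ extChartAt (𝓡∂ m) p '' tsupport ρ) :
    chartField f ν t ρ p =ᶠ[𝓝 u] fun _ => 0 := by
  filter_upwards [(isClosed_image_tsupport hρp).isOpen_compl.mem_nhds hu] with y hy
  exact chartField_eq_zero t hy

theorem continuousOn_chartField [CompactSpace M] (H : IsHypersurface f ν) (t : ℝ) {ρ : M → ℝ}
    (hρ : ContMDiff (𝓡∂ m) 𝓘(ℝ, ℝ) ∞ ρ) {p : M}
    (hρp : tsupport ρ ⊆ (extChartAt (𝓡∂ m) p).source) :
    ContinuousOn (chartField f ν t ρ p) {u | 0 ≤ u 0} := by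
  intro u hu
  by_cases hK : u ∈ extChartAt (𝓡∂ m) p '' tsupport ρ
  · have hT := image_subset_target hρp hK
    have hV := continuousOn_signedDensity H p
    have h1 : ContinuousOn (chartField f ν t ρ p) (extChartAt (𝓡∂ m) p).target := by
      refine ContinuousOn.congr ?_ fun y hy => indicator_of_mem hy _
      refine (hV.div hV.abs fun y hy => abs_ne_zero.2 (signedDensity_ne_zero H hy)).smul
        ((contDiffOn_chartMap hρ p).continuousOn.smul (continuousOn_pi.2 fun i => ?_))
      exact continuousOn_flux (contDiffOn_chartMap H.smooth p).continuousOn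
        (contDiffOn_chartMap H.smooth_normal p).continuousOn (continuousOn_chartDeriv H.smooth p)
        (continuousOn_chartDeriv H.smooth_normal p) (fun _ _ => H.height_pos _) t i
    have h2 : {u : EuclideanSpace ℝ (Fin m) | 0 ≤ u 0} = range (𝓡∂ m) :=
      (range_modelWithCornersEuclideanHalfSpace m).symm
    rw [h2]
    exact (h1 u hT).mono_of_mem_nhdsWithin (extChartAt_target_mem_nhdsWithin_of_mem hT)
  · exact (continuousAt_const.congr
      (chartField_eventuallyEq_zero t hρp hK).symm).continuousWithinAt

theorem div_abs_eventuallyEq {E : Type*} [TopologicalSpace E] {V : E → ℝ} {u : E}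
    (hV : ContinuousAt V u) (h0 : V u ≠ 0) :
    (fun y => V y / |V y|) =ᶠ[𝓝 u] fun _ => V u / |V u| := by
  rcases lt_or_gt_of_ne h0 with h | h
  · filter_upwards [hV.eventually (gt_mem_nhds h)] with y hy
    rw [abs_of_neg hy, abs_of_neg h, div_neg, div_neg, div_self hy.ne, div_self h.ne]
  · filter_upwards [hV.eventually (lt_mem_nhds h)] with y hy
    rw [abs_of_pos hy, abs_of_pos h, div_self hy.ne', div_self h.ne']

theorem hasFDerivAt_chartField [CompactSpace M] (H : IsHypersurface f ν) (t : ℝ) {ρ : M → ℝ}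
    (hρ : ContMDiff (𝓡∂ m) 𝓘(ℝ, ℝ) ∞ ρ) {p : M}
    (hρp : tsupport ρ ⊆ (extChartAt (𝓡∂ m) p).source) {u : EuclideanSpace ℝ (Fin m)}
    (h0 : 0 < u 0) :
    ∃ W' : EuclideanSpace ℝ (Fin m) →L[ℝ] (Fin m → ℝ), HasFDerivAt (chartField f ν t ρ p) W' u ∧
      ∑ i, W' (EuclideanSpace.single i 1) i = (extChartAt (𝓡∂ m) p).target.indicator
        (fun u => areaDensity f p u * chartDivergence f ν t ρ p u) u := by
  by_cases hT : u ∈ (extChartAt (𝓡∂ m) p).target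
  · have hL := H.localHypersurface hT h0
    obtain ⟨F', hF', hsum⟩ := hL.hasFDerivAt_flux t
    have hmul := hL.sum_mul_flux t (chartDeriv ρ p u)
    have hρ' := hasFDerivAt_chartMap hρ hT h0
    have hV := (continuousOn_signedDensity H p).continuousAt (target_mem_nhds hT h0)
    have h1 := (hρ'.smul hF').const_smul (signedDensity f ν p u / |signedDensity f ν p u|)
    refine ⟨_, h1.congr_of_eventuallyEq ?_, ?_⟩
    · filter_upwards [target_mem_nhds hT h0,
        div_abs_eventuallyEq hV (signedDensity_ne_zero H hT)] with y hy hy'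
      rw [chartField, indicator_of_mem hy, hy']
      rfl
    · rw [indicator_of_mem hT, areaDensity_eq_abs H hT]
      have e : ∀ c d : ℝ, ∀ i : Fin m, (c • (d • F' + (chartDeriv ρ p u).smulRight
          (flux t (chartMap f p u) (chartMap ν p u) (chartDeriv f p u) (chartDeriv ν p u))))
          (EuclideanSpace.single i 1) i = c * (d * F' (EuclideanSpace.single i 1) i
          + chartDeriv ρ p u (EuclideanSpace.single i 1) *
          flux t (chartMap f p u) (chartMap ν p u) (chartDeriv f p u) (chartDeriv ν p u) i) :=
        fun c d i => rfl
      rw [Finset.sum_congr rfl fun i _ => e _ _ i, ← Finset.mul_sum, Finset.sum_add_distrib,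
        ← Finset.mul_sum, hsum, hmul]
      change signedDensity f ν p u / |signedDensity f ν p u| *
        (chartMap ρ p u * (signedDensity f ν p u * _) + signedDensity f ν p u * _) = _
      have hne := signedDensity_ne_zero H hT
      have habs : signedDensity f ν p u / |signedDensity f ν p u| * signedDensity f ν p u
          = |signedDensity f ν p u| := by
        rw [div_mul_eq_mul_div, ← abs_mul_abs_self, mul_div_assoc,
          div_self (abs_ne_zero.2 hne), mul_one]
      rw [chartDivergence]
      generalize signedDensity f ν p u / |signedDensity f ν p u| = σ at habs ⊢
      rw [← habs]
      ring
  · have hK : u ∉ extChartAt (𝓡∂ m) p '' tsupport ρ := fun h => hT (image_subset_target hρp h)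
    refine ⟨0, (hasFDerivAt_const 0 u).congr_of_eventuallyEq
      (chartField_eventuallyEq_zero t hρp hK), ?_⟩
    rw [indicator_of_notMem hT]
    simp

variable [CompactSpace M] [T2Space M]

theorem setIntegral_chartDivergence (H : IsHypersurface f ν) {θ : ℝ}
    (hθ : MeetsOrthogonally f ν θ) (t : ℝ) {ρ : M → ℝ}
    (hρ : ContMDiff (𝓡∂ m) 𝓘(ℝ, ℝ) ∞ ρ) {p : M}
    (hρp : tsupport ρ ⊆ (extChartAt (𝓡∂ m) p).source) :
    ∫ u in (extChartAt (𝓡∂ m) p).target, areaDensity f p u * chartDivergence f ν t ρ p u = 0 := by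
  set T := (extChartAt (𝓡∂ m) p).target with hT
  set K := extChartAt (𝓡∂ m) p '' tsupport ρ with hK
  have hKc : IsCompact K := isCompact_image_extChartAt (isClosed_tsupport ρ).isCompact hρp
  have hKT : K ⊆ T := image_subset_target hρp
  set D : EuclideanSpace ℝ (Fin m) → ℝ := fun u => areaDensity f p u * chartDivergence f ν t ρ p u
  set W := chartField f ν t ρ p with hW
  have hd : ∀ u : EuclideanSpace ℝ (Fin m), 0 < u 0 → HasFDerivAt W (fderiv ℝ W u) u := by
    intro u h0
    obtain ⟨W', hW', -⟩ := hasFDerivAt_chartField H t hρ hρp h0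
    exact hW'.differentiableAt.hasFDerivAt
  have hsum : ∀ u : EuclideanSpace ℝ (Fin m), 0 < u 0 →
      ∑ i, fderiv ℝ W u (EuclideanSpace.single i 1) i = T.indicator D u := by
    intro u h0
    obtain ⟨W', hW', h⟩ := hasFDerivAt_chartField H t hρ hρp h0
    rw [hW'.fderiv, h]
  have hpos : ∀ᵐ u ∂(volume.restrict {u : EuclideanSpace ℝ (Fin m) | 0 ≤ u 0}), 0 < u 0 := by
    have hm : MeasurableSet {u : EuclideanSpace ℝ (Fin m) | 0 ≤ u 0} :=
      (isClosed_le continuous_const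
      (EuclideanSpace.proj (0 : Fin m) : EuclideanSpace ℝ (Fin m) →L[ℝ] ℝ).continuous).measurableSet
    filter_upwards [ae_restrict_mem hm, ae_restrict_of_ae ae_ne_zero_zero] with u h1 h2
    exact lt_of_le_of_ne h1 (Ne.symm h2)
  -- `D` is continuous only on the chart target, so integrability is proved on the compact image of
  -- the support; outside it the field and its derivative vanish.
  have hDK : IntegrableOn D K := by
    refine ContinuousOn.integrableOn_compact hKc ?_
    exact ((continuousOn_areaDensity H.smooth H.height_pos p).mul
      (H.continuousOn_chartDivergence t hρ p)).mono hKT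
  have hi : IntegrableOn (fun u => ∑ i, fderiv ℝ W u (EuclideanSpace.single i 1) i)
      {u : EuclideanSpace ℝ (Fin m) | 0 ≤ u 0} := by
    refine ((hDK.integrable_indicator hKc.measurableSet).integrableOn).congr ?_
    filter_upwards [hpos] with u h0
    by_cases hu : u ∈ K
    · rw [indicator_of_mem hu, hsum u h0, indicator_of_mem (hKT hu)]
    · have h1 : fderiv ℝ W u = 0 := by
        rw [(chartField_eventuallyEq_zero t hρp hu).fderiv_eq]
        simp
      rw [indicator_of_notMem hu, h1]
      simp
  have hdiv := integral_divergence_halfSpace W (fderiv ℝ W) hKc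
    (continuousOn_chartField H t hρ hρp) (fun u hu => chartField_eq_zero t hu)
    (fun u h0 => by
      by_cases hu : u ∈ T
      · rw [hW, chartField, indicator_of_mem hu, Pi.smul_apply, Pi.smul_apply,
          flux_boundary H hθ t hu h0, smul_zero, smul_zero]
      · rw [hW, chartField, indicator_of_notMem hu]
        rfl) hd hi
  have hint : {u : EuclideanSpace ℝ (Fin m) | 0 ≤ u 0} ∩ T = T :=
    inter_eq_self_of_subset_right fun u hu => nonneg_of_mem_target hu
  rw [integral_congr_ae (g := T.indicator D) (by
    filter_upwards [hpos] with u h0 using hsum u h0), setIntegral_indicator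
    (measurableSet_target p), hint] at hdiv
  exact hdiv

theorem integral_localizedDivergence (H : IsHypersurface f ν) {θ : ℝ}
    (hθ : MeetsOrthogonally f ν θ) (t : ℝ) {ρ : M → ℝ}
    (hρ : ContMDiff (𝓡∂ m) 𝓘(ℝ, ℝ) ∞ ρ) {p : M}
    (hρp : tsupport ρ ⊆ (extChartAt (𝓡∂ m) p).source) :
    ∫ z, localizedDivergence f ν t ρ z ∂(area f) = 0 := by
  rw [integral_area_eq H.smooth H.height_pos (H.continuousOn_chartDivergence t hρ p)
    (fun u hu _ => H.localizedDivergence_symm t hρ hu) (fun z hz => ?_)]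
  · exact setIntegral_chartDivergence H hθ t hρ hρp
  · have hz' : z ∉ tsupport ρ := fun h => hz (hρp h)
    have h1 : chartDeriv ρ z (extChartAt (𝓡∂ m) z z) = 0 := by
      rw [← mfderiv_eq_chartDeriv hρ]
      have h2 : ρ =ᶠ[𝓝 z] fun _ => 0 := notMem_tsupport_iff_eventuallyEq.1 hz'
      rw [h2.mfderiv_eq, mfderiv_const]
      rfl
    rw [localizedDivergence, fluxPairing, h1, image_eq_zero_of_notMem_tsupport hz', pairing]
    simp

/-- The pairing is linear in the covector, and the differentials of functions that add up to one add
up to zero. -/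
theorem sum_localizedDivergence {ι : Type*} (s : Finset ι) {ρ : ι → M → ℝ}
    (hρ : ∀ i, ContMDiff (𝓡∂ m) 𝓘(ℝ, ℝ) ∞ (ρ i)) (hsum : ∀ z, ∑ i ∈ s, ρ i z = 1) (t : ℝ) (z : M) :
    ∑ i ∈ s, localizedDivergence f ν t (ρ i) z
      = divergence t (f z) (ν z) (shapeOperator f ν z) := by
  have hd : ∑ i ∈ s, chartDeriv (ρ i) z (extChartAt (𝓡∂ m) z z) = 0 := by
    have hu : UniqueDiffWithinAt ℝ (range (𝓡∂ m)) (extChartAt (𝓡∂ m) z z) :=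
      (𝓡∂ m).uniqueDiffOn _ (extChartAt_target_subset_range z (mem_extChartAt_target z))
    have h1 := HasFDerivWithinAt.fun_sum (u := s)
      fun i _ => hasFDerivWithinAt_chartMap (hρ i) (mem_extChartAt_target z)
    have h2 : (fun u : EuclideanSpace ℝ (Fin m) => ∑ i ∈ s, chartMap (ρ i) z u)
        = fun _ => (1 : ℝ) := funext fun u => hsum _
    rw [h2] at h1
    exact hu.eq h1 (hasFDerivWithinAt_const _ _ _)
  simp only [localizedDivergence, Finset.sum_add_distrib, ← Finset.sum_mul, hsum, one_mul,
    fluxPairing, pairing]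
  rw [Finset.sum_comm]
  simp only [← Finset.sum_mul, ← _root_.sum_apply, hd]
  simp

theorem integral_divergence_eq_zero (H : IsHypersurface f ν) {θ : ℝ}
    (hθ : MeetsOrthogonally f ν θ) (t : ℝ) :
    ∫ z, divergence t (f z) (ν z) (shapeOperator f ν z) ∂(area f) = 0 := by
  obtain ⟨ρ, hρ⟩ := SmoothPartitionOfUnity.exists_isSubordinate_chartAt_source (𝓡∂ m) M
  -- By compactness only finitely many members of the partition are not identically zero, so
  -- integral and sum may be interchanged.
  have hfin : {i | (Function.support (ρ i)).Nonempty}.Finite :=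
    ρ.locallyFinite.finite_nonempty_of_compact
  set s := hfin.toFinset
  have hsm : ∀ i, ContMDiff (𝓡∂ m) 𝓘(ℝ, ℝ) ∞ (ρ i) := fun i => (ρ i).contMDiff
  have hsum : ∀ z, ∑ i ∈ s, ρ i z = 1 := by
    intro z
    rw [← ρ.sum_eq_one (mem_univ z)]
    refine (finsum_eq_sum_of_support_subset _ fun i hi => ?_).symm
    simp only [s, Finite.coe_toFinset]
    exact ⟨z, hi⟩
  simp only [← sum_localizedDivergence (f := f) (ν := ν) s hsm hsum t]
  rw [integral_finsetSum _ fun i _ => integrable_of_continuousInCharts H.smooth H.height_pos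
    (H.continuousInCharts_localizedDivergence t (hsm i))]
  refine Finset.sum_eq_zero fun i _ => integral_localizedDivergence H hθ t (hsm i) (p := i) ?_
  rw [extChartAt_source]
  exact hρ i

theorem ae_area {P : M → Prop} (hf : ContMDiff (𝓡∂ m) 𝓘(ℝ, Coord m) ∞ f)
    (hP : ∀ p, ∀ u ∈ (extChartAt (𝓡∂ m) p).target, 0 < u 0 → P ((extChartAt (𝓡∂ m) p).symm u)) :
    ∀ᵐ z ∂(area f), P z := by
  obtain ⟨s, hs⟩ := isCompact_univ.elim_finite_subcover
    (fun p : M => (extChartAt (𝓡∂ m) p).source) (fun p => isOpen_extChartAt_source p)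
    (fun z _ => mem_iUnion.2 ⟨z, mem_extChartAt_source z⟩)
  have h : ∀ p ∈ s, area f ({z | ¬P z} ∩ (extChartAt (𝓡∂ m) p).source) = 0 := by
    intro p _
    have hm := (isOpen_extChartAt_source (I := 𝓡∂ m) p).measurableSet
    rw [← Measure.restrict_apply' hm, area_restrict hf hm subset_rfl, Measure.restrict_apply' hm]
    exact measure_mono_null inter_subset_left (ae_chartArea f p (hP p))
  refine measure_mono_null (fun z hz => ?_) ((measure_biUnion_null_iff s.countable_toSet).2 h)
  obtain ⟨p, hp, hzp⟩ := mem_iUnion₂.1 (hs (mem_univ z))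
  exact mem_iUnion₂.2 ⟨p, hp, hz, hzp⟩

/-- A polynomial function that vanishes identically has zero coefficients. -/
theorem coeff_eq_zero_of_forall_sum_eq_zero {n : ℕ} {c : ℕ → ℝ}
    (h : ∀ t : ℝ, ∑ k ∈ Finset.range n, t ^ k * c k = 0) {k : ℕ} (hk : k < n) : c k = 0 := by
  set q : Polynomial ℝ := ∑ k ∈ Finset.range n, Polynomial.C (c k) * Polynomial.X ^ k with hq
  have hq0 : q = 0 := by
    refine Polynomial.funext fun t => ?_
    rw [hq, Polynomial.eval_finsetSum]
    simp only [Polynomial.eval_mul, Polynomial.eval_C, Polynomial.eval_pow, Polynomial.eval_X,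
      Polynomial.eval_zero]
    rw [← h t]
    exact Finset.sum_congr rfl fun k _ => mul_comm _ _
  have := congrArg (fun q => Polynomial.coeff q k) hq0
  simpa [hq, Polynomial.finsetSum_coeff, Polynomial.coeff_X_pow, hk] using this

theorem integral_meanCurvature_div_height (H : IsHypersurface f ν) {θ : ℝ}
    (hθ : MeetsOrthogonally f ν θ) {k : ℕ} (hk : k < m) :
    ∫ z, meanCurvature f ν k z / height (f z) ∂(area f)
      = ∫ z, meanCurvature f ν (k + 1) z * metric (f z) (X (f z)) (ν z) ∂(area f) := by
  have hu : ∀ r, r ≤ m → Integrable (fun z => meanCurvature f ν r z / height (f z)) (area f) :=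
    fun r hr => integrable_of_continuousInCharts H.smooth H.height_pos
      (H.continuousInCharts_meanCurvature_div hr)
  have hv : ∀ r, r ≤ m → Integrable (fun z => meanCurvature f ν r z *
      metric (f z) (X (f z)) (ν z)) (area f) :=
    fun r hr => integrable_of_continuousInCharts H.smooth H.height_pos
      (H.continuousInCharts_meanCurvature_mul hr)
  -- `divergence_eq_sum` needs all roots to be real; this is available at interior points, hence
  -- almost everywhere.
  have hcard : ∀ᵐ z ∂(area f), Multiset.card (shapeOperator f ν z).charpoly.roots = m := by
    refine ae_area H.smooth fun p u hT h0 => ?_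
    obtain ⟨J, hJ, h⟩ := H.shapeOperator_eq_conj ((extChartAt (𝓡∂ m) p).map_target hT)
    rw [h, charpoly_conj hJ, (extChartAt (𝓡∂ m) p).right_inv hT]
    exact (H.localHypersurface hT h0).card_roots_charpoly
  -- The integrated divergence is a polynomial in `t`, and its coefficients are nonzero multiples of
  -- the differences that have to vanish.
  have hpoly : ∀ t : ℝ, ∑ k ∈ Finset.range m, t ^ k * ((k + 1) * m.choose (k + 1) *
      (∫ z, meanCurvature f ν k z / height (f z) ∂(area f)
        - ∫ z, meanCurvature f ν (k + 1) z * metric (f z) (X (f z)) (ν z) ∂(area f))) = 0 := by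
    intro t
    rw [← integral_divergence_eq_zero H hθ t, integral_congr_ae (g := fun z =>
      ∑ k ∈ Finset.range m, t ^ k * ((k + 1) * m.choose (k + 1) *
      (meanCurvature f ν k z / height (f z)
        - meanCurvature f ν (k + 1) z * metric (f z) (X (f z)) (ν z)))) (by
      filter_upwards [hcard] with z hz
      rw [divergence_eq_sum hz]
      rfl), integral_finsetSum]
    · refine Finset.sum_congr rfl fun k hk => ?_
      have hk' := Finset.mem_range.1 hk
      rw [integral_const_mul, integral_const_mul, integral_sub (hu k hk'.le) (hv (k + 1) hk')]
    · intro k hk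
      have hk' := Finset.mem_range.1 hk
      exact (((hu k hk'.le).sub (hv (k + 1) hk')).const_mul _).const_mul _
  have h := coeff_eq_zero_of_forall_sum_eq_zero hpoly hk
  have hc : ((k : ℝ) + 1) * (m.choose (k + 1) : ℝ) ≠ 0 :=
    mul_ne_zero (by positivity) (by exact_mod_cast (Nat.choose_pos hk).ne')
  exact sub_eq_zero.1 ((mul_eq_zero.1 h).resolve_left hc)

end Integral

end HalfSpace

end

/-! ### The main theorem. -/

theorem proposition5p2 {m : ℕ} [NeZero m] {M : Type*} [TopologicalSpace M] [T2Space M]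
    [CompactSpace M] [ChartedSpace (EuclideanHalfSpace m) M] [IsManifold (𝓡∂ m) ∞ M]
    [MeasurableSpace M] [BorelSpace M] (f ν : M → HalfSpace.Coord m)
    (hf : HalfSpace.IsHypersurface f ν) (θ : ℝ) (hθ : θ ∈ Set.Icc 0 (Real.pi / 2))
    (horth : HalfSpace.MeetsOrthogonally f ν θ) (k : ℕ) (hk : 1 ≤ k) (hkm : k ≤ m) :
    Integrable (fun p => HalfSpace.meanCurvature f ν (k - 1) p / HalfSpace.height (f p))
        (HalfSpace.area f) ∧
      Integrable (fun p => HalfSpace.meanCurvature f ν k p *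
        HalfSpace.metric (f p) (HalfSpace.X (f p)) (ν p)) (HalfSpace.area f) ∧
      ∫ p, HalfSpace.meanCurvature f ν (k - 1) p / HalfSpace.height (f p) ∂(HalfSpace.area f) =
        ∫ p, HalfSpace.meanCurvature f ν k p *
          HalfSpace.metric (f p) (HalfSpace.X (f p)) (ν p) ∂(HalfSpace.area f) := by
  obtain ⟨j, rfl⟩ : ∃ j, k = j + 1 := ⟨k - 1, by omega⟩
  rw [Nat.add_sub_cancel]
  exact ⟨HalfSpace.integrable_of_continuousInCharts hf.smooth hf.height_pos
      (hf.continuousInCharts_meanCurvature_div (by omega)),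
    HalfSpace.integrable_of_continuousInCharts hf.smooth hf.height_pos
      (hf.continuousInCharts_meanCurvature_mul hkm),
    HalfSpace.integral_meanCurvature_div_height hf horth (by omega)⟩
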